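/- Let $(S,\mathfrak n)$ be a commutative noetherian local ring, let $\omega\in\mathfrak n$ be a non-zerodivisor and let $R=S/(\omega)$. For a commutative noetherian ring $A$ let $\mathcal G(A)$ be the category of finitely generated Gorenstein projective $A$-modules, i.e. finitely generated $A$-modules $M$ for which the biduality map $M\to \operatorname{Hom}_A(\operatorname{Hom}_A(M,A),A)$ is an isomorphism and $\operatorname{Ext}^i_A(M,A)=0=\operatorname{Ext}^i_A(\operatorname{Hom}_A(M,A),A)$ for all $i\ge 1$; its conflations are the short exact sequences with terms in $\mathcal G(A)$. Let $\mathsf{Mon}(\omega,\mathcal G)$ be the category whose objects are the injective $S$-linear maps $f\colon G_1\to G_0$ with $G_1,G_0\in\mathcal G(S)$ and $\omega\operatorname{Coker} f=0$, and whose morphisms are the commutative squares $(\varphi_1,\varphi_0)$; its conflations are the sequences of such objects that are short exact both on sources and on targets. A Gorenstein projective precover of an $S$-module $M$ is an $S$-linear map $G\to M$ with $G\in\mathcal G(S)$ such that $\operatorname{Hom}_S(G',G)\to\operatorname{Hom}_S(G',M)$ is surjective for every $G'\in\mathcal G(S)$. **Theorem.** The exact categories $\mathcal G(R)$ and $\mathsf{Mon}(\omega,\mathcal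 G)$ are Frobenius categories; let $\underline{\mathcal G}(R)$ and $\underline{\mathsf{Mon}}(\omega,\mathcal G)$ be their stable categories (morphisms modulo those which factor through a projective object), with Happel's suspension functors and distinguished triangles. Every $M\in\mathcal G(R)$ admits a short exact sequence of $S$-modules $0\to P_M\xrightarrow{g_M} G_M\xrightarrow{\pi_M} M\to 0$ in which $P_M$ is a finitely generated projective $S$-module, $\pi_M$ is a Gorenstein projective precover, and hence $(P_M\xrightarrow{g_M} G_M)\in\mathsf{Mon}(\omega,\mathcal G)$. For every choice of such sequences there is a fully faithful triangle functor $$\underline T\colon \underline{\mathcal G}(R)\longrightarrow \underline{\mathsf{Mon}}(\omega,\mathcal G)$$ such that $\underline T(M)=(P_M\xrightarrow{g_M}G_M)$ for every $M\in\mathcal G(R)$, and such that for every $R$-linear map $f\colon M\to M'$ in $\mathcal G(R)$ and every morphism $\varphi=(\varphi_1,\varphi_0)\colon (P_M\to G_M)\to(P_{M'}\to G_{M'})$ with $\pi_{M'}\varphi_0=f\pi_M$, $\underline T$ sends the class of $f$ to the class of $\varphi$. Here a triangle functor is an additive functor together with a natural isomorphism $\underline T\Sigma\cong\Sigma\underline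 T$ through which it sends distinguished triangles to distinguished triangles. Moreover, for every short exact sequence $0\to M'\xrightarrow{f}M\xrightarrow{g}M''\to0$ in $\mathcal G(R)$ there is a conflation $X'\to X\to X''$ in $\mathsf{Mon}(\omega,\mathcal G)$ whose image in $\underline{\mathsf{Mon}}(\omega,\mathcal G)$ is isomorphic to $\underline T(M')\xrightarrow{\underline T(f)}\underline T(M)\xrightarrow{\underline T(g)}\underline T(M'')$. -/

import Mathlib

open CategoryTheory CategoryTheory.Limits

universe w v u

/-! ## Exact categories, Frobenius categories and their stable categories -/

namespace FrobeniusExact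

section General

variable {C : Type u} [Category.{v} C] [Preadditive C]

/-! Throughout, `E` is a class of short complexes `X ⟶ Y ⟶ Z`, called conflations. -/
variable (E : ObjectProperty (ShortComplex C))

/-- An inflation (admissible monic): the first map of a conflation. -/
def IsInflation {X Y : C} (i : X ⟶ Y) : Prop :=
  ∃ (Z : C) (p : Y ⟶ Z) (zero : i ≫ p = 0), E (ShortComplex.mk i p zero)

/-- A deflation (admissible epic): the second map of a conflation. -/
def IsDeflation {Y Z : C} (p : Y ⟶ Z) : Prop :=
  ∃ (X : C) (i : X ⟶ Y) (zero : i ≫ p = 0), E (ShortComplex.mk i p zero)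

/-- `(C, E)` is an exact category in the sense of Quillen: `C` is additive, `E` is an
isomorphism closed class of kernel-cokernel pairs, and the axioms (E0), (E0ᵒᵖ), (E1), (E1ᵒᵖ),
(E2), (E2ᵒᵖ) hold. -/
structure IsExactStructure : Prop where
  hasFiniteBiproducts : HasFiniteBiproducts C
  isKernel : ∀ T : ShortComplex C, E T → Nonempty (IsLimit (KernelFork.ofι T.f T.zero))
  isCokernel : ∀ T : ShortComplex C, E T → Nonempty (IsColimit (CokernelCofork.ofπ T.g T.zero))
  of_iso : ∀ T T' : ShortComplex C, Nonempty (T ≅ T') → E T → E T'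
  id_inflation : ∀ X : C, IsInflation E (𝟙 X)
  id_deflation : ∀ X : C, IsDeflation E (𝟙 X)
  comp_inflation : ∀ {X Y Z : C} (i : X ⟶ Y) (j : Y ⟶ Z),
    IsInflation E i → IsInflation E j → IsInflation E (i ≫ j)
  comp_deflation : ∀ {X Y Z : C} (p : X ⟶ Y) (q : Y ⟶ Z),
    IsDeflation E p → IsDeflation E q → IsDeflation E (p ≫ q)
  pushout : ∀ {X Y X' : C} (i : X ⟶ Y) (f : X ⟶ X'), IsInflation E i →
    ∃ (Y' : C) (g : Y ⟶ Y') (i' : X' ⟶ Y'), IsPushout i f g i' ∧ IsInflation E i'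
  pullback : ∀ {Y Z Z' : C} (p : Y ⟶ Z) (f : Z' ⟶ Z), IsDeflation E p →
    ∃ (Y' : C) (g : Y' ⟶ Y) (p' : Y' ⟶ Z'), IsPullback g p' p f ∧ IsDeflation E p'

/-- Projective objects of an exact category: they lift along deflations. -/
def IsProjective (P : C) : Prop :=
  ∀ ⦃Y Z : C⦄ (p : Y ⟶ Z), IsDeflation E p → ∀ g : P ⟶ Z, ∃ h : P ⟶ Y, h ≫ p = g

/-- Injective objects of an exact category: they extend along inflations. -/
def IsInjective (I : C) : Prop :=
  ∀ ⦃X Y : C⦄ (i : X ⟶ Y), IsInflation E i → ∀ g : X ⟶ I, ∃ h : Y ⟶ I, i ≫ h = g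

/-- A Frobenius category: an exact category with enough projectives and enough injectives,
in which projective and injective objects coincide. -/
structure IsFrobenius : Prop where
  exact : IsExactStructure E
  enough_projectives : ∀ X : C, ∃ T : ShortComplex C, E T ∧ T.X₃ = X ∧ IsProjective E T.X₂
  enough_injectives : ∀ X : C, ∃ T : ShortComplex C, E T ∧ T.X₁ = X ∧ IsInjective E T.X₂
  projective_iff_injective : ∀ X : C, IsProjective E X ↔ IsInjective E X

/-- The morphism `f` factors through a projective object. -/
def FactorsThroughProjective {X Y : C} (f : X ⟶ Y) : Prop :=
  ∃ (P : C) (a : X ⟶ P) (b : P ⟶ Y), IsProjective E P ∧ a ≫ b = f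

/-- The group of morphisms `X ⟶ Y` generated by those which factor through a projective object.
In an additive category every element of it factors through a projective object, see
`mem_projIdeal_iff`. -/
def projIdeal (X Y : C) : AddSubgroup (X ⟶ Y) :=
  AddSubgroup.closure {f | FactorsThroughProjective E f}

lemma projIdeal_comp_left {X Y Z : C} (f : X ⟶ Y) {g : Y ⟶ Z} (hg : g ∈ projIdeal E Y Z) :
    f ≫ g ∈ projIdeal E X Z := by
  have : projIdeal E Y Z ≤ (projIdeal E X Z).comap (Preadditive.leftComp Z f) := by
    rw [projIdeal, AddSubgroup.closure_le]
    rintro k ⟨P, a, b, hP, rfl⟩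
    exact AddSubgroup.subset_closure ⟨P, f ≫ a, b, hP, by simp [Preadditive.leftComp]⟩
  exact this hg

lemma projIdeal_comp_right {X Y Z : C} {f : X ⟶ Y} (g : Y ⟶ Z) (hf : f ∈ projIdeal E X Y) :
    f ≫ g ∈ projIdeal E X Z := by
  have : projIdeal E X Y ≤ (projIdeal E X Z).comap (Preadditive.rightComp X g) := by
    rw [projIdeal, AddSubgroup.closure_le]
    rintro k ⟨P, a, b, hP, rfl⟩
    exact AddSubgroup.subset_closure ⟨P, a, b ≫ g, hP, by simp [Preadditive.rightComp]⟩
  exact this hf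

lemma mem_projIdeal_iff [HasBinaryBiproducts C] [HasZeroObject C] {X Y : C} (f : X ⟶ Y) :
    f ∈ projIdeal E X Y ↔ FactorsThroughProjective E f := by
  refine ⟨fun hf => ?_, fun hf => AddSubgroup.subset_closure hf⟩
  induction hf using AddSubgroup.closure_induction with
  | mem f hf => exact hf
  | zero =>
    open ZeroObject in
    exact ⟨0, 0, 0, fun _ _ _ _ g => ⟨0, (isZero_zero C).eq_of_src _ _⟩, by simp⟩
  | add f g _ _ hf hg =>
    obtain ⟨P, a, b, hP, rfl⟩ := hf
    obtain ⟨Q, c, d, hQ, rfl⟩ := hg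
    refine ⟨P ⊞ Q, biprod.lift a c, biprod.desc b d, fun Y Z p hp g => ?_, by simp⟩
    obtain ⟨h, hh⟩ := hP p hp (biprod.inl ≫ g)
    obtain ⟨k, hk⟩ := hQ p hp (biprod.inr ≫ g)
    exact ⟨biprod.desc h k, by ext <;> simp [hh, hk]⟩
  | neg f _ hf =>
    obtain ⟨P, a, b, hP, rfl⟩ := hf
    exact ⟨P, -a, b, hP, by simp⟩

/-- Two parallel morphisms are identified in the stable category when their difference factors
through a projective object. -/
def stableRel : HomRel C := fun X Y f g => f - g ∈ projIdeal E X Y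

instance : Congruence (stableRel E) where
  equivalence := by
    refine ⟨fun f => by simp [stableRel], fun {f g} h => ?_, fun {f g k} h h' => ?_⟩
    · simpa [stableRel] using (projIdeal E _ _).neg_mem h
    · simpa [stableRel] using (projIdeal E _ _).add_mem h h'
  comp_left f g g' h := by
    simpa [stableRel, Preadditive.comp_sub] using projIdeal_comp_left E f h
  comp_right g h := by
    simpa [stableRel, Preadditive.sub_comp] using projIdeal_comp_right E g h

/-- The stable category: the objects are those of `C`, and a morphism is a morphism of `C` modulo
the morphisms which factor through a projective object. -/
abbrev Stable := CategoryTheory.Quotient (stableRel E)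

/-- The quotient functor from `C` to its stable category. -/
abbrev toStable : C ⥤ Stable E := CategoryTheory.Quotient.functor (stableRel E)

instance : Preadditive (Stable E) :=
  CategoryTheory.Quotient.preadditive (stableRel E) (fun X Y f₁ f₂ g₁ g₂ h h' => by
    have := (projIdeal E X Y).add_mem h h'
    simpa [stableRel, sub_add_sub_comm] using this)

/-! ### The suspension functor -/

/-- A choice, for every object `X`, of a conflation `X ⟶ I X ⟶ ΣX` with `I X` injective. -/
structure InjectiveEmbeddings where
  I : C → C
  susp : C → C
  ι : ∀ X, X ⟶ I X
  π : ∀ X, I X ⟶ susp X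
  zero : ∀ X, ι X ≫ π X = 0
  conflation : ∀ X, E (ShortComplex.mk (ι X) (π X) (zero X))
  injective : ∀ X, IsInjective E (I X)

variable {E}

namespace InjectiveEmbeddings

variable (D : InjectiveEmbeddings E)

lemma inflation (X : C) : IsInflation E (D.ι X) := ⟨_, _, _, D.conflation X⟩

lemma exists_susp (hE : IsExactStructure E) {X Y : C} (f : X ⟶ Y) :
    ∃ (j : D.I X ⟶ D.I Y) (s : D.susp X ⟶ D.susp Y),
      D.ι X ≫ j = f ≫ D.ι Y ∧ D.π X ≫ s = j ≫ D.π Y := by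
  obtain ⟨j, hj⟩ := D.injective Y (D.ι X) (D.inflation X) (f ≫ D.ι Y)
  obtain ⟨hc⟩ := hE.isCokernel _ (D.conflation X)
  obtain ⟨s, hs⟩ := CokernelCofork.IsColimit.desc' hc (j ≫ D.π Y)
    (by simp [reassoc_of% hj, D.zero])
  exact ⟨j, s, hj, hs⟩

/-- A map of conflations extending a stably trivial map is stably trivial on the third terms. -/
lemma susp_mem (h : IsFrobenius E) {X Y : C} {f : X ⟶ Y} (hf : f ∈ projIdeal E X Y)
    {j : D.I X ⟶ D.I Y} {s : D.susp X ⟶ D.susp Y}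
    (hj : D.ι X ≫ j = f ≫ D.ι Y) (hs : D.π X ≫ s = j ≫ D.π Y) :
    s ∈ projIdeal E (D.susp X) (D.susp Y) := by
  have hB := h.exact.hasFiniteBiproducts
  have hB2 : HasBinaryBiproducts C := hasBinaryBiproducts_of_finite_biproducts C
  have hZ : HasZeroObject C := hasZeroObject_of_hasTerminal_object
  obtain ⟨Q, a, b, hQ, rfl⟩ := (mem_projIdeal_iff E f).1 hf
  obtain ⟨c, hc⟩ := (h.projective_iff_injective Q).1 hQ (D.ι X) (D.inflation X) a
  obtain ⟨hcok⟩ := h.exact.isCokernel _ (D.conflation X)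
  obtain ⟨t, ht⟩ := CokernelCofork.IsColimit.desc' hcok (j - c ≫ b ≫ D.ι Y)
    (by simp [Preadditive.comp_sub, hj, reassoc_of% hc])
  refine AddSubgroup.subset_closure ⟨D.I Y, t, D.π Y,
    (h.projective_iff_injective _).2 (D.injective Y), ?_⟩
  refine Cofork.IsColimit.hom_ext hcok ?_
  change D.π X ≫ t ≫ D.π Y = D.π X ≫ s
  replace ht : D.π X ≫ t = _ := ht
  rw [reassoc_of% ht, hs]
  simp [Preadditive.sub_comp, D.zero]

lemma susp_unique (h : IsFrobenius E) {X Y : C} {f f' : X ⟶ Y} (hf : stableRel E f f')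
    {j j' : D.I X ⟶ D.I Y} {s s' : D.susp X ⟶ D.susp Y}
    (hj : D.ι X ≫ j = f ≫ D.ι Y) (hs : D.π X ≫ s = j ≫ D.π Y)
    (hj' : D.ι X ≫ j' = f' ≫ D.ι Y) (hs' : D.π X ≫ s' = j' ≫ D.π Y) :
    (toStable E).map s = (toStable E).map s' := by
  refine CategoryTheory.Quotient.sound _ (D.susp_mem h hf (j := j - j') ?_ ?_)
  · simp [Preadditive.comp_sub, Preadditive.sub_comp, hj, hj']
  · simp [Preadditive.comp_sub, Preadditive.sub_comp, hs, hs']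

/-- The suspension functor of the stable category: it sends `X` to `ΣX` and the class of
`f : X ⟶ Y` to the class of the map `ΣX ⟶ ΣY` induced by any extension `I X ⟶ I Y` of `f`. -/
noncomputable def suspension (h : IsFrobenius E) : Stable E ⥤ Stable E :=
  CategoryTheory.Quotient.lift (stableRel E)
    { obj := fun X => (toStable E).obj (D.susp X)
      map := fun f => (toStable E).map (D.exists_susp h.exact f).choose_spec.choose
      map_id := fun X => by
        obtain ⟨h₁, h₂⟩ := (D.exists_susp h.exact (𝟙 X)).choose_spec.choose_spec
        rw [← (toStable E).map_id]
        exact D.susp_unique h (f := 𝟙 X) (f' := 𝟙 X) (by simp [stableRel]) h₁ h₂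
          (j' := 𝟙 _) (by simp) (by simp)
      map_comp := fun {X Y Z} f g => by
        obtain ⟨h₁, h₂⟩ := (D.exists_susp h.exact f).choose_spec.choose_spec
        obtain ⟨h₃, h₄⟩ := (D.exists_susp h.exact g).choose_spec.choose_spec
        obtain ⟨h₅, h₆⟩ := (D.exists_susp h.exact (f ≫ g)).choose_spec.choose_spec
        rw [← (toStable E).map_comp]
        exact D.susp_unique h (f := f ≫ g) (f' := f ≫ g) (by simp [stableRel]) h₅ h₆
          (j' := (D.exists_susp h.exact f).choose ≫ (D.exists_susp h.exact g).choose)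
          (by rw [reassoc_of% h₁, h₃, Category.assoc])
          (by rw [reassoc_of% h₂, h₄, Category.assoc]) }
    (fun X Y f f' hf => by
      obtain ⟨h₁, h₂⟩ := (D.exists_susp h.exact f).choose_spec.choose_spec
      obtain ⟨h₃, h₄⟩ := (D.exists_susp h.exact f').choose_spec.choose_spec
      exact D.susp_unique h hf h₁ h₂ h₃ h₄)

/-- The value of the suspension functor on the class of `f` may be computed with any map of
conflations extending `f`. -/
lemma suspension_map_eq (h : IsFrobenius E) {X Y : C} (f : X ⟶ Y)
    {j : D.I X ⟶ D.I Y} {s : D.susp X ⟶ D.susp Y}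
    (hj : D.ι X ≫ j = f ≫ D.ι Y) (hs : D.π X ≫ s = j ≫ D.π Y) :
    (D.suspension h).map ((toStable E).map f) = (toStable E).map s := by
  obtain ⟨h₁, h₂⟩ := (D.exists_susp h.exact f).choose_spec.choose_spec
  exact D.susp_unique h (f := f) (f' := f) (by simp [stableRel]) h₁ h₂ hj hs

/-! ### Distinguished triangles and triangle functors -/

/-- The distinguished triangles `X ⟶ Y ⟶ Z ⟶ ΣX` of the stable category of a Frobenius category:
those isomorphic to a standard triangle `A ⟶ B ⟶ K ⟶ ΣA`. The standard triangle of `f : A ⟶ B` is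
given by the pushout `K` of `f` and `ι A : A ⟶ I A`, with `K ⟶ ΣA` the map which vanishes on `B` and
restricts to `π A` on `I A`. -/
def IsDistinguished (h : IsFrobenius E) {X Y Z : Stable E}
    (a : X ⟶ Y) (b : Y ⟶ Z) (c : Z ⟶ (D.suspension h).obj X) : Prop :=
  ∃ (A B K : C) (f : A ⟶ B) (g : B ⟶ K) (j : D.I A ⟶ K) (k : K ⟶ D.susp A),
    IsPushout f (D.ι A) g j ∧ g ≫ k = 0 ∧ j ≫ k = D.π A ∧
    ∃ (x : X ≅ (toStable E).obj A) (y : Y ≅ (toStable E).obj B) (z : Z ≅ (toStable E).obj K),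
      a ≫ y.hom = x.hom ≫ (toStable E).map f ∧
      b ≫ z.hom = y.hom ≫ (toStable E).map g ∧
      c ≫ (D.suspension h).map x.hom = z.hom ≫ (toStable E).map k

end InjectiveEmbeddings

/-- `T` is a triangle functor between the stable categories of two Frobenius categories: it is
additive, and there is a natural isomorphism `ξ : TΣ ≅ ΣT` such that `T` sends every distinguished
triangle `(a, b, c)` to the distinguished triangle `(T a, T b, ξ ∘ T c)`. -/
def IsTriangleFunctor {C' : Type w} [Category.{v} C'] [Preadditive C']
    {E' : ObjectProperty (ShortComplex C')}
    (h : IsFrobenius E) (D : InjectiveEmbeddings E)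
    (h' : IsFrobenius E') (D' : InjectiveEmbeddings E') (T : Stable E ⥤ Stable E') : Prop :=
  T.Additive ∧ ∃ ξ : D.suspension h ⋙ T ≅ T ⋙ D'.suspension h',
    ∀ ⦃X Y Z : Stable E⦄ (a : X ⟶ Y) (b : Y ⟶ Z) (c : Z ⟶ (D.suspension h).obj X),
      D.IsDistinguished h a b c →
      D'.IsDistinguished h' (T.map a) (T.map b) (T.map c ≫ ξ.hom.app X)

end General

end FrobeniusExact

/-! ## Gorenstein projective modules and the monomorphism category -/

namespace GorensteinMono

open FrobeniusExact

/-- Finitely generated Gorenstein projective modules over a commutative ring `A`: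
`M` is finitely generated, the biduality map `M ⟶ Hom(Hom(M, A), A)` is an isomorphism, and
`Ext^i(M, A) = 0 = Ext^i(Hom(M, A), A)` for all `i ≥ 1`. -/
structure IsGorensteinProjective {A : Type u} [CommRing A] (M : ModuleCat.{u} A) : Prop where
  finite : Module.Finite A M
  reflexive : Module.IsReflexive A M
  ext_eq_zero : ∀ i : ℕ, 1 ≤ i → Subsingleton (Abelian.Ext M (ModuleCat.of A A) i)
  ext_dual_eq_zero : ∀ i : ℕ, 1 ≤ i →
    Subsingleton (Abelian.Ext (ModuleCat.of A (Module.Dual A M)) (ModuleCat.of A A) i)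

/-- The property of being a finitely generated Gorenstein projective `A`-module. -/
def gorensteinProjective (A : Type u) [CommRing A] : ObjectProperty (ModuleCat.{u} A) :=
  fun M => IsGorensteinProjective M

/-- The category of finitely generated Gorenstein projective `A`-modules. -/
abbrev GProj (A : Type u) [CommRing A] := (gorensteinProjective A).FullSubcategory

/-- The conflations of `GProj A`: the short exact sequences of `A`-modules with terms in
`GProj A`. -/
def gprojConflations (A : Type u) [CommRing A] : ObjectProperty (ShortComplex (GProj A)) :=
  fun T => (T.map (gorensteinProjective A).ι).ShortExact

section Mon

variable {S : Type u} [CommRing S] (ω : S)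

/-- Injective maps `G₁ ⟶ G₀` between finitely generated Gorenstein projective `S`-modules, with
cokernel annihilated by `ω`. -/
structure IsMonObject (f : Arrow (ModuleCat.{u} S)) : Prop where
  left : IsGorensteinProjective f.left
  right : IsGorensteinProjective f.right
  injective : Function.Injective f.hom
  smul_coker : ∀ y : f.right ⧸ LinearMap.range f.hom.hom, ω • y = 0

/-- The property of being an object of `Mon(ω, 𝒢)`. -/
def monProperty : ObjectProperty (Arrow (ModuleCat.{u} S)) := fun f => IsMonObject ω f

/-- The monomorphism category `Mon(ω, 𝒢)`, with commutative squares as morphisms. -/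
abbrev Mon := (monProperty ω).FullSubcategory

/-- The conflations of `Mon(ω, 𝒢)`: the sequences `0 ⟶ X' ⟶ X ⟶ X'' ⟶ 0` which are short exact in
the category of morphisms of `S`-modules, i.e. short exact on sources and on targets. -/
def monConflations : ObjectProperty (ShortComplex (Mon ω)) := fun T =>
  (T.map ((monProperty ω).ι ⋙ Arrow.leftFunc)).ShortExact ∧
  (T.map ((monProperty ω).ι ⋙ Arrow.rightFunc)).ShortExact

/-- The factor ring `R = S/(ω)`. -/
abbrev FactorRing := S ⧸ Ideal.span {ω}

/-- An `R`-module viewed as an `S`-module. -/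
noncomputable abbrev resS : ModuleCat.{u} (FactorRing ω) ⥤ ModuleCat.{u} S :=
  ModuleCat.restrictScalars (Ideal.Quotient.mk (Ideal.span {ω}))

/-- A short exact sequence of `S`-modules `0 ⟶ P ⟶ G ⟶ M ⟶ 0` in which `P ⟶ G` is an object of
`Mon(ω, 𝒢)`, `P` is projective and `G ⟶ M` is a Gorenstein projective precover of the
`R`-module `M`. -/
structure PrecoverSequence (M : ModuleCat.{u} (FactorRing ω)) where
  obj : Mon ω
  projective : Module.Projective S obj.obj.left
  π : obj.obj.right ⟶ (resS ω).obj M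
  zero : obj.obj.hom ≫ π = 0
  exact : (ShortComplex.mk obj.obj.hom π zero).ShortExact
  precover : ∀ G : ModuleCat.{u} S, IsGorensteinProjective G →
    ∀ g : G ⟶ (resS ω).obj M, ∃ g' : G ⟶ obj.obj.right, g' ≫ π = g

/-- The morphism `φ = (φ₁, φ₀)` of `Mon(ω, 𝒢)` lifts the map of `R`-modules `f : M ⟶ M'`. -/
def IsLiftOf {ω : S} {M M' : ModuleCat.{u} (FactorRing ω)} (c : PrecoverSequence ω M)
    (c' : PrecoverSequence ω M') (f : M ⟶ M') (φ : c.obj ⟶ c'.obj) : Prop :=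
  φ.hom.right ≫ c'.π = c.π ≫ (resS ω).map f

end Mon

end GorensteinMono

open FrobeniusExact GorensteinMono

/-!
An object `f : G₁ ⟶ G₀` of `Mon(ω, 𝒢)` is half of a factorization of `ω`: since `ω` kills the
cokernel there is `g : G₀ ⟶ G₁` with `f g = ω = g f`. A morphism is determined by its component on
targets, and the objects `(1 × ω) : P × Q ⟶ P × Q` with `P`, `Q` finitely generated projective
represent on both sides: maps out of them are pairs `P ⟶ G₁`, `Q ⟶ G₀`, maps into them are pairs
`G₀ ⟶ P`, `G₁ ⟶ Q`. So they are projective and injective, there are enough of them on both sides,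
and `Mon(ω, 𝒢)` is Frobenius (`isFrobenius_mon`). The exact structures of `𝒢(R)` and of
`Mon(ω, 𝒢)` are both obtained from `IsConflationClosed.isExactStructure`, applied in the category of
modules and in its abelian category of arrows.

Precover sequences are produced from an embedding `M ⊆ Rⁿ` with Gorenstein projective cokernel
`N`: the preimage `G` of `M` in `Sⁿ` is the first syzygy over `S` of `N`, it is Gorenstein projective
over `S`, and `0 ⟶ Sⁿ ⟶ G ⟶ M ⟶ 0`, with first map the multiplication by `ω`, is the sequence wanted
(`nonempty_precoverSequence`). That `G` is Gorenstein projective holds because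
a presentation or a copresentation of `N` over `R` induces one of its `S`-syzygy, along which
functionals extend (`exists_syzygy_sequence`, `gp_syzygy`, `GP.of_class`). The map `G ⟶ M` is
a precover because its kernel is projective (`IsSES.lift_of_projective`).

Morphisms `M ⟶ M'` lift to the chosen sequences; a lift of zero factors through `1 : P' ⟶ P'`, and a
lift of a morphism which factors through a projective `R`-module factors through some `ω : Sⁿ ⟶ Sⁿ`
up to a lift of zero. Conversely, a morphism between precover sequences induces one on cokernels, and
the cokernel of `(1 × ω)` is a free `R`-module. This gives a well-defined, full and faithful
functor (`precoverFunctor`).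

For the triangles, a conflation of `𝒢(R)` lifts to a conflation of precover sequences once a trivial
object `1 : P'' ⟶ P''` is added to the middle term (`exists_conflation_lift`). Lifting
`M ⟶ I M ⟶ ΣM` and comparing the result with the suspension conflation of the image of `M` gives the
isomorphism `TΣ ≅ ΣT` (`suspComparison`), which by `IsFrobenius.third_unique` is computed by any other
lifted conflation (`suspComparison_unique`), which gives its naturality. As the distinguished
triangles are exactly those of conflations, with third morphism the negative of the connecting
one (`InjectiveEmbeddings.isDistinguished_of_conflation` and
`InjectiveEmbeddings.IsDistinguished.exists_conflation`), the functor preserves them.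
-/

/-! ### Frobenius categories -/

namespace FrobeniusExact

variable {C : Type u} [Category.{v} C] [Preadditive C] {E : ObjectProperty (ShortComplex C)}

lemma toStable_map_eq_iff {X Y : C} (f g : X ⟶ Y) :
    (toStable E).map f = (toStable E).map g ↔ f - g ∈ projIdeal E X Y :=
  CategoryTheory.Quotient.functor_map_eq_iff (stableRel E) f g

instance : (toStable E).Additive where
  map_add := rfl

lemma IsProjective.of_retract {P Q : C} (hQ : IsProjective E Q) (i : P ⟶ Q) (r : Q ⟶ P)
    (h : i ≫ r = 𝟙 P) : IsProjective E P := fun _ _ p hp g => by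
  obtain ⟨k, hk⟩ := hQ p hp (r ≫ g)
  exact ⟨i ≫ k, by rw [Category.assoc, hk, reassoc_of% h]⟩

lemma IsInjective.of_retract {P Q : C} (hQ : IsInjective E Q) (i : P ⟶ Q) (r : Q ⟶ P)
    (h : i ≫ r = 𝟙 P) : IsInjective E P := fun _ _ p hp g => by
  obtain ⟨k, hk⟩ := hQ p hp (g ≫ i)
  exact ⟨k ≫ r, by rw [reassoc_of% hk, h, Category.comp_id]⟩

/-- An exact category is Frobenius once it has, on both sides, enough objects from a class of
objects which are at the same time projective and injective. -/
lemma IsFrobenius.of_class (hE : IsExactStructure E) (𝒬 : ObjectProperty C)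
    (hproj : ∀ X, 𝒬 X → IsProjective E X) (hinj : ∀ X, 𝒬 X → IsInjective E X)
    (enoughP : ∀ X, ∃ T : ShortComplex C, E T ∧ T.X₃ = X ∧ 𝒬 T.X₂)
    (enoughI : ∀ X, ∃ T : ShortComplex C, E T ∧ T.X₁ = X ∧ 𝒬 T.X₂) : IsFrobenius E where
  exact := hE
  enough_projectives X := by
    obtain ⟨T, hT, h, h'⟩ := enoughP X
    exact ⟨T, hT, h, hproj _ h'⟩
  enough_injectives X := by
    obtain ⟨T, hT, h, h'⟩ := enoughI X
    exact ⟨T, hT, h, hinj _ h'⟩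
  projective_iff_injective X := by
    constructor
    · intro hX
      obtain ⟨T, hT, rfl, h'⟩ := enoughP X
      obtain ⟨s, hs⟩ := hX T.g ⟨_, _, _, hT⟩ (𝟙 _)
      exact (hinj _ h').of_retract s T.g hs
    · intro hX
      obtain ⟨T, hT, rfl, h'⟩ := enoughI X
      obtain ⟨s, hs⟩ := hX T.f ⟨_, _, _, hT⟩ (𝟙 _)
      exact (hproj _ h').of_retract T.f s hs

lemma IsFrobenius.factors_of_mem (h : IsFrobenius E) {X Y : C} {f : X ⟶ Y}
    (hf : f ∈ projIdeal E X Y) : FactorsThroughProjective E f := by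
  have hB := h.exact.hasFiniteBiproducts
  have hB2 : HasBinaryBiproducts C := hasBinaryBiproducts_of_finite_biproducts C
  have hZ : HasZeroObject C := hasZeroObject_of_hasTerminal_object
  exact (mem_projIdeal_iff E f).1 hf

lemma IsFrobenius.isProjective_of_id_mem (h : IsFrobenius E) {X : C}
    (hX : 𝟙 X ∈ projIdeal E X X) : IsProjective E X := by
  obtain ⟨P, a, b, hP, hab⟩ := h.factors_of_mem hX
  exact hP.of_retract a b hab

/-- A morphism into the source of a conflation with injective middle term extends to a morphism
of conflations. -/
lemma IsExactStructure.exists_hom (h : IsExactStructure E) {T T' : ShortComplex C} (hT : E T)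
    (hI : IsInjective E T'.X₂) (a : T.X₁ ⟶ T'.X₁) : ∃ φ : T ⟶ T', φ.τ₁ = a := by
  obtain ⟨j, hj⟩ := hI T.f ⟨_, _, _, hT⟩ (a ≫ T'.f)
  obtain ⟨hc⟩ := h.isCokernel _ hT
  obtain ⟨s, hs⟩ := CokernelCofork.IsColimit.desc' hc (j ≫ T'.g) (by simp [reassoc_of% hj])
  exact ⟨⟨a, j, s, hj.symm, hs.symm⟩, rfl⟩

lemma IsExactStructure.hom_ext_g (h : IsExactStructure E) {T : ShortComplex C} (hT : E T) {W : C}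
    {a b : T.X₃ ⟶ W} (hab : T.g ≫ a = T.g ≫ b) : a = b := by
  obtain ⟨hc⟩ := h.isCokernel _ hT
  exact Cofork.IsColimit.hom_ext hc hab

/-- Morphisms from a conflation to one with injective middle term are determined stably on the
third terms by their values on the first terms. -/
lemma IsFrobenius.third_unique (h : IsFrobenius E) {T T' : ShortComplex C} (hT : E T)
    (hI : IsInjective E T'.X₂) (φ φ' : T ⟶ T')
    (hφ : (toStable E).map φ.τ₁ = (toStable E).map φ'.τ₁) :
    (toStable E).map φ.τ₃ = (toStable E).map φ'.τ₃ := by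
  rw [toStable_map_eq_iff] at hφ ⊢
  obtain ⟨Q, a, b, hQ, hab⟩ := h.factors_of_mem hφ
  obtain ⟨c, hc⟩ := (h.projective_iff_injective Q).1 hQ T.f ⟨_, _, _, hT⟩ a
  obtain ⟨hcok⟩ := h.exact.isCokernel _ hT
  obtain ⟨t, ht⟩ := CokernelCofork.IsColimit.desc' hcok (φ.τ₂ - φ'.τ₂ - c ≫ b ≫ T'.f) (by
    simp [Preadditive.comp_sub, reassoc_of% hc, reassoc_of% hab, ← φ.comm₁₂, ← φ'.comm₁₂,
      Preadditive.sub_comp])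
  refine AddSubgroup.subset_closure ⟨T'.X₂, t, T'.g, (h.projective_iff_injective _).2 hI, ?_⟩
  refine h.exact.hom_ext_g hT ?_
  replace ht : T.g ≫ t = _ := ht
  rw [reassoc_of% ht]
  simp [Preadditive.sub_comp, Preadditive.comp_sub, φ.comm₂₃, φ'.comm₂₃]

/-- The standard suspension conflation `X ⟶ I X ⟶ ΣX`. -/
abbrev InjectiveEmbeddings.complex (D : InjectiveEmbeddings E) (X : C) : ShortComplex C :=
  ShortComplex.mk (D.ι X) (D.π X) (D.zero X)

namespace InjectiveEmbeddings

variable (D : InjectiveEmbeddings E)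

lemma suspension_map_of_hom (h : IsFrobenius E) {X Y : C} (φ : D.complex X ⟶ D.complex Y) :
    (D.suspension h).map ((toStable E).map φ.τ₁) = (toStable E).map φ.τ₃ :=
  D.suspension_map_eq h φ.τ₁ φ.comm₁₂.symm φ.comm₂₃.symm

/-- The triangle of a conflation `T`: if `φ` is a morphism from `T` to the suspension conflation
of its first term, which is the identity on first terms, then `(T.f, T.g, -φ₃)` is
distinguished. -/
lemma isDistinguished_of_conflation (h : IsFrobenius E) {T : ShortComplex C} (hT : E T)
    (φ : T ⟶ D.complex T.X₁) (hφ : φ.τ₁ = 𝟙 _) {X Y Z : Stable E}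
    (a : X ⟶ Y) (b : Y ⟶ Z) (c : Z ⟶ (D.suspension h).obj X)
    (x : X ≅ (toStable E).obj T.X₁) (y : Y ≅ (toStable E).obj T.X₂)
    (z : Z ≅ (toStable E).obj T.X₃)
    (ha : a ≫ y.hom = x.hom ≫ (toStable E).map T.f)
    (hb : b ≫ z.hom = y.hom ≫ (toStable E).map T.g)
    (hc : c ≫ (D.suspension h).map x.hom = -(z.hom ≫ (toStable E).map φ.τ₃)) :
    D.IsDistinguished h a b c := by
  obtain ⟨K, g, j, sq, -⟩ := h.exact.pushout T.f (D.ι T.X₁) ⟨_, _, _, hT⟩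
  have hj : T.f ≫ φ.τ₂ = D.ι T.X₁ := by simpa [hφ] using φ.comm₁₂.symm
  have hd : φ.τ₂ ≫ D.π T.X₁ = T.g ≫ φ.τ₃ := φ.comm₂₃
  -- the pushout `K` differs from `T.X₃` by the injective object `I`, split off by `r`
  let r : K ⟶ D.I T.X₁ := sq.desc φ.τ₂ (𝟙 _) (by simp [hj])
  let q : K ⟶ T.X₃ := sq.desc T.g 0 (by simp)
  let k : K ⟶ D.susp T.X₁ := sq.desc 0 (D.π _) (by simp [D.zero])
  obtain ⟨hcok⟩ := h.exact.isCokernel _ hT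
  obtain ⟨s, hs⟩ : ∃ s : T.X₃ ⟶ K, T.g ≫ s = g - φ.τ₂ ≫ j :=
    ⟨_, (CokernelCofork.IsColimit.desc' hcok (g - φ.τ₂ ≫ j) (by
      simp [Preadditive.comp_sub, reassoc_of% hj, sq.w])).2⟩
  have hsq : s ≫ q = 𝟙 _ := by
    refine h.exact.hom_ext_g hT ?_
    rw [reassoc_of% hs]
    simp [Preadditive.sub_comp, q]
  have hqs : q ≫ s = 𝟙 _ - r ≫ j := by
    apply sq.hom_ext
    · simp [q, r, hs, Preadditive.comp_sub]
    · simp [q, r, Preadditive.comp_sub]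
  have hqd : q ≫ φ.τ₃ = r ≫ D.π _ - k := by
    apply sq.hom_ext
    · simp [q, r, k, hd, Preadditive.comp_sub]
    · simp [q, r, k, Preadditive.comp_sub]
  have hI := (h.projective_iff_injective _).2 (D.injective T.X₁)
  have zero_of_factor : ∀ {U V : C} (u : U ⟶ D.I T.X₁) (v : D.I T.X₁ ⟶ V),
      (toStable E).map (u ≫ v) = 0 := fun u v => by
    rw [← (toStable E).map_zero, toStable_map_eq_iff, sub_zero]
    exact AddSubgroup.subset_closure ⟨_, u, v, hI, rfl⟩
  have hgq : g ≫ q = T.g := sq.inl_desc _ _ _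
  let e : (toStable E).obj T.X₃ ≅ (toStable E).obj K :=
    { hom := (toStable E).map s
      inv := (toStable E).map q
      hom_inv_id := by rw [← Functor.map_comp, hsq, CategoryTheory.Functor.map_id]
      inv_hom_id := by
        rw [← Functor.map_comp, hqs, Functor.map_sub, zero_of_factor, sub_zero,
          CategoryTheory.Functor.map_id] }
  refine ⟨T.X₁, T.X₂, K, T.f, g, j, k, sq, by simp [k], by simp [k], x, y, z ≪≫ e, ha, ?_, ?_⟩
  · rw [Iso.trans_hom, reassoc_of% hb, ← Functor.map_comp, hs, Functor.map_sub, zero_of_factor,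
      sub_zero]
  · have hk : (toStable E).map (s ≫ k) = -(toStable E).map φ.τ₃ := by
      have : s ≫ k = s ≫ r ≫ D.π _ - φ.τ₃ := by
        rw [← Category.id_comp φ.τ₃, ← hsq, Category.assoc, hqd]
        simp [Preadditive.comp_sub]
      rw [this, Functor.map_sub, ← Category.assoc, zero_of_factor, zero_sub]
    rw [hc, Iso.trans_hom, Category.assoc, ← Functor.map_comp, hk, Preadditive.comp_neg]

end InjectiveEmbeddings

/-- Direct sum with an inflation: if `i : X ⟶ Y` is an inflation, so is `(i, f) : X ⟶ Y ⊞ Z`. -/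
lemma IsExactStructure.inflation_lift [HasBinaryBiproducts C] (h : IsExactStructure E)
    {X Y Z : C} (i : X ⟶ Y) (hi : IsInflation E i) (f : X ⟶ Z) :
    IsInflation E (biprod.lift i f) := by
  have hB := h.hasFiniteBiproducts
  have hZ : HasZeroObject C := hasZeroObject_of_hasTerminal_object
  have inf_of_iso : ∀ {A B : C} (a : A ⟶ B) [IsIso a], IsInflation E a := fun {A B} a _ => by
    obtain ⟨Q, p, zero, hp⟩ := h.id_inflation A
    have zero' : a ≫ inv a ≫ p = 0 := by simpa using zero
    exact ⟨Q, inv a ≫ p, zero', h.of_iso (ShortComplex.mk (𝟙 A) p zero)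
      (ShortComplex.mk a (inv a ≫ p) zero')
      ⟨ShortComplex.isoMk (Iso.refl _) (asIso a) (Iso.refl _) (by simp) (by simp)⟩ hp⟩
  -- the coprojection `X ⟶ X ⊞ Z` is a pushout of `0 ⟶ Z`
  have hinl : IsInflation E (biprod.inl : X ⟶ X ⊞ Z) := by
    obtain ⟨K, k, zero, hk⟩ := h.id_deflation Z
    have hk0 : k = 0 := by simpa using zero
    obtain ⟨hker⟩ := h.isKernel _ hk
    have hKZ : IsZero K := by
      rw [IsZero.iff_id_eq_zero]
      exact Fork.IsLimit.hom_ext hker (by simp [hk0])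
    obtain ⟨W, g, i', sq, hi'⟩ := h.pushout (0 : K ⟶ Z) (0 : K ⟶ X) ⟨_, 𝟙 Z, by simp, by
      convert! hk
      exact hk0.symm⟩
    let e : W ⟶ X ⊞ Z := sq.desc biprod.inr biprod.inl (by simp)
    have : IsIso e := ⟨biprod.desc i' g, by apply sq.hom_ext <;> simp [e], by
      apply biprod.hom_ext' <;> simp [e]⟩
    have := h.comp_inflation _ _ hi' (inf_of_iso e)
    simpa [e] using this
  have hmap : IsInflation E (biprod.map i (𝟙 Z)) := by
    obtain ⟨W, g, i', sq, hi'⟩ := h.pushout i (biprod.inl : X ⟶ X ⊞ Z) hi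
    let e : W ⟶ Y ⊞ Z := sq.desc biprod.inl (biprod.map i (𝟙 Z)) (by simp)
    have : IsIso e := ⟨biprod.desc g (biprod.inr ≫ i'), by
      apply sq.hom_ext
      · simp [e]
      · apply biprod.hom_ext' <;> simp [e, sq.w], by
      apply biprod.hom_ext' <;> simp [e]⟩
    have := h.comp_inflation _ _ hi' (inf_of_iso e)
    simpa [e] using this
  have hiso : IsIso (biprod.desc (biprod.lift (𝟙 X) f) biprod.inr : X ⊞ Z ⟶ X ⊞ Z) :=
    ⟨biprod.desc (biprod.lift (𝟙 X) (-f)) biprod.inr, by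
      apply biprod.hom_ext' <;> apply biprod.hom_ext <;> simp, by
      apply biprod.hom_ext' <;> apply biprod.hom_ext <;> simp⟩
  have := h.comp_inflation _ _ (h.comp_inflation _ _ hinl
    (inf_of_iso (biprod.desc (biprod.lift (𝟙 X) f) biprod.inr))) hmap
  have heq : biprod.lift i f = (biprod.inl ≫ biprod.desc (biprod.lift (𝟙 X) f) biprod.inr) ≫
      biprod.map i (𝟙 Z) := by
    apply biprod.hom_ext <;> simp
  rwa [heq]

/-- Every distinguished triangle is isomorphic to the triangle of a conflation, as in
`InjectiveEmbeddings.isDistinguished_of_conflation`. -/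
lemma InjectiveEmbeddings.IsDistinguished.exists_conflation {D : InjectiveEmbeddings E}
    {h : IsFrobenius E} {X Y Z : Stable E} {a : X ⟶ Y} {b : Y ⟶ Z}
    {c : Z ⟶ (D.suspension h).obj X} (hd : D.IsDistinguished h a b c) :
    ∃ (T : ShortComplex C) (_ : E T) (φ : T ⟶ D.complex T.X₁) (_ : φ.τ₁ = 𝟙 _)
      (x : X ≅ (toStable E).obj T.X₁) (y : Y ≅ (toStable E).obj T.X₂)
      (z : Z ≅ (toStable E).obj T.X₃),
      a ≫ y.hom = x.hom ≫ (toStable E).map T.f ∧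
      b ≫ z.hom = y.hom ≫ (toStable E).map T.g ∧
      c ≫ (D.suspension h).map x.hom = -(z.hom ≫ (toStable E).map φ.τ₃) := by
  have hB := h.exact.hasFiniteBiproducts
  have hB2 : HasBinaryBiproducts C := hasBinaryBiproducts_of_finite_biproducts C
  obtain ⟨A, B, K, f, g, j, k, sq, hgk, hjk, x, y, z, ha, hb, hc⟩ := hd
  let T : ShortComplex C := ShortComplex.mk (biprod.lift (D.ι A) f) (biprod.desc (-j) g)
    (by simp [sq.w])
  have hcolim : IsColimit (CokernelCofork.ofπ T.g T.zero) :=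
    CokernelCofork.IsColimit.ofπ _ _
      (fun u hu => sq.desc (biprod.inr ≫ u) (-(biprod.inl ≫ u)) (by
        have : D.ι A ≫ biprod.inl ≫ u + f ≫ biprod.inr ≫ u = 0 := by
          simpa [T, biprod.lift_eq, Preadditive.add_comp] using hu
        rw [Preadditive.comp_neg, eq_neg_iff_add_eq_zero, add_comm, this]))
      (fun u hu => by apply biprod.hom_ext' <;> simp [T])
      (fun u hu m hm => by
        apply sq.hom_ext
        · simp [← hm, T]
        · simp [← hm, T])
  have hT : E T := by
    obtain ⟨Q, p, zero, hp⟩ := h.exact.inflation_lift (D.ι A) (D.inflation A) f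
    obtain ⟨hq⟩ := h.exact.isCokernel _ hp
    let e : Q ≅ K := hq.coconePointUniqueUpToIso hcolim
    have he : p ≫ e.hom = T.g := hq.comp_coconePointUniqueUpToIso_hom hcolim .one
    exact h.exact.of_iso (ShortComplex.mk _ p zero) T
      ⟨ShortComplex.isoMk (Iso.refl _) (Iso.refl _) e (by simp [T]) (by simpa using he.symm)⟩ hp
  have hkf : T.g ≫ k = -(biprod.fst ≫ D.π A) := by
    apply biprod.hom_ext' <;> simp [T, hgk, hjk]
  let φ : T ⟶ D.complex T.X₁ :=
    { τ₁ := 𝟙 _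
      τ₂ := biprod.fst
      τ₃ := -k
      comm₁₂ := by simp [T]
      comm₂₃ := by rw [Preadditive.comp_neg, hkf, neg_neg] }
  have hI := (h.projective_iff_injective _).2 (D.injective A)
  have zero_of_factor : ∀ {U V : C} (u : U ⟶ D.I A) (v : D.I A ⟶ V),
      (toStable E).map (u ≫ v) = 0 := fun u v => by
    rw [← (toStable E).map_zero, toStable_map_eq_iff, sub_zero]
    exact AddSubgroup.subset_closure ⟨_, u, v, hI, rfl⟩
  let e : (toStable E).obj B ≅ (toStable E).obj (D.I A ⊞ B) :=
    { hom := (toStable E).map biprod.inr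
      inv := (toStable E).map biprod.snd
      hom_inv_id := by rw [← Functor.map_comp, biprod.inr_snd, CategoryTheory.Functor.map_id]
      inv_hom_id := by
        rw [← Functor.map_comp, ← CategoryTheory.Functor.map_id, ← biprod.total, Functor.map_add,
          zero_of_factor, zero_add] }
  refine ⟨T, hT, φ, rfl, x, y ≪≫ e, z, ?_, ?_, ?_⟩
  · rw [Iso.trans_hom, reassoc_of% ha, ← Functor.map_comp]
    congr 1
    rw [← sub_eq_zero, ← Functor.map_sub]
    have : f ≫ biprod.inr - T.f = D.ι A ≫ (-biprod.inl) := by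
      apply biprod.hom_ext <;> simp [T, Preadditive.sub_comp]
    rw [this, (toStable E).map_comp, ← Category.id_comp ((toStable E).map (D.ι A)),
      ← (toStable E).map_id]
    rw [Category.assoc, ← Functor.map_comp, zero_of_factor, comp_zero]
  · rw [hb, Iso.trans_hom, Category.assoc, ← Functor.map_comp]
    simp [T]
  · rw [hc]
    simp only [φ, Functor.map_neg, Preadditive.comp_neg, neg_neg]
    rfl

/-- Transport of the third morphism of a triangle along a functor `F` with a comparison
`ξ : FΣ ≅ ΣF`. -/
lemma map_third_of_comparison {A : Type*} {B : Type*} [Category A] [Category B] [Preadditive A]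
    [Preadditive B] {s : A ⥤ A} {s' : B ⥤ B} {F : A ⥤ B} [F.Additive] (ξ : s ⋙ F ≅ F ⋙ s')
    {X X₁ Z X₃ : A} {t : Z ⟶ s.obj X} {x : X ≅ X₁} {z : Z ≅ X₃} {k : X₃ ⟶ s.obj X₁}
    (hc : t ≫ s.map x.hom = -(z.hom ≫ k)) {Y₁ : B} {e : F.obj X₁ ≅ Y₁}
    {l : F.obj X₃ ⟶ s'.obj Y₁} (h : F.map k ≫ ξ.hom.app X₁ = l ≫ s'.map e.inv) :
    (F.map t ≫ ξ.hom.app X) ≫ s'.map (F.mapIso x ≪≫ e).hom = -((F.mapIso z).hom ≫ l) := by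
  have h₁ := ξ.hom.naturality x.hom
  have h₂ := congr_arg F.map hc
  dsimp at h₁
  rw [Functor.map_comp, Functor.map_neg, Functor.map_comp] at h₂
  rw [Iso.trans_hom, Functor.mapIso_hom, Functor.mapIso_hom, Functor.map_comp, Category.assoc,
    ← reassoc_of% h₁, reassoc_of% h₂, Preadditive.neg_comp, Category.assoc, reassoc_of% h,
    ← Functor.map_comp, Iso.inv_hom_id, CategoryTheory.Functor.map_id, Category.comp_id]

lemma hom_eq_id_of_inv {B : Type*} [Category B] {X : B} (e : X ≅ X) (h : e.inv = 𝟙 X) :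
    e.hom = 𝟙 X := by
  simpa [h] using e.hom_inv_id

end FrobeniusExact

/-! ### Arrow categories of abelian categories -/

namespace CategoryTheory.Arrow

variable {C : Type u} [Category.{v} C]

instance preservesLimitsOfShape_leftFunc {J : Type*} [Category J] [HasLimitsOfShape J C] :
    PreservesLimitsOfShape J (Arrow.leftFunc : Arrow C ⥤ C) where
  preservesLimit {F} := preservesLimit_of_preserves_limit_cone
    (Comma.coneOfPreservesIsLimit F (limit.isLimit (F ⋙ Comma.fst _ _))
      (limit.isLimit (F ⋙ Comma.snd _ _))) (limit.isLimit (F ⋙ Comma.fst _ _))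

instance preservesLimitsOfShape_rightFunc {J : Type*} [Category J] [HasLimitsOfShape J C] :
    PreservesLimitsOfShape J (Arrow.rightFunc : Arrow C ⥤ C) where
  preservesLimit {F} := preservesLimit_of_preserves_limit_cone
    (Comma.coneOfPreservesIsLimit F (limit.isLimit (F ⋙ Comma.fst _ _))
      (limit.isLimit (F ⋙ Comma.snd _ _))) (limit.isLimit (F ⋙ Comma.snd _ _))

variable [Abelian C]

instance : PreservesFiniteLimits (Arrow.leftFunc : Arrow C ⥤ C) where
  preservesFiniteLimits _ := inferInstance
instance : PreservesFiniteLimits (Arrow.rightFunc : Arrow C ⥤ C) where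
  preservesFiniteLimits _ := inferInstance
instance : PreservesFiniteColimits (Arrow.leftFunc : Arrow C ⥤ C) where
  preservesFiniteColimits _ := inferInstance
instance : PreservesFiniteColimits (Arrow.rightFunc : Arrow C ⥤ C) where
  preservesFiniteColimits _ := inferInstance
instance : (Arrow.leftFunc : Arrow C ⥤ C).Additive where
instance : (Arrow.rightFunc : Arrow C ⥤ C).Additive where

instance : HasFiniteProducts (Arrow C) := ⟨fun _ => inferInstance⟩
instance : HasKernels (Arrow C) := ⟨fun _ => inferInstance⟩
instance : HasCokernels (Arrow C) := ⟨fun _ => inferInstance⟩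

/-- The category of arrows of an abelian category is abelian: the comparison from the coimage to
the image of a morphism is computed on sources and on targets. -/
noncomputable instance : Abelian (Arrow C) := by
  have : ∀ {X Y : Arrow C} (f : X ⟶ Y), IsIso (Abelian.coimageImageComparison f) := by
    intro X Y f
    have h₁ : IsIso (Arrow.leftFunc.map (Abelian.coimageImageComparison f)) := by
      refine (Arrow.isIso_iff_isIso_of_isIso
        (Abelian.PreservesCoimageImageComparison.iso Arrow.leftFunc f).hom).2 ?_
      infer_instance
    have h₂ : IsIso (Arrow.rightFunc.map (Abelian.coimageImageComparison f)) := by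
      refine (Arrow.isIso_iff_isIso_of_isIso
        (Abelian.PreservesCoimageImageComparison.iso Arrow.rightFunc f).hom).2 ?_
      infer_instance
    have h₁ : IsIso (Abelian.coimageImageComparison f).left := h₁
    have h₂ : IsIso (Abelian.coimageImageComparison f).right := h₂
    exact Arrow.isIso_of_isIso_left_of_isIso_right _
  exact Abelian.ofCoimageImageComparisonIsIso

lemma isZero_of_left_right {X : Arrow C} (h₁ : IsZero X.left) (h₂ : IsZero X.right) :
    IsZero X := by
  rw [IsZero.iff_id_eq_zero]
  ext
  · exact h₁.eq_of_src _ _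
  · exact h₂.eq_of_src _ _

/-- A sequence of arrows is short exact if and only if it is so on sources and on targets. -/
lemma shortExact_iff (T : ShortComplex (Arrow C)) :
    T.ShortExact ↔ (T.map Arrow.leftFunc).ShortExact ∧ (T.map Arrow.rightFunc).ShortExact := by
  refine ⟨fun h => ⟨h.map_of_exact _, h.map_of_exact _⟩, fun ⟨h₁, h₂⟩ => ?_⟩
  have hf₁ := h₁.mono_f
  have hf₂ := h₂.mono_f
  have hg₁ := h₁.epi_g
  have hg₂ := h₂.epi_g
  refine
    { exact := ?_
      mono_f := ⟨fun a b hab => ?_⟩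
      epi_g := ⟨fun a b hab => ?_⟩ }
  · rw [ShortComplex.exact_iff_isZero_homology]
    exact isZero_of_left_right
      (((ShortComplex.exact_iff_isZero_homology _).1 h₁.exact).of_iso
        (T.mapHomologyIso Arrow.leftFunc).symm)
      (((ShortComplex.exact_iff_isZero_homology _).1 h₂.exact).of_iso
        (T.mapHomologyIso Arrow.rightFunc).symm)
  · ext
    · exact (cancel_mono (T.map Arrow.leftFunc).f).1 (congr_arg CommaMorphism.left hab)
    · exact (cancel_mono (T.map Arrow.rightFunc).f).1 (congr_arg CommaMorphism.right hab)
  · ext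
    · exact (cancel_epi (T.map Arrow.leftFunc).g).1 (congr_arg CommaMorphism.left hab)
    · exact (cancel_epi (T.map Arrow.rightFunc).g).1 (congr_arg CommaMorphism.right hab)

end CategoryTheory.Arrow

/-! ### Exact structures on full subcategories of abelian categories -/

namespace FrobeniusExact

section Subcategory

open ZeroObject

variable {A : Type u} [Category.{v} A] [Abelian A] (P : ObjectProperty A)

/-- The sequences in a full subcategory of an abelian category which are short exact in the
ambient category. -/
def shortExactConflations : ObjectProperty (ShortComplex P.FullSubcategory) :=
  fun T => (T.map P.ι).ShortExact

/-- The closure properties of a full subcategory of an abelian category which make its ambient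
short exact sequences an exact structure. Closure is only required under those extensions which
are, moreover, a quotient of an object of the subcategory, or the kernel of a morphism of the
subcategory: these are the extensions which occur in pushouts and pullbacks of conflations, and
in composites of inflations and of deflations. -/
structure IsConflationClosed : Prop where
  of_iso : ∀ {X Y : A}, (X ≅ Y) → P X → P Y
  zero : P 0
  biprod : ∀ {X Y : A}, P X → P Y → P (X ⊞ Y)
  ext_quotient : ∀ (T : ShortComplex A), T.ShortExact → P T.X₁ → P T.X₃ →
    ∀ {V : A} (q : V ⟶ T.X₂), Epi q → P V → P T.X₂
  ext_kernel : ∀ (T : ShortComplex A), T.ShortExact → P T.X₁ → P T.X₃ →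
    ∀ {V U : A} (i : T.X₂ ⟶ V) (d : V ⟶ U) (w : i ≫ d = 0), P V → P U →
      IsLimit (KernelFork.ofι i w) → P T.X₂

variable {P}

lemma shortExact_of_kernel {X Y Z : A} {f : X ⟶ Y} {g : Y ⟶ Z} {w : f ≫ g = 0}
    (h : IsLimit (KernelFork.ofι f w)) [Epi g] : (ShortComplex.mk f g w).ShortExact where
  exact := ShortComplex.exact_of_f_is_kernel _ h
  mono_f := ⟨fun _ _ hab => Fork.IsLimit.hom_ext h hab⟩
  epi_g := inferInstance

lemma shortExact_of_cokernel {X Y Z : A} {f : X ⟶ Y} {g : Y ⟶ Z} {w : f ≫ g = 0}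
    (h : IsColimit (CokernelCofork.ofπ g w)) [Mono f] : (ShortComplex.mk f g w).ShortExact where
  exact := ShortComplex.exact_of_g_is_cokernel _ h
  mono_f := inferInstance
  epi_g := ⟨fun _ _ hab => Cofork.IsColimit.hom_ext h hab⟩

lemma exists_shortExact_of_isPushout {T : ShortComplex A} (hT : T.ShortExact) {X' Y' : A}
    {a : T.X₁ ⟶ X'} {b : T.X₂ ⟶ Y'} {f' : X' ⟶ Y'} (sq : IsPushout T.f a b f') :
    ∃ (g' : Y' ⟶ T.X₃) (w : f' ≫ g' = 0), b ≫ g' = T.g ∧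
      (ShortComplex.mk f' g' w).ShortExact := by
  have := hT.mono_f
  have := hT.epi_g
  have : Mono f' := MorphismProperty.of_isPushout (P := MorphismProperty.monomorphisms A)
    sq.flip ‹Mono T.f›
  have w : f' ≫ sq.desc T.g 0 (by simp) = 0 := by simp
  refine ⟨sq.desc T.g 0 (by simp), w, by simp, shortExact_of_cokernel ?_⟩
  refine CokernelCofork.IsColimit.ofπ _ _ (fun k hk => hT.exact.desc (b ≫ k) ?_)
    (fun k hk => ?_) (fun k hk m hm => ?_)
  · rw [reassoc_of% sq.w, hk, comp_zero]
  · apply sq.hom_ext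
    · rw [sq.inl_desc_assoc, hT.exact.g_desc]
    · rw [sq.inr_desc_assoc, zero_comp, hk]
  · rw [← cancel_epi T.g, hT.exact.g_desc, ← hm, sq.inl_desc_assoc]

lemma exists_shortExact_of_isPullback {T : ShortComplex A} (hT : T.ShortExact) {Z' Y' : A}
    {a : Z' ⟶ T.X₃} {b : Y' ⟶ T.X₂} {g' : Y' ⟶ Z'} (sq : IsPullback b g' T.g a) :
    ∃ (f' : T.X₁ ⟶ Y') (w : f' ≫ g' = 0), f' ≫ b = T.f ∧
      (ShortComplex.mk f' g' w).ShortExact := by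
  have := hT.mono_f
  have := hT.epi_g
  have : Epi g' := MorphismProperty.of_isPullback (P := MorphismProperty.epimorphisms A)
    sq ‹Epi T.g›
  have w : sq.lift T.f 0 (by simp) ≫ g' = 0 := by simp
  refine ⟨sq.lift T.f 0 (by simp), w, by simp, shortExact_of_kernel ?_⟩
  refine KernelFork.IsLimit.ofι _ _ (fun k hk => hT.exact.lift (k ≫ b) ?_)
    (fun k hk => ?_) (fun k hk m hm => ?_)
  · rw [Category.assoc, sq.w, reassoc_of% hk, zero_comp]
  · apply sq.hom_ext
    · rw [Category.assoc, sq.lift_fst, hT.exact.lift_f]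
    · rw [Category.assoc, sq.lift_snd, comp_zero, hk]
  · rw [← cancel_mono T.f, hT.exact.lift_f, ← hm, Category.assoc, sq.lift_fst]

lemma isInflation_of_shortExact {X Y : P.FullSubcategory} (f : X ⟶ Y) {Z : A} (g : Y.obj ⟶ Z)
    (hZ : P Z) (w : f.hom ≫ g = 0) (h : (ShortComplex.mk f.hom g w).ShortExact) :
    IsInflation (shortExactConflations P) f :=
  ⟨⟨Z, hZ⟩, ObjectProperty.homMk g, by ext; exact w, h⟩

lemma isDeflation_of_shortExact {Y Z : P.FullSubcategory} (g : Y ⟶ Z) {X : A} (f : X ⟶ Y.obj)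
    (hX : P X) (w : f ≫ g.hom = 0) (h : (ShortComplex.mk f g.hom w).ShortExact) :
    IsDeflation (shortExactConflations P) g :=
  ⟨⟨X, hX⟩, ObjectProperty.homMk f, by ext; exact w, h⟩

lemma IsConflationClosed.hasFiniteBiproducts (hP : IsConflationClosed P) :
    HasFiniteBiproducts P.FullSubcategory := by
  have : P.IsClosedUnderIsomorphisms := ⟨fun e h => hP.of_iso e h⟩
  have : P.ContainsZero := ⟨⟨0, isZero_zero _, hP.zero⟩⟩
  have : P.IsClosedUnderBinaryProducts := ObjectProperty.IsClosedUnderLimitsOfShape.mk' (by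
    rintro _ ⟨F, hF⟩
    refine hP.of_iso ?_ (hP.biprod (hF ⟨.left⟩) (hF ⟨.right⟩))
    exact biprod.isoProd _ _ ≪≫ (HasLimit.isoOfNatIso (diagramIsoPair F)).symm)
  have := ObjectProperty.IsClosedUnderFiniteProducts.mk' (P := P)
  exact HasFiniteBiproducts.of_hasFiniteProducts

theorem IsConflationClosed.isExactStructure (hP : IsConflationClosed P) :
    IsExactStructure (shortExactConflations P) where
  hasFiniteBiproducts := hP.hasFiniteBiproducts
  isKernel T hT := by
    have hT' : (T.map P.ι).ShortExact := hT
    have := hT'.mono_f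
    refine ⟨KernelFork.IsLimit.ofι _ _
      (fun g hg => ObjectProperty.homMk (hT'.exact.lift g.hom (congr_arg (·.hom) hg)))
      (fun g hg => ?_) (fun g hg m hm => ?_)⟩
    · ext
      exact hT'.exact.lift_f _ _
    · ext
      refine (cancel_mono (T.map P.ι).f).1 (Eq.trans ?_ (hT'.exact.lift_f _ _).symm)
      exact congr_arg (·.hom) hm
  isCokernel T hT := by
    have hT' : (T.map P.ι).ShortExact := hT
    have := hT'.epi_g
    refine ⟨CokernelCofork.IsColimit.ofπ _ _
      (fun g hg => ObjectProperty.homMk (hT'.exact.desc g.hom (congr_arg (·.hom) hg)))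
      (fun g hg => ?_) (fun g hg m hm => ?_)⟩
    · ext
      exact hT'.exact.g_desc _ _
    · ext
      refine (cancel_epi (T.map P.ι).g).1 (Eq.trans ?_ (hT'.exact.g_desc _ _).symm)
      exact congr_arg (·.hom) hm
  of_iso T T' := fun ⟨e⟩ hT => ShortComplex.shortExact_of_iso (P.ι.mapShortComplex.mapIso e) hT
  id_inflation X := isInflation_of_shortExact _ (0 : X.obj ⟶ 0) hP.zero (by simp)
    (shortExact_of_cokernel (CokernelCofork.IsColimit.ofEpiOfIsZero _ (by
      infer_instance) (isZero_zero _)) (f := 𝟙 X.obj))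
  id_deflation X := isDeflation_of_shortExact _ (0 : 0 ⟶ X.obj) hP.zero (by simp)
    (shortExact_of_kernel (KernelFork.IsLimit.ofMonoOfIsZero _ (by
      infer_instance) (isZero_zero _)) (g := 𝟙 X.obj))
  comp_inflation := by
    rintro X Y Z i j ⟨U, p, w, hU⟩ ⟨V, q, w', hV⟩
    replace hU : (ShortComplex.mk i.hom p.hom (congr_arg (·.hom) w)).ShortExact := hU
    replace hV : (ShortComplex.mk j.hom q.hom (congr_arg (·.hom) w')).ShortExact := hV
    have := hU.epi_g
    have hp := hU.exact.gIsCokernel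
    -- the cokernel of the composite is the pushout of `j` along the cokernel `p` of `i`
    let sq := IsPushout.of_hasPushout j.hom p.hom
    have w'' : (i ≫ j).hom ≫ pushout.inl j.hom p.hom = 0 := by
      have : i.hom ≫ p.hom = 0 := congr_arg (·.hom) w
      simp [pushout.condition, reassoc_of% this]
    obtain ⟨r, wr, hr, hr'⟩ := exists_shortExact_of_isPushout hV sq
    have hepi : Epi (pushout.inl j.hom p.hom) := inferInstance
    refine isInflation_of_shortExact _ (pushout.inl j.hom p.hom)
      (hP.ext_quotient _ hr' U.property V.property _ hepi Z.property) w'' ?_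
    have : Mono (i ≫ j).hom := by
      have := hU.mono_f
      have := hV.mono_f
      change Mono (i.hom ≫ j.hom)
      infer_instance
    refine shortExact_of_cokernel (CokernelCofork.IsColimit.ofπ _ _
      (fun k hk => sq.desc k (hU.exact.desc (j.hom ≫ k) (by simpa using hk)) ?_)
      (fun k hk => ?_) (fun k hk m hm => ?_))
    · exact (hU.exact.g_desc _ _).symm
    · exact sq.inl_desc _ _ _
    · rw [← cancel_epi (pushout.inl j.hom p.hom), hm, sq.inl_desc]
  comp_deflation := by
    rintro X Y Z p q ⟨U, i, w, hU⟩ ⟨V, j, w', hV⟩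
    replace hU : (ShortComplex.mk i.hom p.hom (congr_arg (·.hom) w)).ShortExact := hU
    replace hV : (ShortComplex.mk j.hom q.hom (congr_arg (·.hom) w')).ShortExact := hV
    have := hV.mono_f
    -- the kernel of the composite is the pullback of `p` along the kernel `j` of `q`
    let sq := IsPullback.of_hasPullback p.hom j.hom
    have w'' : pullback.fst p.hom j.hom ≫ (p ≫ q).hom = 0 := by
      have : j.hom ≫ q.hom = 0 := congr_arg (·.hom) w'
      simp [pullback.condition_assoc, this]
    obtain ⟨r, wr, hr, hr'⟩ := exists_shortExact_of_isPullback hU sq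
    have hmono : Mono (pullback.fst p.hom j.hom) := inferInstance
    have hlim : IsLimit (KernelFork.ofι _ w'') := by
      refine KernelFork.IsLimit.ofι _ _
        (fun k hk => sq.lift k (hV.exact.lift (k ≫ p.hom) (by simpa using hk)) ?_)
        (fun k hk => ?_) (fun k hk m hm => ?_)
      · exact (hV.exact.lift_f _ _).symm
      · exact sq.lift_fst _ _ _
      · rw [← cancel_mono (pullback.fst p.hom j.hom), hm, sq.lift_fst]
    have : Epi (p ≫ q).hom := by
      have := hU.epi_g
      have := hV.epi_g
      change Epi (p.hom ≫ q.hom)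
      infer_instance
    exact isDeflation_of_shortExact _ (pullback.fst p.hom j.hom)
      (hP.ext_kernel _ hr' U.property V.property _ _ w'' X.property Z.property hlim) w''
      (shortExact_of_kernel hlim)
  pushout := by
    rintro X Y X' i f ⟨Z, p, w, h⟩
    replace h : (ShortComplex.mk i.hom p.hom (congr_arg (·.hom) w)).ShortExact := h
    let sq := IsPushout.of_hasPushout i.hom f.hom
    obtain ⟨g', w', hg, hs⟩ := exists_shortExact_of_isPushout h sq
    have hY' : P (pushout i.hom f.hom) := hP.ext_quotient _ hs X'.property Z.property
      (biprod.desc (pushout.inl i.hom f.hom) (pushout.inr i.hom f.hom)) ⟨fun a b hab => by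
        apply pushout.hom_ext
        · simpa using biprod.inl ≫= hab
        · simpa using biprod.inr ≫= hab⟩ (hP.biprod Y.property X'.property)
    refine ⟨⟨_, hY'⟩, ObjectProperty.homMk (pushout.inl _ _),
      ObjectProperty.homMk (pushout.inr _ _), IsPushout.of_map P.ι ?_ sq,
      isInflation_of_shortExact _ g' Z.property w' hs⟩
    ext
    exact sq.w
  pullback := by
    rintro Y Z Z' p f ⟨X, i, w, h⟩
    replace h : (ShortComplex.mk i.hom p.hom (congr_arg (·.hom) w)).ShortExact := h
    let sq := IsPullback.of_hasPullback p.hom f.hom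
    obtain ⟨f', w', hf, hs⟩ := exists_shortExact_of_isPullback h sq
    have hY' : P (pullback p.hom f.hom) := by
      refine hP.ext_kernel _ hs X.property Z'.property
        (biprod.lift (pullback.fst p.hom f.hom) (pullback.snd p.hom f.hom))
        (biprod.desc p.hom (-f.hom)) (by simp [pullback.condition])
        (hP.biprod Y.property Z'.property) Z.property
        (KernelFork.IsLimit.ofι _ _ (fun k hk => sq.lift (k ≫ biprod.fst) (k ≫ biprod.snd) ?_)
          (fun k hk => ?_) (fun k hk m hm => ?_))
      · rw [← sub_eq_zero]
        simpa [biprod.desc_eq, Preadditive.comp_add, ← sub_eq_add_neg] using hk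
      · apply biprod.hom_ext <;> simp
      · apply sq.hom_ext <;> simp [← hm]
    refine ⟨⟨_, hY'⟩, ObjectProperty.homMk (pullback.fst _ _),
      ObjectProperty.homMk (pullback.snd _ _), IsPullback.of_map P.ι ?_ sq,
      isDeflation_of_shortExact _ f' X.property w' hs⟩
    ext
    exact sq.w

end Subcategory

end FrobeniusExact

/-! ### Gorenstein projective modules -/

namespace GorensteinMono

open FrobeniusExact

/-- Linear maps `f`, `g` forming a short exact sequence `0 ⟶ X ⟶ Y ⟶ Z ⟶ 0`. -/
structure IsSES {A X Y Z : Type*} [CommRing A] [AddCommGroup X] [AddCommGroup Y] [AddCommGroup Z]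
    [Module A X] [Module A Y] [Module A Z] (f : X →ₗ[A] Y) (g : Y →ₗ[A] Z) : Prop where
  inj : Function.Injective f
  surj : Function.Surjective g
  exact : Function.Exact f g

variable {A : Type u} [CommRing A]

section

variable {X Y Z : Type u} [AddCommGroup X] [AddCommGroup Y] [AddCommGroup Z]
  [Module A X] [Module A Y] [Module A Z] {f : X →ₗ[A] Y} {g : Y →ₗ[A] Z}

lemma IsSES.comp_eq_zero (h : IsSES f g) (x : X) : g (f x) = 0 := h.exact.apply_apply_eq_zero x

lemma IsSES.of_ker (hg : Function.Surjective g) : IsSES (LinearMap.ker g).subtype g where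
  inj := Subtype.val_injective
  surj := hg
  exact := g.exact_subtype_ker_map

/-- The short complex of modules given by a short exact sequence of linear maps. -/
abbrev IsSES.complex (h : IsSES f g) : ShortComplex (ModuleCat.{u} A) :=
  ShortComplex.mk (ModuleCat.ofHom f) (ModuleCat.ofHom g) (by ext x; exact h.comp_eq_zero x)

lemma IsSES.shortExact (h : IsSES f g) : h.complex.ShortExact :=
  ModuleCat.shortComplex_shortExact _ h.exact h.inj h.surj

lemma IsSES.of_shortExact {T : ShortComplex (ModuleCat.{u} A)} (hT : T.ShortExact) :
    IsSES T.f.hom T.g.hom where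
  inj := hT.moduleCat_injective_f
  surj := hT.moduleCat_surjective_g
  exact := (ShortComplex.ShortExact.moduleCat_exact_iff_function_exact T).1 hT.exact

/-- `Ext^i(X, A) = 0`. -/
abbrev ExtZero (A : Type u) [CommRing A] (X : Type u) [AddCommGroup X] [Module A X] (i : ℕ) :
    Prop :=
  Subsingleton (Abelian.Ext (ModuleCat.of A X) (ModuleCat.of A A) i)

lemma IsSES.extZero_left (h : IsSES f g) {i : ℕ} (hY : ExtZero A Y i) (hZ : ExtZero A Z (1 + i)) :
    ExtZero A X i := by
  have : ∀ x : Abelian.Ext (ModuleCat.of A X) (ModuleCat.of A A) i, x = 0 := fun x => by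
    obtain ⟨y, rfl⟩ := Abelian.Ext.contravariant_sequence_exact₁ h.shortExact _ x rfl
      (Subsingleton.elim (α := Abelian.Ext (ModuleCat.of A Z) _ _) _ _)
    rw [Subsingleton.elim (α := Abelian.Ext (ModuleCat.of A Y) _ _) y 0, Abelian.Ext.comp_zero]
  exact ⟨fun a b => by rw [this a, this b]⟩

lemma IsSES.extZero_mid (h : IsSES f g) {i : ℕ} (hX : ExtZero A X i) (hZ : ExtZero A Z i) :
    ExtZero A Y i := by
  have : ∀ x : Abelian.Ext (ModuleCat.of A Y) (ModuleCat.of A A) i, x = 0 := fun x => by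
    obtain ⟨y, rfl⟩ := Abelian.Ext.contravariant_sequence_exact₂ h.shortExact _ x
      (Subsingleton.elim (α := Abelian.Ext (ModuleCat.of A X) _ _) _ _)
    rw [Subsingleton.elim (α := Abelian.Ext (ModuleCat.of A Z) _ _) y 0, Abelian.Ext.comp_zero]
  exact ⟨fun a b => by rw [this a, this b]⟩

lemma IsSES.extZero_right (h : IsSES f g) {i : ℕ} (hX : ExtZero A X i)
    (hY : ExtZero A Y (1 + i)) : ExtZero A Z (1 + i) := by
  have : ∀ x : Abelian.Ext (ModuleCat.of A Z) (ModuleCat.of A A) (1 + i), x = 0 := fun x => by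
    obtain ⟨y, rfl⟩ := Abelian.Ext.contravariant_sequence_exact₃ h.shortExact _ x
      (Subsingleton.elim (α := Abelian.Ext (ModuleCat.of A Y) _ _) _ _) rfl
    rw [Subsingleton.elim (α := Abelian.Ext (ModuleCat.of A X) _ _) y 0, Abelian.Ext.comp_zero]
  exact ⟨fun a b => by rw [this a, this b]⟩

lemma IsSES.extend (h : IsSES f g) (hZ : ExtZero A Z 1) (k : X →ₗ[A] A) :
    ∃ l : Y →ₗ[A] A, l ∘ₗ f = k := by
  obtain ⟨y, hy⟩ := Abelian.Ext.contravariant_sequence_exact₁ h.shortExact (ModuleCat.of A A)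
    (Abelian.Ext.mk₀ (ModuleCat.ofHom k)) rfl
    (Subsingleton.elim (α := Abelian.Ext (ModuleCat.of A Z) _ _) _ _)
  obtain ⟨l, rfl⟩ := (Abelian.Ext.mk₀_bijective _ _).2 y
  rw [Abelian.Ext.mk₀_comp_mk₀] at hy
  exact ⟨l.hom, congr_arg ModuleCat.Hom.hom ((Abelian.Ext.mk₀_bijective _ _).1 hy)⟩

lemma IsSES.extZero_one (h : IsSES f g) (hY : ExtZero A Y 1)
    (hext : ∀ k : X →ₗ[A] A, ∃ l : Y →ₗ[A] A, l ∘ₗ f = k) : ExtZero A Z 1 := by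
  have : ∀ x : Abelian.Ext (ModuleCat.of A Z) (ModuleCat.of A A) 1, x = 0 := fun x => by
    obtain ⟨y, rfl⟩ := Abelian.Ext.contravariant_sequence_exact₃ h.shortExact _ x
      (Subsingleton.elim (α := Abelian.Ext (ModuleCat.of A Y) _ _) _ _) (n₀ := 0) rfl
    obtain ⟨k, rfl⟩ := (Abelian.Ext.mk₀_bijective _ _).2 y
    obtain ⟨l, hl⟩ := hext k.hom
    have : k = h.complex.f ≫ ModuleCat.ofHom l := by
      ext x
      exact (LinearMap.congr_fun hl x).symm
    rw [this, ← Abelian.Ext.mk₀_comp_mk₀, ← Abelian.Ext.comp_assoc_of_second_deg_zero,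
      h.shortExact.extClass_comp, Abelian.Ext.zero_comp]
  exact ⟨fun a b => by rw [this a, this b]⟩

lemma extZero_of_equiv (e : X ≃ₗ[A] Y) {i : ℕ} (h : ExtZero A X i) : ExtZero A Y i := by
  have : ∀ x : Abelian.Ext (ModuleCat.of A Y) (ModuleCat.of A A) i, x = 0 := fun x => by
    rw [← Abelian.Ext.mk₀_id_comp x, ← e.toModuleIso.inv_hom_id, ← Abelian.Ext.mk₀_comp_mk₀,
      Abelian.Ext.comp_assoc_of_second_deg_zero,
      Subsingleton.elim (α := Abelian.Ext (ModuleCat.of A X) _ _)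
        ((Abelian.Ext.mk₀ e.toModuleIso.hom).comp x (zero_add i)) 0, Abelian.Ext.comp_zero]
  exact ⟨fun a b => by rw [this a, this b]⟩

lemma extZero_of_projective [Module.Projective A X] (i : ℕ) (hi : 1 ≤ i) : ExtZero A X i := by
  obtain ⟨i, rfl⟩ := Nat.exists_eq_add_of_le' hi
  have : Projective (ModuleCat.of A X) := (IsProjective.iff_projective X).1 inferInstance
  exact Abelian.Ext.subsingleton_of_projective _ _ i

lemma exists_comp_eq_of_ker_le {X Y Z : Type*} [AddCommGroup X] [AddCommGroup Y]
    [AddCommGroup Z] [Module A X] [Module A Y] [Module A Z] {g : X →ₗ[A] Y}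
    (hg : Function.Surjective g) (k : X →ₗ[A] Z) (hk : ∀ x, g x = 0 → k x = 0) :
    ∃ l : Y →ₗ[A] Z, ∀ x, l (g x) = k x := by
  refine ⟨(LinearMap.ker g).liftQ k hk ∘ₗ (g.quotKerEquivOfSurjective hg).symm.toLinearMap,
    fun x => ?_⟩
  have : (g.quotKerEquivOfSurjective hg).symm (g x) = Submodule.Quotient.mk x := by
    rw [LinearEquiv.symm_apply_eq]; rfl
  rw [LinearMap.comp_apply, LinearEquiv.coe_coe, this]
  rfl

/-- The dual is left exact. -/
lemma exact_dualMap {X Y Z : Type*} [AddCommGroup X] [AddCommGroup Y] [AddCommGroup Z]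
    [Module A X] [Module A Y] [Module A Z] {f : X →ₗ[A] Y} {g : Y →ₗ[A] Z}
    (hg : Function.Surjective g) (h : Function.Exact f g) :
    Function.Exact g.dualMap f.dualMap := fun k => by
  constructor
  · intro hk
    obtain ⟨l, hl⟩ := exists_comp_eq_of_ker_le hg k fun y hy => by
      obtain ⟨x, rfl⟩ := (h y).1 hy
      exact LinearMap.congr_fun hk x
    exact ⟨l, LinearMap.ext hl⟩
  · rintro ⟨l, rfl⟩
    ext x
    simp [h.apply_apply_eq_zero]

/-- The dual of a short exact sequence along which functionals extend is short exact. -/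
lemma IsSES.dual (h : IsSES f g) (hext : ∀ k : X →ₗ[A] A, ∃ l : Y →ₗ[A] A, l ∘ₗ f = k) :
    IsSES g.dualMap f.dualMap where
  inj := LinearMap.dualMap_injective_of_surjective h.surj
  surj := hext
  exact := exact_dualMap h.surj h.exact

/-- A four lemma: a kernel of a morphism with bijective source and injective target components. -/
lemma bijective_left {X' Y' Z' : Type*} [AddCommGroup X'] [AddCommGroup Y'] [AddCommGroup Z']
    [Module A X'] [Module A Y'] [Module A Z'] {f' : X' →ₗ[A] Y'} {g' : Y' →ₗ[A] Z'}
    (hf : Function.Injective f) (hfg : Function.Exact f g)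
    (hf' : Function.Injective f') (hfg' : Function.Exact f' g')
    {a : X →ₗ[A] X'} {b : Y →ₗ[A] Y'} {c : Z →ₗ[A] Z'}
    (hab : ∀ x, f' (a x) = b (f x)) (hbc : ∀ y, g' (b y) = c (g y))
    (hb : Function.Bijective b) (hc : Function.Injective c) : Function.Bijective a := by
  constructor
  · intro x y hxy
    exact hf (hb.1 (by rw [← hab, ← hab, hxy]))
  · intro x'
    obtain ⟨y, hy⟩ := hb.2 (f' x')
    have : g y = 0 := hc (by rw [← hbc, hy, hfg'.apply_apply_eq_zero, map_zero])
    obtain ⟨x, rfl⟩ := (hfg y).1 this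
    exact ⟨x, hf' (by rw [hab, hy])⟩

/-- The five lemma for short exact sequences. -/
lemma bijective_mid {X' Y' Z' : Type*} [AddCommGroup X'] [AddCommGroup Y'] [AddCommGroup Z']
    [Module A X'] [Module A Y'] [Module A Z'] {f' : X' →ₗ[A] Y'} {g' : Y' →ₗ[A] Z'}
    (h : IsSES f g) (hf' : Function.Injective f') (hfg' : Function.Exact f' g')
    {a : X →ₗ[A] X'} {b : Y →ₗ[A] Y'} {c : Z →ₗ[A] Z'}
    (hab : ∀ x, f' (a x) = b (f x)) (hbc : ∀ y, g' (b y) = c (g y))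
    (ha : Function.Bijective a) (hc : Function.Bijective c) : Function.Bijective b := by
  constructor
  · rw [← LinearMap.ker_eq_bot, LinearMap.ker_eq_bot']
    intro y hy
    have : g y = 0 := hc.1 (by rw [← hbc, hy, map_zero, map_zero])
    obtain ⟨x, rfl⟩ := (h.exact y).1 this
    have : x = 0 := ha.1 (hf' (by rw [hab, hy, map_zero, map_zero]))
    rw [this, map_zero]
  · intro y'
    obtain ⟨z, hz⟩ := hc.2 (g' y')
    obtain ⟨y, rfl⟩ := h.surj z
    obtain ⟨x', hx'⟩ := (hfg' (y' - b y)).1 (by rw [map_sub, hbc, hz, sub_self])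
    obtain ⟨x, rfl⟩ := ha.2 x'
    exact ⟨y + f x, by rw [map_add, ← hab, hx']; abel⟩

end

/-- The `A`-module `X` is finitely generated Gorenstein projective. -/
abbrev GP (A : Type u) [CommRing A] (X : Type u) [AddCommGroup X] [Module A X] : Prop :=
  IsGorensteinProjective (ModuleCat.of A X)

section

variable {X Y Z : Type u} [AddCommGroup X] [AddCommGroup Y] [AddCommGroup Z]
  [Module A X] [Module A Y] [Module A Z] {f : X →ₗ[A] Y} {g : Y →ₗ[A] Z}

lemma GP.eval_bijective (h : GP A X) : Function.Bijective (Module.Dual.eval A X) :=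
  h.reflexive.bijective_dual_eval'

lemma GP.of_equiv (e : X ≃ₗ[A] Y) (h : GP A X) : GP A Y where
  finite := have := h.finite; Module.Finite.equiv (M := X) e
  reflexive := have := h.reflexive; Module.equiv (M := X) e
  ext_eq_zero i hi := extZero_of_equiv e (h.ext_eq_zero i hi)
  ext_dual_eq_zero i hi := extZero_of_equiv e.symm.dualMap (h.ext_dual_eq_zero i hi)

lemma GP.of_projective [Module.Finite A X] [Module.Projective A X] : GP A X where
  finite := ‹_›
  reflexive := inferInstanceAs (Module.IsReflexive A X)
  ext_eq_zero i hi := extZero_of_projective i hi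
  ext_dual_eq_zero i hi := extZero_of_projective i hi

lemma GP.dual [IsNoetherianRing A] (h : GP A X) : GP A (Module.Dual A X) where
  finite := have := h.finite; inferInstanceAs (Module.Finite A (Module.Dual A X))
  reflexive := have := h.reflexive; inferInstanceAs (Module.IsReflexive A (Module.Dual A X))
  ext_eq_zero i hi := h.ext_dual_eq_zero i hi
  ext_dual_eq_zero i hi := extZero_of_equiv (LinearEquiv.ofBijective _ h.eval_bijective)
    (h.ext_eq_zero i hi)

/-- Gorenstein projective modules are closed under extensions. -/
lemma GP.of_extension (h : IsSES f g) (hX : GP A X) (hZ : GP A Z) : GP A Y := by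
  have hd := h.dual (h.extend (hZ.ext_eq_zero 1 le_rfl))
  have hdd := hd.dual (hd.extend (hX.ext_dual_eq_zero 1 le_rfl))
  exact
    { finite := by
        have := hX.finite
        have := hZ.finite
        have : Module.Finite A X := ‹_›
        have : Module.Finite A Z := ‹_›
        exact Module.Finite.of_exact h.exact h.surj
      reflexive := ⟨bijective_mid h hdd.inj hdd.exact (fun _ => rfl) (fun _ => rfl)
        hX.eval_bijective hZ.eval_bijective⟩
      ext_eq_zero := fun i hi => h.extZero_mid (hX.ext_eq_zero i hi) (hZ.ext_eq_zero i hi)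
      ext_dual_eq_zero := fun i hi =>
        hd.extZero_mid (hZ.ext_dual_eq_zero i hi) (hX.ext_dual_eq_zero i hi) }

/-- Gorenstein projective modules are closed under kernels of epimorphisms. -/
lemma GP.of_kernel [IsNoetherianRing A] (h : IsSES f g) (hY : GP A Y) (hZ : GP A Z) : GP A X := by
  have hd := h.dual (h.extend (hZ.ext_eq_zero 1 le_rfl))
  have hext : ∀ k : Module.Dual A Z →ₗ[A] A, ∃ l : Module.Dual A Y →ₗ[A] A,
      l ∘ₗ g.dualMap = k := fun k => by
    obtain ⟨z, rfl⟩ := hZ.eval_bijective.2 k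
    obtain ⟨y, rfl⟩ := h.surj z
    exact ⟨Module.Dual.eval A Y y, rfl⟩
  have hdd := hd.dual hext
  exact
    { finite := by
        have := hY.finite
        have : Module.Finite A Y := ‹_›
        exact Module.Finite.of_injective f h.inj
      reflexive := ⟨bijective_left h.inj h.exact hdd.inj hdd.exact (fun _ => rfl) (fun _ => rfl)
        hY.eval_bijective hZ.eval_bijective.1⟩
      ext_eq_zero := fun i hi => h.extZero_left (hY.ext_eq_zero i hi)
        (hZ.ext_eq_zero (1 + i) (by omega))
      ext_dual_eq_zero := fun i hi => by
        obtain ⟨i, rfl⟩ := Nat.exists_eq_add_of_le hi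
        rcases i with _ | i
        · exact hd.extZero_one (hY.ext_dual_eq_zero 1 le_rfl) hext
        · exact hd.extZero_right (hZ.ext_dual_eq_zero (i + 1) (by omega))
            (hY.ext_dual_eq_zero _ (by omega)) }

/-- Every Gorenstein projective module is a submodule of a free module of finite rank, with
Gorenstein projective quotient: dualize a presentation of its dual. -/
lemma GP.exists_cosyzygy [IsNoetherianRing A] (hX : GP A X) :
    ∃ (n : ℕ) (N : Type u) (_ : AddCommGroup N) (_ : Module A N) (i : X →ₗ[A] (Fin n → A))
      (p : (Fin n → A) →ₗ[A] N), IsSES i p ∧ GP A N := by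
  have := hX.dual.finite
  obtain ⟨n, p, hp⟩ := Module.Finite.exists_fin' A (Module.Dual A X)
  have hs := IsSES.of_ker hp
  have hN : GP A (LinearMap.ker p) := GP.of_kernel hs GP.of_projective hX.dual
  have hd := hs.dual (hs.extend (hX.ext_dual_eq_zero 1 le_rfl))
  let e₁ := LinearEquiv.ofBijective _ hX.eval_bijective
  let e₂ := (Pi.basisFun A (Fin n)).toDualEquiv
  refine ⟨n, _, _, _, e₂.symm.toLinearMap ∘ₗ p.dualMap ∘ₗ e₁.toLinearMap,
    (LinearMap.ker p).subtype.dualMap ∘ₗ e₂.toLinearMap, ⟨?_, ?_, ?_⟩, hN.dual⟩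
  · exact e₂.symm.injective.comp (hd.inj.comp e₁.injective)
  · exact hd.surj.comp e₂.surjective
  · intro y
    refine (hd.exact (e₂ y)).trans ⟨?_, ?_⟩
    · rintro ⟨z, hz⟩
      exact ⟨e₁.symm z, by simp [hz]⟩
    · rintro ⟨x, rfl⟩
      exact ⟨e₁ x, by simp⟩

/-- Maps to finitely generated projective modules extend along monomorphisms with Gorenstein
projective cokernel. -/
lemma IsSES.extend_projective (h : IsSES f g) (hZ : ExtZero A Z 1) {P : Type*} [AddCommGroup P]
    [Module A P] [Module.Finite A P] [Module.Projective A P] (k : X →ₗ[A] P) :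
    ∃ l : Y →ₗ[A] P, l ∘ₗ f = k := by
  obtain ⟨n, p, hp⟩ := Module.Finite.exists_fin' A P
  obtain ⟨s, hs⟩ := Module.projective_lifting_property p LinearMap.id hp
  choose l hl using fun i => h.extend hZ (LinearMap.proj i ∘ₗ s ∘ₗ k)
  refine ⟨p ∘ₗ LinearMap.pi l, ?_⟩
  ext x
  have : LinearMap.pi l (f x) = s (k x) := by
    ext i
    exact LinearMap.congr_fun (hl i) x
  simpa [this] using LinearMap.congr_fun hs (k x)

/-- Maps from Gorenstein projective modules lift along epimorphisms with finitely generated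
projective kernel: the pullback of such an extension splits. -/
lemma IsSES.lift_of_projective [Module.Finite A X] [Module.Projective A X] (h : IsSES f g)
    {G : Type u} [AddCommGroup G] [Module A G] (hG : ExtZero A G 1) (k : G →ₗ[A] Z) :
    ∃ l : G →ₗ[A] Y, g ∘ₗ l = k := by
  let W := LinearMap.eqLocus (g ∘ₗ LinearMap.fst A Y G) (k ∘ₗ LinearMap.snd A Y G)
  let i : X →ₗ[A] W := LinearMap.codRestrict _ (LinearMap.inl A Y G ∘ₗ f) fun x => by
    change g (f x) = k 0
    rw [h.comp_eq_zero, map_zero]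
  let p : W →ₗ[A] G := LinearMap.snd A Y G ∘ₗ W.subtype
  have hW : ∀ w : W, g w.1.1 = k w.1.2 := fun w => w.2
  have hs : IsSES i p :=
    { inj := fun x y hxy => h.inj (congr_arg (fun w : W => w.1.1) hxy)
      surj := fun x => by
        obtain ⟨y, hy⟩ := h.surj (k x)
        exact ⟨⟨(y, x), hy⟩, rfl⟩
      exact := fun w => by
        constructor
        · intro hw
          replace hw : w.1.2 = 0 := hw
          obtain ⟨x, hx⟩ := (h.exact w.1.1).1 (by rw [hW, hw, map_zero])
          exact ⟨x, Subtype.ext (Prod.ext hx hw.symm)⟩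
        · rintro ⟨x, rfl⟩
          rfl }
  obtain ⟨r, hr⟩ := hs.extend_projective hG LinearMap.id
  -- `w ↦ w - i (r w)` vanishes on the image of `i`, and so descends to a splitting of `p`
  let q : W →ₗ[A] W := LinearMap.id - i ∘ₗ r
  have hq : ∀ w w' : W, p w = p w' → q w = q w' := fun w w' hw => by
    obtain ⟨x, hx⟩ := (hs.exact (w - w')).1 (by rw [map_sub, hw, sub_self])
    rw [← sub_eq_zero, ← map_sub, ← hx]
    have : r (i x) = x := LinearMap.congr_fun hr x
    simp [q, this]
  have hpq : ∀ w, p (q w) = p w := fun w => by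
    simp [q, hs.comp_eq_zero]
  choose σ hσ using hs.surj
  let l : G →ₗ[A] W :=
    { toFun := fun x => q (σ x)
      map_add' := fun x y => by rw [← map_add]; exact hq _ _ (by simp [hσ])
      map_smul' := fun a x => by
        rw [RingHom.id_apply, ← map_smul]; exact hq _ _ (by simp [hσ]) }
  refine ⟨LinearMap.fst A Y G ∘ₗ W.subtype ∘ₗ l, ?_⟩
  ext x
  have : (l x).1.2 = x := (hpq (σ x)).trans (hσ x)
  exact (hW (l x)).trans (by rw [this])

end

/-- A class of finitely generated modules consists of Gorenstein projective modules as soon as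
each of its members is both the cokernel and the kernel, in short exact sequences along which
functionals extend, of a map between a member and a finitely generated projective module. Such
sequences splice to a totally acyclic complex. -/
theorem GP.of_class (Q : ModuleCat.{u} A → Prop) (hfin : ∀ K, Q K → Module.Finite A K)
    (hleft : ∀ K, Q K → ∃ (K' : ModuleCat.{u} A) (F : Type u) (_ : AddCommGroup F)
      (_ : Module A F) (_ : Module.Finite A F) (_ : Module.Projective A F)
      (f : K' →ₗ[A] F) (g : F →ₗ[A] K),
      Q K' ∧ IsSES f g ∧ ∀ k : K' →ₗ[A] A, ∃ l : F →ₗ[A] A, l ∘ₗ f = k)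
    (hright : ∀ K, Q K → ∃ (K' : ModuleCat.{u} A) (F : Type u) (_ : AddCommGroup F)
      (_ : Module A F) (_ : Module.Finite A F) (_ : Module.Projective A F)
      (f : K →ₗ[A] F) (g : F →ₗ[A] K'),
      Q K' ∧ IsSES f g ∧ ∀ k : K →ₗ[A] A, ∃ l : F →ₗ[A] A, l ∘ₗ f = k)
    (K : ModuleCat.{u} A) (hK : Q K) : IsGorensteinProjective K := by
  have hext : ∀ i : ℕ, ∀ K, Q K → ExtZero A K (1 + i) := by
    intro i
    induction i with
    | zero =>
      intro K hK
      obtain ⟨K', F, _, _, _, _, f, g, -, h, he⟩ := hleft K hK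
      exact h.extZero_one (extZero_of_projective 1 le_rfl) he
    | succ i ih =>
      intro K hK
      obtain ⟨K', F, _, _, _, _, f, g, hK', h, -⟩ := hleft K hK
      have := ih K' hK'
      rw [add_comm] at this
      exact h.extZero_right this (extZero_of_projective _ (by omega))
  have hinj : ∀ K, Q K → Function.Injective (Module.Dual.eval A K) := by
    intro K hK
    obtain ⟨K', F, _, _, _, _, f, g, -, h, -⟩ := hright K hK
    refine Function.Injective.of_comp (f := f.dualMap.dualMap) ?_
    exact (Module.bijective_dual_eval A F).1.comp h.inj
  have hbij : ∀ K, Q K → Function.Bijective (Module.Dual.eval A K) := by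
    intro K hK
    obtain ⟨K', F, _, _, _, _, f, g, hK', h, he⟩ := hright K hK
    have hd := h.dual he
    refine bijective_left h.inj h.exact (f' := f.dualMap.dualMap) (g' := g.dualMap.dualMap)
      (LinearMap.dualMap_injective_of_surjective hd.surj) (exact_dualMap hd.surj hd.exact)
      (fun _ => rfl) (fun _ => rfl) (Module.bijective_dual_eval A F) (hinj K' hK')
  have hdual : ∀ i : ℕ, ∀ K, Q K → ExtZero A (Module.Dual A K) (1 + i) := by
    intro i
    induction i with
    | zero =>
      intro K hK
      obtain ⟨K', F, _, _, _, _, f, g, hK', h, he⟩ := hright K hK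
      refine (h.dual he).extZero_one (extZero_of_projective 1 le_rfl) fun k => ?_
      obtain ⟨z, rfl⟩ := (hbij K' hK').2 k
      obtain ⟨y, rfl⟩ := h.surj z
      exact ⟨Module.Dual.eval A F y, rfl⟩
    | succ i ih =>
      intro K hK
      obtain ⟨K', F, _, _, _, _, f, g, hK', h, he⟩ := hright K hK
      have := ih K' hK'
      rw [add_comm] at this
      exact (h.dual he).extZero_right this (extZero_of_projective _ (by omega))
  exact
    { finite := hfin K hK
      reflexive := ⟨hbij K hK⟩
      ext_eq_zero := fun i hi => by
        obtain ⟨i, rfl⟩ := Nat.exists_eq_add_of_le hi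
        exact hext i K hK
      ext_dual_eq_zero := fun i hi => by
        obtain ⟨i, rfl⟩ := Nat.exists_eq_add_of_le hi
        exact hdual i K hK }

end GorensteinMono

/-! ### The Frobenius category of Gorenstein projective modules -/

namespace GorensteinMono

open FrobeniusExact

variable {A : Type u} [CommRing A]

lemma GP.of_subsingleton (X : Type u) [AddCommGroup X] [Module A X] [Subsingleton X] :
    GP A X :=
  have : Module.Projective A X := Module.Projective.of_free
  GP.of_projective

lemma GP.prod {X Y : Type u} [AddCommGroup X] [AddCommGroup Y] [Module A X] [Module A Y]
    (hX : GP A X) (hY : GP A Y) : GP A (X × Y) :=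
  GP.of_extension (f := LinearMap.inl A X Y) (g := LinearMap.snd A X Y)
    { inj := LinearMap.inl_injective
      surj := LinearMap.snd_surjective
      exact := LinearMap.exact_iff.2 (LinearMap.range_inl A X Y).symm } hX hY

open ZeroObject in
lemma isConflationClosed_gorensteinProjective :
    IsConflationClosed (gorensteinProjective A) where
  of_iso e h := GP.of_equiv e.toLinearEquiv h
  zero :=
    have : Subsingleton (0 : ModuleCat.{u} A) := ModuleCat.subsingleton_of_isZero (isZero_zero _)
    GP.of_subsingleton (0 : ModuleCat.{u} A)
  biprod {X Y} hX hY := GP.of_equiv (ModuleCat.biprodIsoProd X Y).symm.toLinearEquiv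
    (GP.prod hX hY)
  ext_quotient _ hT h₁ h₃ _ _ _ _ := GP.of_extension (IsSES.of_shortExact hT) h₁ h₃
  ext_kernel _ hT h₁ h₃ _ _ _ _ _ _ _ _ := GP.of_extension (IsSES.of_shortExact hT) h₁ h₃

lemma isSES_of_gprojConflations {T : ShortComplex (GProj A)} (hT : gprojConflations A T) :
    IsSES T.f.hom.hom T.g.hom.hom :=
  IsSES.of_shortExact (T := T.map (gorensteinProjective A).ι) hT

/-- A Gorenstein projective module as an object of `GProj A`. -/
abbrev gprojOf (X : Type u) [AddCommGroup X] [Module A X] (hX : GP A X) : GProj A :=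
  ⟨ModuleCat.of A X, hX⟩

lemma gprojConflations_of_isSES {X Y Z : GProj A} {f : X.obj →ₗ[A] Y.obj} {g : Y.obj →ₗ[A] Z.obj}
    (h : IsSES f g) : gprojConflations A (ShortComplex.mk (X₁ := X) (X₂ := Y) (X₃ := Z)
      (ObjectProperty.homMk (ModuleCat.ofHom f)) (ObjectProperty.homMk (ModuleCat.ofHom g))
      (by ext x; exact h.comp_eq_zero x)) :=
  h.shortExact

lemma isProjective_of_module_projective (X : GProj A) [Module.Projective A X.obj] :
    FrobeniusExact.IsProjective (gprojConflations A) X := by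
  rintro Y Z p ⟨K, i, w, h⟩ g
  obtain ⟨l, hl⟩ := Module.projective_lifting_property p.hom.hom g.hom.hom
    (isSES_of_gprojConflations h).surj
  refine ⟨ObjectProperty.homMk (ModuleCat.ofHom l), ?_⟩
  ext x
  exact LinearMap.congr_fun hl x

lemma isInjective_of_module_projective (X : GProj A) [Module.Projective A X.obj] :
    FrobeniusExact.IsInjective (gprojConflations A) X := by
  rintro Y Z i ⟨K, p, w, h⟩ g
  have := X.property.finite
  obtain ⟨l, hl⟩ := (isSES_of_gprojConflations h).extend_projective
    (K.property.ext_eq_zero 1 le_rfl) g.hom.hom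
  refine ⟨ObjectProperty.homMk (ModuleCat.ofHom l), ?_⟩
  ext x
  exact LinearMap.congr_fun hl x

variable (A) in
/-- The projective-injective objects of `GProj A` are the projective modules. -/
theorem isFrobenius_gproj [IsNoetherianRing A] : IsFrobenius (gprojConflations A) := by
  refine IsFrobenius.of_class isConflationClosed_gorensteinProjective.isExactStructure
    (fun X => Module.Projective A X.obj) (fun X _ => isProjective_of_module_projective X)
    (fun X _ => isInjective_of_module_projective X) (fun X => ?_) (fun X => ?_)
  · have := X.property.finite
    obtain ⟨n, p, hp⟩ := Module.Finite.exists_fin' A X.obj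
    have hs := IsSES.of_ker hp
    exact ⟨_, gprojConflations_of_isSES
      (X := gprojOf _ (GP.of_kernel hs GP.of_projective X.property))
      (Y := gprojOf _ GP.of_projective) (Z := X) hs, rfl,
      inferInstanceAs (Module.Projective A (Fin n → A))⟩
  · obtain ⟨n, N, _, _, i, p, hs, hN⟩ := GP.exists_cosyzygy (A := A) (X := X.obj) X.property
    exact ⟨_, gprojConflations_of_isSES (X := X) (Y := gprojOf _ GP.of_projective)
      (Z := gprojOf _ hN) hs, rfl, inferInstanceAs (Module.Projective A (Fin n → A))⟩

/-- A projective object of `GProj A` is a retract of a free module of finite rank. -/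
lemma exists_retract_of_isProjective [IsNoetherianRing A] {X : GProj A}
    (hX : FrobeniusExact.IsProjective (gprojConflations A) X) :
    ∃ (n : ℕ) (i : X ⟶ gprojOf (Fin n → A) GP.of_projective)
      (r : gprojOf (Fin n → A) GP.of_projective ⟶ X), i ≫ r = 𝟙 X := by
  have := X.property.finite
  obtain ⟨n, p, hp⟩ := Module.Finite.exists_fin' A X.obj
  have hs := IsSES.of_ker hp
  obtain ⟨i, hi⟩ := hX _ ⟨_, _, _, gprojConflations_of_isSES
      (X := gprojOf _ (GP.of_kernel hs GP.of_projective X.property))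
      (Y := gprojOf _ GP.of_projective) (Z := X) hs⟩ (𝟙 X)
  exact ⟨n, i, _, hi⟩

/-! ### The monomorphism category: objects and morphisms -/

variable {S : Type u} [CommRing S] {ω : S}

lemma GP.smul_injective {X : Type u} [AddCommGroup X] [Module S X] (hX : GP S X)
    (hreg : ω ∈ nonZeroDivisors S) {x y : X} (h : ω • x = ω • y) : x = y := by
  have := hX.reflexive
  have : Module.IsTorsionFree S X := inferInstanceAs (Module.IsTorsionFree S (ModuleCat.of S X))
  exact Module.IsTorsionFree.isSMulRegular (isRegular_iff_mem_nonZeroDivisors.2 hreg) h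

namespace Mon

/-- The injective linear map underlying an object of `Mon(ω, 𝒢)`. -/
def arr (X : Mon ω) : X.obj.left →ₗ[S] X.obj.right := X.obj.hom.hom

/-- The component on sources of a morphism of `Mon(ω, 𝒢)`. -/
def lft {X Y : Mon ω} (φ : X ⟶ Y) : X.obj.left →ₗ[S] Y.obj.left := φ.hom.left.hom

/-- The component on targets of a morphism of `Mon(ω, 𝒢)`. -/
def rgt {X Y : Mon ω} (φ : X ⟶ Y) : X.obj.right →ₗ[S] Y.obj.right := φ.hom.right.hom

lemma arr_injective (X : Mon ω) : Function.Injective X.arr := X.property.injective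

lemma exists_arr_eq (X : Mon ω) (y : X.obj.right) : ∃ x, X.arr x = ω • y := by
  have h := X.property.smul_coker (Submodule.Quotient.mk y)
  rw [← Submodule.Quotient.mk_smul, Submodule.Quotient.mk_eq_zero] at h
  exact h

lemma arr_lft {X Y : Mon ω} (φ : X ⟶ Y) (x : X.obj.left) :
    Y.arr (lft φ x) = rgt φ (X.arr x) :=
  congr_arg (fun k : X.obj.left ⟶ Y.obj.right => k.hom x) φ.hom.w

lemma hom_ext {X Y : Mon ω} {φ ψ : X ⟶ Y} (h : ∀ y, rgt φ y = rgt ψ y) : φ = ψ := by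
  apply ObjectProperty.hom_ext
  apply Arrow.hom_ext
  · ext x
    apply Y.arr_injective
    exact (arr_lft φ x).trans ((h _).trans (arr_lft ψ x).symm)
  · ext y
    exact h y

@[simp] lemma rgt_comp {X Y Z : Mon ω} (φ : X ⟶ Y) (ψ : Y ⟶ Z) (x : X.obj.right) :
    rgt (φ ≫ ψ) x = rgt ψ (rgt φ x) := rfl
@[simp] lemma rgt_sub {X Y : Mon ω} (φ ψ : X ⟶ Y) (x : X.obj.right) :
    rgt (φ - ψ) x = rgt φ x - rgt ψ x := rfl

/-- Every object `f : G₁ ⟶ G₀` of `Mon(ω, 𝒢)` underlies a factorization of `ω`: there is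
`g : G₀ ⟶ G₁` with `f g = ω` and `g f = ω`. -/
lemma exists_adj (X : Mon ω) : ∃ g : X.obj.right →ₗ[S] X.obj.left,
    (∀ y, X.arr (g y) = ω • y) ∧ ∀ x, g (X.arr x) = ω • x := by
  choose g hg using X.exists_arr_eq
  refine ⟨{ toFun := g, map_add' := fun a b => ?_, map_smul' := fun a b => ?_ }, hg, fun x => ?_⟩
  · apply X.arr_injective
    simp [hg]
  · apply X.arr_injective
    simp [hg, smul_comm a ω b]
  · apply X.arr_injective
    exact (hg _).trans (map_smul _ _ _).symm

/-- The object of `Mon(ω, 𝒢)` given by a linear map. -/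
abbrev of {G₁ G₀ : Type u} [AddCommGroup G₁] [AddCommGroup G₀] [Module S G₁] [Module S G₀]
    (f : G₁ →ₗ[S] G₀) (h₁ : GP S G₁) (h₀ : GP S G₀) (hf : Function.Injective f)
    (hω : ∀ y, ∃ x, f x = ω • y) : Mon ω :=
  ⟨Arrow.mk (ModuleCat.ofHom f),
    { left := h₁
      right := h₀
      injective := hf
      smul_coker := fun y => by
        obtain ⟨y, rfl⟩ := Submodule.Quotient.mk_surjective _ y
        obtain ⟨x, hx⟩ := hω y
        rw [← Submodule.Quotient.mk_smul, Submodule.Quotient.mk_eq_zero]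
        exact ⟨x, hx⟩ }⟩

/-- The morphism of `Mon(ω, 𝒢)` given by a commutative square of linear maps. -/
def homMk {X Y : Mon ω} (l : X.obj.left →ₗ[S] Y.obj.left) (r : X.obj.right →ₗ[S] Y.obj.right)
    (h : ∀ x, Y.arr (l x) = r (X.arr x)) : X ⟶ Y :=
  ObjectProperty.homMk (Arrow.homMk (ModuleCat.ofHom l) (ModuleCat.ofHom r)
    (by ext x; exact h x))

end Mon

/-! ### The exact structure of the monomorphism category -/

lemma monConflations_eq : monConflations ω = shortExactConflations (monProperty ω) := by
  funext T
  exact propext (Arrow.shortExact_iff (T.map (monProperty ω).ι)).symm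

lemma isSES_left_of_shortExact {T : ShortComplex (Arrow (ModuleCat.{u} S))} (h : T.ShortExact) :
    IsSES T.f.left.hom T.g.left.hom :=
  IsSES.of_shortExact (T := T.map Arrow.leftFunc) ((Arrow.shortExact_iff T).1 h).1

lemma isSES_right_of_shortExact {T : ShortComplex (Arrow (ModuleCat.{u} S))} (h : T.ShortExact) :
    IsSES T.f.right.hom T.g.right.hom :=
  IsSES.of_shortExact (T := T.map Arrow.rightFunc) ((Arrow.shortExact_iff T).1 h).2

lemma arrow_comm {X Y : Arrow (ModuleCat.{u} S)} (φ : X ⟶ Y) (x : X.left) :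
    Y.hom (φ.left x) = φ.right (X.hom x) :=
  congr_arg (fun k : X.left ⟶ Y.right => k.hom x) φ.w

/-- An extension of objects of `Mon(ω, 𝒢)` can only fail to be one because of the condition
on the cokernel. -/
lemma monProperty_of_extension {T : ShortComplex (Arrow (ModuleCat.{u} S))} (hT : T.ShortExact)
    (h₁ : monProperty ω T.X₁) (h₃ : monProperty ω T.X₃)
    (hω : ∀ y : T.X₂.right, ∃ x : T.X₂.left, T.X₂.hom x = ω • y) : monProperty ω T.X₂ where
  left := GP.of_extension (isSES_left_of_shortExact hT) h₁.left h₃.left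
  right := GP.of_extension (isSES_right_of_shortExact hT) h₁.right h₃.right
  injective := by
    have hl := isSES_left_of_shortExact hT
    have hr := isSES_right_of_shortExact hT
    refine (injective_iff_map_eq_zero T.X₂.hom.hom).2 fun x hx => ?_
    have h0 : T.g.left x = 0 := h₃.injective (by
      rw [arrow_comm]
      exact (congr_arg T.g.right hx).trans ((map_zero _).trans (map_zero _).symm))
    obtain ⟨y, rfl⟩ := (hl.exact x).1 h0
    have : T.X₁.hom y = 0 := hr.inj (by
      refine (arrow_comm T.f y).symm.trans (Eq.trans hx (map_zero _).symm))
    have : y = 0 := h₁.injective (this.trans (map_zero _).symm)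
    rw [this, map_zero]
  smul_coker y := by
    obtain ⟨y, rfl⟩ := Submodule.Quotient.mk_surjective _ y
    obtain ⟨x, hx⟩ := hω y
    rw [← Submodule.Quotient.mk_smul, Submodule.Quotient.mk_eq_zero]
    exact ⟨x, hx⟩

open ZeroObject in
lemma isConflationClosed_monProperty : IsConflationClosed (monProperty ω) where
  of_iso {X Y} e h :=
    { left := GP.of_equiv (Arrow.leftFunc.mapIso e).toLinearEquiv h.left
      right := GP.of_equiv (Arrow.rightFunc.mapIso e).toLinearEquiv h.right
      injective := by
        intro x y hxy
        have hinj : Function.Injective e.inv.left :=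
          (Arrow.leftFunc.mapIso e).toLinearEquiv.symm.injective
        refine hinj (h.injective ?_)
        rw [arrow_comm, arrow_comm]
        exact congr_arg e.inv.right hxy
      smul_coker := fun y => by
        obtain ⟨y, rfl⟩ := Submodule.Quotient.mk_surjective _ y
        obtain ⟨y, rfl⟩ : ∃ z, e.hom.right z = y :=
          (Arrow.rightFunc.mapIso e).toLinearEquiv.surjective y
        obtain ⟨x, hx⟩ := Mon.exists_arr_eq ⟨X, h⟩ y
        rw [← Submodule.Quotient.mk_smul, Submodule.Quotient.mk_eq_zero]
        exact ⟨e.hom.left x, (arrow_comm e.hom x).trans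
          ((congr_arg e.hom.right hx).trans (map_smul e.hom.right.hom ω y))⟩ }
  zero := by
    have h₁ : Subsingleton (0 : Arrow (ModuleCat.{u} S)).left :=
      ModuleCat.subsingleton_of_isZero (Arrow.leftFunc.map_isZero (isZero_zero _))
    have h₂ : Subsingleton (0 : Arrow (ModuleCat.{u} S)).right :=
      ModuleCat.subsingleton_of_isZero (Arrow.rightFunc.map_isZero (isZero_zero _))
    exact
      { left := GP.of_subsingleton _
        right := GP.of_subsingleton _
        injective := fun x y _ => h₁.elim x y
        smul_coker := fun y => by
          obtain ⟨y, rfl⟩ := Submodule.Quotient.mk_surjective _ y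
          rw [h₂.elim y 0, Submodule.Quotient.mk_zero, smul_zero] }
  biprod {X Y} hX hY := by
    have hs : (ShortComplex.mk (biprod.inl : X ⟶ X ⊞ Y) biprod.snd (by simp)).ShortExact :=
      (ShortComplex.Splitting.ofHasBinaryBiproduct X Y).shortExact
    refine monProperty_of_extension hs hX hY fun y => ?_
    obtain ⟨a, ha⟩ := Mon.exists_arr_eq ⟨X, hX⟩ ((biprod.fst : X ⊞ Y ⟶ X).right y)
    obtain ⟨b, hb⟩ := Mon.exists_arr_eq ⟨Y, hY⟩ ((biprod.snd : X ⊞ Y ⟶ Y).right y)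
    refine ⟨(biprod.inl : X ⟶ X ⊞ Y).left a + (biprod.inr : Y ⟶ X ⊞ Y).left b, ?_⟩
    have ht : (biprod.inl : X ⟶ X ⊞ Y).right ((biprod.fst : X ⊞ Y ⟶ X).right y) +
        (biprod.inr : Y ⟶ X ⊞ Y).right ((biprod.snd : X ⊞ Y ⟶ Y).right y) = y :=
      congr_arg (fun k : X ⊞ Y ⟶ X ⊞ Y => k.right y) (biprod.total (X := X) (Y := Y))
    refine (map_add _ _ _).trans ?_
    refine (congr_arg₂ (· + ·) (arrow_comm _ a) (arrow_comm _ b)).trans ?_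
    refine (congr_arg₂ (fun c d => (biprod.inl : X ⟶ X ⊞ Y).right c +
      (biprod.inr : Y ⟶ X ⊞ Y).right d) ha hb).trans ?_
    conv_rhs => rw [← ht]
    rw [smul_add]
    exact congr_arg₂ (· + ·) (map_smul _ _ _) (map_smul _ _ _)
  ext_quotient T hT h₁ h₃ V q _ hV := by
    refine monProperty_of_extension hT h₁ h₃ fun y => ?_
    have : Epi (Arrow.rightFunc.map q) := inferInstance
    obtain ⟨y, rfl⟩ := (ModuleCat.epi_iff_surjective (Arrow.rightFunc.map q)).1 this y
    obtain ⟨x, hx⟩ := Mon.exists_arr_eq ⟨V, hV⟩ y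
    exact ⟨q.left x, (arrow_comm q x).trans
      ((congr_arg q.right hx).trans (map_smul q.right.hom ω y))⟩
  ext_kernel T hT h₁ h₃ V U i d w hV hU hlim := by
    refine monProperty_of_extension hT h₁ h₃ fun y => ?_
    have : Mono i := ⟨fun _ _ h => Fork.IsLimit.hom_ext hlim h⟩
    have hex : (ShortComplex.mk i d w).Exact := ShortComplex.exact_of_f_is_kernel _ hlim
    have hl := (ShortComplex.ShortExact.moduleCat_exact_iff_function_exact _).1
      (hex.map Arrow.leftFunc)
    have hmono : Mono (Arrow.rightFunc.map i) := inferInstance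
    have hinj := (ModuleCat.mono_iff_injective (Arrow.rightFunc.map i)).1 hmono
    obtain ⟨v, hv⟩ := Mon.exists_arr_eq ⟨V, hV⟩ (i.right y)
    replace hv : V.hom v = ω • i.right y := hv
    have hdi : d.right (i.right y) = 0 := congr_arg (fun k : T.X₂ ⟶ U => k.right y) w
    have hd : d.left v = 0 := hU.injective (by
      rw [arrow_comm, hv, map_zero]
      exact (map_smul d.right.hom ω _).trans (by rw [hdi, smul_zero]))
    obtain ⟨x, hx⟩ := (hl v).1 hd
    replace hx : i.left x = v := hx
    refine ⟨x, hinj ?_⟩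
    refine (arrow_comm i x).symm.trans ?_
    rw [hx, hv]
    exact (map_smul i.right.hom ω y).symm

lemma isExactStructure_mon : IsExactStructure (monConflations ω) := by
  rw [monConflations_eq]
  exact isConflationClosed_monProperty.isExactStructure

end GorensteinMono

namespace GorensteinMono

open FrobeniusExact

variable {S : Type u} [CommRing S] {ω : S}

/-! ### The Frobenius structure of the monomorphism category -/

namespace Mon

lemma isSES_lft {T : ShortComplex (Mon ω)} (hT : monConflations ω T) :
    IsSES (lft T.f) (lft T.g) :=
  IsSES.of_shortExact (T := T.map ((monProperty ω).ι ⋙ Arrow.leftFunc)) hT.1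

lemma isSES_rgt {T : ShortComplex (Mon ω)} (hT : monConflations ω T) :
    IsSES (rgt T.f) (rgt T.g) :=
  IsSES.of_shortExact (T := T.map ((monProperty ω).ι ⋙ Arrow.rightFunc)) hT.2

lemma conflation_mk {X Y Z : Mon ω} {f : X ⟶ Y} {g : Y ⟶ Z} (hl : IsSES (lft f) (lft g))
    (hr : IsSES (rgt f) (rgt g)) :
    ∃ w : f ≫ g = 0, monConflations ω (ShortComplex.mk f g w) :=
  ⟨hom_ext fun y => hr.comp_eq_zero y, hl.shortExact, hr.shortExact⟩

variable [IsNoetherianRing S]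

section Kernel

variable {X Y : Mon ω} (φ : X ⟶ Y) (hl : Function.Surjective (lft φ))
  (hr : Function.Surjective (rgt φ))

/-- The kernel of a morphism of `Mon(ω, 𝒢)` which is surjective on sources and on targets. -/
abbrev ker : Mon ω :=
  of (G₁ := LinearMap.ker (lft φ)) (G₀ := LinearMap.ker (rgt φ))
    (X.arr.restrict (p := LinearMap.ker (lft φ)) (q := LinearMap.ker (rgt φ)) fun x hx => by
      rw [LinearMap.mem_ker] at hx ⊢
      rw [← arr_lft, hx, map_zero])
    (GP.of_kernel (IsSES.of_ker hl) X.property.left Y.property.left)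
    (GP.of_kernel (IsSES.of_ker hr) X.property.right Y.property.right)
    (fun x y hxy => Subtype.ext (X.arr_injective (congr_arg Subtype.val hxy)))
    (fun y => by
      obtain ⟨x, hx⟩ := X.exists_arr_eq y
      have hy : rgt φ y.1 = 0 := y.2
      refine ⟨⟨x, Y.arr_injective ?_⟩, Subtype.ext hx⟩
      rw [arr_lft, hx, map_smul, hy, smul_zero, map_zero])

/-- The inclusion of the kernel. -/
def kerι : ker φ hl hr ⟶ X :=
  homMk (X := ker φ hl hr) (LinearMap.ker (lft φ)).subtype (LinearMap.ker (rgt φ)).subtype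
    (fun _ => rfl)

lemma kerι_conflation :
    ∃ w : kerι φ hl hr ≫ φ = 0, monConflations ω (ShortComplex.mk (kerι φ hl hr) φ w) :=
  conflation_mk (IsSES.of_ker hl) (IsSES.of_ker hr)

end Kernel

end Mon

/-- The object `(1 × ω) : P × Q ⟶ P × Q` of `Mon(ω, 𝒢)`, for finitely generated projective modules
`P` and `Q`. These objects are projective and injective. -/
abbrev Mon.triv (ω : S) (hreg : ω ∈ nonZeroDivisors S) (P Q : Type u) [AddCommGroup P]
    [AddCommGroup Q] [Module S P] [Module S Q] [Module.Finite S P] [Module.Finite S Q]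
    [Module.Projective S P] [Module.Projective S Q] : Mon ω :=
  Mon.of (LinearMap.prodMap (LinearMap.id : P →ₗ[S] P) (LinearMap.lsmul S Q ω))
    GP.of_projective GP.of_projective
    (fun _ _ hxy => Prod.ext (Prod.ext_iff.1 hxy).1
      (GP.smul_injective (GP.of_projective (X := Q)) hreg (Prod.ext_iff.1 hxy).2))
    (fun y => ⟨(ω • y.1, y.2), rfl⟩)

namespace Mon

section Triv

variable {hreg : ω ∈ nonZeroDivisors S} {P Q : Type u} [AddCommGroup P]
    [AddCommGroup Q] [Module S P] [Module S Q] [Module.Finite S P] [Module.Finite S Q]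
    [Module.Projective S P] [Module.Projective S Q]

/-- Morphisms from `(1 × ω) : P × Q ⟶ P × Q` are given by a map from `P` to the source and a map
from `Q` to the target. -/
lemma exists_triv_hom (X : Mon ω) (a : P →ₗ[S] X.obj.left) (b : Q →ₗ[S] X.obj.right) :
    ∃ φ : triv ω hreg P Q ⟶ X, (∀ p : P, lft φ (p, (0 : Q)) = a p) ∧
      ∀ (p : P) (q : Q), rgt φ (p, q) = X.arr (a p) + b q := by
  obtain ⟨g, hg, hg'⟩ := X.exists_adj
  refine ⟨homMk (X := triv ω hreg P Q) (a.coprod (g ∘ₗ b)) ((X.arr ∘ₗ a).coprod b) ?_, ?_, ?_⟩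
  · rintro ⟨p, q⟩
    change X.arr (a p + g (b q)) = X.arr (a p) + b (ω • q)
    rw [map_add, hg, map_smul]
  · intro p
    change a p + g (b 0) = a p
    simp
  · intro p q
    rfl

lemma triv_rgt {X : Mon ω} (φ : triv ω hreg P Q ⟶ X) (p : P) (q : Q) :
    rgt φ (p, q) = X.arr (lft φ (p, (0 : Q))) + rgt φ ((0 : P), q) := by
  rw [arr_lft, ← map_add]
  congr 1
  change (p, q) = (p, ω • (0 : Q)) + (0, q)
  simp

lemma triv_isProjective :
    FrobeniusExact.IsProjective (monConflations ω) (triv ω hreg P Q) := by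
  rintro Y Z p ⟨K, i, w, h⟩ φ
  obtain ⟨a, ha⟩ := Module.projective_lifting_property (lft p) (lft φ ∘ₗ LinearMap.inl S P Q)
    (isSES_lft h).surj
  obtain ⟨b, hb⟩ := Module.projective_lifting_property (rgt p) (rgt φ ∘ₗ LinearMap.inr S P Q)
    (isSES_rgt h).surj
  obtain ⟨ψ, hψ, hψ'⟩ := exists_triv_hom (hreg := hreg) Y a b
  refine ⟨ψ, hom_ext ?_⟩
  rintro ⟨x, y⟩
  rw [rgt_comp, hψ', triv_rgt φ, map_add, ← arr_lft]
  exact congr_arg₂ (fun u v => Z.arr u + v) (LinearMap.congr_fun ha x) (LinearMap.congr_fun hb y)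

/-- Morphisms to `(1 × ω) : P × Q ⟶ P × Q` are given by a map from the target to `P` and a map
from the source to `Q`. -/
lemma exists_hom_triv (X : Mon ω) (a : X.obj.right →ₗ[S] P) (b : X.obj.left →ₗ[S] Q) :
    ∃ φ : X ⟶ triv ω hreg P Q, (∀ x, lft φ x = (a (X.arr x), b x)) ∧
      ∀ y, (rgt φ y : P × Q).1 = a y ∧ ∀ x, X.arr x = ω • y → (rgt φ y : P × Q).2 = b x := by
  obtain ⟨g, hg, hg'⟩ := X.exists_adj
  refine ⟨homMk (Y := triv ω hreg P Q) ((a ∘ₗ X.arr).prod b) (a.prod (b ∘ₗ g)) ?_,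
    fun x => rfl, fun y => ⟨rfl, fun x hx => ?_⟩⟩
  · intro x
    change (a (X.arr x), ω • b x) = (a (X.arr x), b (g (X.arr x)))
    rw [hg', map_smul]
  · change b (g y) = b x
    rw [X.arr_injective ((hg y).trans hx.symm)]

lemma triv_isInjective :
    FrobeniusExact.IsInjective (monConflations ω) (triv ω hreg P Q) := by
  rintro X Y i ⟨K, p, w, h⟩ φ
  obtain ⟨a, ha⟩ := (isSES_rgt h).extend_projective (K.property.right.ext_eq_zero 1 le_rfl)
    (LinearMap.fst S P Q ∘ₗ rgt φ)
  obtain ⟨b, hb⟩ := (isSES_lft h).extend_projective (K.property.left.ext_eq_zero 1 le_rfl)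
    (LinearMap.snd S P Q ∘ₗ lft φ)
  obtain ⟨ψ, hψ, hψ'⟩ := exists_hom_triv (hreg := hreg) Y a b
  refine ⟨ψ, hom_ext fun y => ?_⟩
  obtain ⟨x, hx⟩ := X.exists_arr_eq y
  have hx' : Y.arr (lft i x) = ω • rgt i y := by rw [arr_lft, hx, map_smul]
  refine Prod.ext ((hψ' _).1.trans (LinearMap.congr_fun ha y)) (((hψ' _).2 _ hx').trans ?_)
  refine (LinearMap.congr_fun hb x).trans ?_
  -- both sides agree after multiplication by `ω`
  apply GP.smul_injective (GP.of_projective (X := Q)) hreg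
  have := congr_arg Prod.snd (arr_lft φ x)
  rw [hx, map_smul] at this
  exact this

end Triv

/-- If a module embeds in `Q` with Gorenstein projective cokernel, it still does so after any map
to a Gorenstein projective module `P` is added. -/
lemma gp_quotient_prod {A : Type u} [CommRing A] {X P Q N : Type u} [AddCommGroup X]
    [AddCommGroup P] [AddCommGroup Q] [AddCommGroup N] [Module A X] [Module A P] [Module A Q]
    [Module A N] {b : X →ₗ[A] Q} {π : Q →ₗ[A] N} (h : IsSES b π) (hP : GP A P) (hN : GP A N)
    (c : X →ₗ[A] P) : GP A ((P × Q) ⧸ LinearMap.range (c.prod b)) := by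
  refine GP.of_extension (X := P) (Z := N)
    (f := (LinearMap.range (c.prod b)).mkQ ∘ₗ LinearMap.inl A P Q)
    (g := (LinearMap.range (c.prod b)).liftQ (π ∘ₗ LinearMap.snd A P Q) ?_) ?_ hP hN
  · rintro _ ⟨x, rfl⟩
    exact h.comp_eq_zero x
  · refine { inj := ?_, surj := ?_, exact := ?_ }
    · refine (injective_iff_map_eq_zero _).2 fun p hp => ?_
      obtain ⟨x, hx⟩ := (Submodule.Quotient.mk_eq_zero _).1 hp
      have : x = 0 := h.inj ((congr_arg Prod.snd hx).trans (map_zero b).symm)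
      rw [← show c x = p from congr_arg Prod.fst hx, this, map_zero]
    · intro n
      obtain ⟨q, rfl⟩ := h.surj n
      exact ⟨Submodule.Quotient.mk (0, q), rfl⟩
    · intro y
      obtain ⟨⟨p, q⟩, rfl⟩ := Submodule.Quotient.mk_surjective _ y
      constructor
      · intro hy
        obtain ⟨x, rfl⟩ := (h.exact q).1 hy
        refine ⟨p - c x, ?_⟩
        refine (Submodule.Quotient.eq _).2 ⟨-x, ?_⟩
        simp
      · rintro ⟨p', hp'⟩
        rw [← hp']
        exact map_zero π

variable [IsNoetherianRing S]

lemma exists_triv_deflation (hreg : ω ∈ nonZeroDivisors S) (X : Mon ω) :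
    ∃ (a b : ℕ) (φ : triv ω hreg (Fin a → S) (Fin b → S) ⟶ X) (K : Mon ω) (i : K ⟶ _)
      (w : i ≫ φ = 0), monConflations ω (ShortComplex.mk i φ w) := by
  have := X.property.left.finite
  have := X.property.right.finite
  obtain ⟨a, f, hf⟩ := Module.Finite.exists_fin' S X.obj.left
  obtain ⟨b, g, hg⟩ := Module.Finite.exists_fin' S X.obj.right
  obtain ⟨φ, hφ, hφ'⟩ := exists_triv_hom (hreg := hreg) X f g
  have hl : Function.Surjective (lft φ) := fun x => by
    obtain ⟨p, rfl⟩ := hf x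
    exact ⟨_, hφ p⟩
  have hr : Function.Surjective (rgt φ) := fun x => by
    obtain ⟨p, rfl⟩ := hg x
    exact ⟨(0, p), (hφ' 0 p).trans (by simp)⟩
  exact ⟨a, b, φ, _, _, kerι_conflation φ hl hr⟩

lemma exists_triv_inflation (hreg : ω ∈ nonZeroDivisors S) (X : Mon ω) :
    ∃ (a b : ℕ) (φ : X ⟶ triv ω hreg (Fin a → S) (Fin b → S)) (K : Mon ω) (p : _ ⟶ K)
      (w : φ ≫ p = 0), monConflations ω (ShortComplex.mk φ p w) := by
  obtain ⟨a, N₀, _, _, f, f', hf, hN₀⟩ := GP.exists_cosyzygy (A := S) (X := X.obj.right)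
    X.property.right
  obtain ⟨b, N₁, _, _, g, g', hg, hN₁⟩ := GP.exists_cosyzygy (A := S) (X := X.obj.left)
    X.property.left
  obtain ⟨adj, hadj, hadj'⟩ := X.exists_adj
  obtain ⟨φ, hφ, hφ'⟩ := exists_hom_triv (hreg := hreg) X f g
  -- the components of `φ`
  let P := Fin a → S
  let Q := Fin b → S
  let l : X.obj.left →ₗ[S] P × Q := (f ∘ₗ X.arr).prod g
  let r : X.obj.right →ₗ[S] P × Q := f.prod (g ∘ₗ adj)
  have hlφ : ∀ x, lft φ x = l x := hφ
  have hrφ : ∀ y, rgt φ y = r y := fun y => Prod.ext (hφ' y).1 ((hφ' y).2 _ (hadj y))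
  let t : P × Q →ₗ[S] P × Q := LinearMap.prodMap LinearMap.id (LinearMap.lsmul S Q ω)
  have ht : ∀ x, t (l x) = r (X.arr x) := fun x => by
    rw [← hlφ, ← hrφ]
    exact arr_lft φ x
  have hL : GP S ((P × Q) ⧸ LinearMap.range l) := gp_quotient_prod hg GP.of_projective hN₁ _
  have hR : GP S ((P × Q) ⧸ LinearMap.range r) := by
    have := gp_quotient_prod hf (GP.of_projective (X := Q)) hN₀ (g ∘ₗ adj)
    refine GP.of_equiv (Submodule.Quotient.equiv _ _ (LinearEquiv.prodComm S Q P) ?_) this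
    ext ⟨p, q⟩
    constructor
    · rintro ⟨_, ⟨x, rfl⟩, hx⟩
      exact ⟨x, hx⟩
    · rintro ⟨x, hx⟩
      exact ⟨_, ⟨x, rfl⟩, hx⟩
  let k : ((P × Q) ⧸ LinearMap.range l) →ₗ[S] ((P × Q) ⧸ LinearMap.range r) :=
    Submodule.mapQ _ _ t (by
      rintro _ ⟨x, rfl⟩
      exact ⟨_, (ht x).symm⟩)
  have hk : Function.Injective k := by
    refine (injective_iff_map_eq_zero _).2 fun x hx => ?_
    obtain ⟨⟨p, q⟩, rfl⟩ := Submodule.Quotient.mk_surjective _ x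
    obtain ⟨y, hy⟩ := (Submodule.Quotient.mk_eq_zero _).1 hx
    have h₁ : f y = p := congr_arg Prod.fst hy
    have h₂ : g (adj y) = ω • q := congr_arg Prod.snd hy
    -- the cokernel of `g` is Gorenstein projective, hence `ω`-torsion free
    have hq : g' q = 0 := hN₁.smul_injective hreg (by
      rw [← map_smul, ← h₂, hg.comp_eq_zero, smul_zero])
    obtain ⟨x, rfl⟩ := (hg.exact q).1 hq
    have hx : adj y = ω • x := hg.inj (by rw [h₂, map_smul])
    have hxy : X.arr x = y := GP.smul_injective (X := X.obj.right) X.property.right hreg (by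
      rw [← map_smul, ← hx, hadj])
    refine (Submodule.Quotient.mk_eq_zero _).2 ⟨x, ?_⟩
    change (f (X.arr x), g x) = (p, g x)
    rw [hxy, h₁]
  have hkω : ∀ y, ∃ x, k x = ω • y := fun y => by
    obtain ⟨⟨p, q⟩, rfl⟩ := Submodule.Quotient.mk_surjective _ y
    exact ⟨Submodule.Quotient.mk (ω • p, q), rfl⟩
  let K : Mon ω := of k hL hR hk hkω
  let π : triv ω hreg P Q ⟶ K := homMk (X := triv ω hreg P Q) (Y := K) (LinearMap.range l).mkQ
    (LinearMap.range r).mkQ (fun _ => rfl)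
  refine ⟨a, b, φ, K, π, conflation_mk ?_ ?_⟩
  · have : lft φ = l := LinearMap.ext hlφ
    rw [this]
    exact
      { inj := fun x y hxy => hg.inj (congr_arg Prod.snd hxy)
        surj := Submodule.mkQ_surjective _
        exact := LinearMap.exact_iff.2 (Submodule.ker_mkQ _) }
  · have : rgt φ = r := LinearMap.ext hrφ
    rw [this]
    exact
      { inj := fun x y hxy => hf.inj (congr_arg Prod.fst hxy)
        surj := Submodule.mkQ_surjective _
        exact := LinearMap.exact_iff.2 (Submodule.ker_mkQ _) }

end Mon

/-- The projective-injective objects of `Mon(ω, 𝒢)` are the retracts of the objects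
`(1 × ω) : P × Q ⟶ P × Q`. -/
theorem isFrobenius_mon [IsNoetherianRing S] (hreg : ω ∈ nonZeroDivisors S) :
    IsFrobenius (monConflations ω) := by
  refine IsFrobenius.of_class isExactStructure_mon
    (fun X => ∃ a b : ℕ, X = Mon.triv ω hreg (Fin a → S) (Fin b → S)) ?_ ?_ ?_ ?_
  · rintro _ ⟨a, b, rfl⟩
    exact Mon.triv_isProjective
  · rintro _ ⟨a, b, rfl⟩
    exact Mon.triv_isInjective
  · intro X
    obtain ⟨a, b, φ, K, i, w, h⟩ := Mon.exists_triv_deflation hreg X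
    exact ⟨_, h, rfl, a, b, rfl⟩
  · intro X
    obtain ⟨a, b, φ, K, i, w, h⟩ := Mon.exists_triv_inflation hreg X
    exact ⟨_, h, rfl, a, b, rfl⟩

end GorensteinMono

namespace GorensteinMono

open FrobeniusExact

variable {S : Type u} [CommRing S] {ω : S}

/-! ### Syzygies over `S` of Gorenstein projective `R`-modules -/

/-- The reduction map `Sⁿ ⟶ Rⁿ` for `R = S/(ω)`. -/
def red (ω : S) (n : ℕ) : (Fin n → S) →ₗ[S] (Fin n → FactorRing ω) :=
  (Algebra.linearMap S (FactorRing ω)).compLeft (Fin n)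

lemma red_surjective (n : ℕ) : Function.Surjective (red ω n) := fun y => by
  choose x hx using fun i => Ideal.Quotient.mk_surjective (y i)
  exact ⟨x, funext hx⟩

lemma mk_eq_zero_iff (x : S) :
    Ideal.Quotient.mk (Ideal.span {ω}) x = 0 ↔ ∃ y, x = ω * y := by
  rw [Ideal.Quotient.eq_zero_iff_mem, Ideal.mem_span_singleton]
  rfl

lemma exists_of_red_eq_zero {n : ℕ} {x : Fin n → S} (hx : red ω n x = 0) : ∃ y, x = ω • y := by
  choose y hy using fun i => (mk_eq_zero_iff (ω := ω) (x i)).1 (congr_fun hx i)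
  exact ⟨y, funext hy⟩

lemma omega_smul {N : Type*} [AddCommGroup N] [Module S N] [Module (FactorRing ω) N]
    [IsScalarTower S (FactorRing ω) N] (x : N) : ω • x = 0 := by
  rw [← algebraMap_smul (FactorRing ω) ω x]
  have : algebraMap S (FactorRing ω) ω = 0 := (mk_eq_zero_iff ω).2 ⟨1, by simp⟩
  rw [this, zero_smul]

lemma red_smul (n : ℕ) (x : Fin n → S) : red ω n (ω • x) = 0 := by
  rw [map_smul, omega_smul]

lemma smul_fin_injective (hreg : ω ∈ nonZeroDivisors S) {n : ℕ} {x y : Fin n → S}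
    (h : ω • x = ω • y) : x = y :=
  GP.smul_injective (GP.of_projective (X := Fin n → S)) hreg h

lemma mul_left_cancel_of_reg (hreg : ω ∈ nonZeroDivisors S) {x y : S}
    (h : ω * x = ω * y) : x = y :=
  (mul_cancel_left_mem_nonZeroDivisors hreg).1 h

/-- A linear map all of whose values are divisible by `ω` may be divided by `ω`. -/
lemma exists_div {G : Type*} [AddCommGroup G] [Module S G] {X : Type*} [AddCommGroup X]
    [Module S X] (hX : ∀ {x y : X}, ω • x = ω • y → x = y) (k : G →ₗ[S] X)
    (hk : ∀ x, ∃ y, k x = ω • y) : ∃ l : G →ₗ[S] X, ∀ x, k x = ω • l x := by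
  choose l hl using hk
  refine ⟨{ toFun := l, map_add' := fun a b => hX ?_, map_smul' := fun a b => hX ?_ }, hl⟩
  · rw [← hl, map_add, hl, hl, smul_add]
  · rw [← hl, map_smul, hl, RingHom.id_apply, smul_comm]

/-- A short exact sequence `0 ⟶ N' ⟶ Rᵐ ⟶ N ⟶ 0` of `R`-modules with `N` Gorenstein projective
induces a short exact sequence of `S`-syzygies `0 ⟶ Ω N' ⟶ Sˡ × Sᵐ ⟶ Ω N ⟶ 0`, and functionals
extend along it. This is the elementary form of the isomorphism
`Ext_S^{i+1}(-, S) ≅ Ext_R^i(-, R)` that the argument needs: a functional `h` on the syzygy of `N'`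
has as obstruction to its extension to `Sˡ` the functional on `N'` induced by `q ↦ h (ω q)`. -/
lemma exists_syzygy_sequence (hreg : ω ∈ nonZeroDivisors S) {N N' : Type u} [AddCommGroup N]
    [AddCommGroup N'] [Module S N] [Module (FactorRing ω) N] [IsScalarTower S (FactorRing ω) N]
    [Module S N'] [Module (FactorRing ω) N'] [IsScalarTower S (FactorRing ω) N'] {l m : ℕ}
    {i : N' →ₗ[FactorRing ω] (Fin m → FactorRing ω)} {π : (Fin m → FactorRing ω) →ₗ[FactorRing ω] N}
    (hs : IsSES i π) (hN : GP (FactorRing ω) N) {p' : (Fin l → S) →ₗ[S] N'}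
    (hp' : Function.Surjective p') {p : (Fin m → S) →ₗ[S] N} (hp : ∀ x, p x = π (red ω m x)) :
    ∃ (f : LinearMap.ker p' →ₗ[S] (Fin l → S) × (Fin m → S))
      (g : (Fin l → S) × (Fin m → S) →ₗ[S] LinearMap.ker p),
      IsSES f g ∧ ∀ k : LinearMap.ker p' →ₗ[S] S,
        ∃ k' : (Fin l → S) × (Fin m → S) →ₗ[S] S, k' ∘ₗ f = k := by
  obtain ⟨s, hs'⟩ := Module.projective_lifting_property (red ω m) (i.restrictScalars S ∘ₗ p')
    (red_surjective m)
  replace hs' : ∀ q, red ω m (s q) = i (p' q) := LinearMap.congr_fun hs'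
  obtain ⟨t, ht⟩ := exists_div (smul_fin_injective hreg)
    (s ∘ₗ (LinearMap.ker p').subtype) fun q => exists_of_red_eq_zero (by
      have : p' q.1 = 0 := q.2
      change red ω m (s q.1) = 0
      rw [hs', this, map_zero])
  replace ht : ∀ q : LinearMap.ker p', s q.1 = ω • t q := ht
  let f : LinearMap.ker p' →ₗ[S] (Fin l → S) × (Fin m → S) := (LinearMap.ker p').subtype.prod t
  let g : (Fin l → S) × (Fin m → S) →ₗ[S] LinearMap.ker p :=
    LinearMap.codRestrict _ (s.coprod (-LinearMap.lsmul S (Fin m → S) ω)) fun x => by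
      change p (s x.1 + -(ω • x.2)) = 0
      rw [hp, map_add, map_neg, red_smul, hs', neg_zero, add_zero, hs.comp_eq_zero]
  have hg : ∀ x, (g x : Fin m → S) = s x.1 + -(ω • x.2) := fun _ => rfl
  refine ⟨f, g, ⟨fun x y hxy => Subtype.ext (Prod.ext_iff.1 hxy).1, ?_, ?_⟩, fun h => ?_⟩
  · rintro ⟨y, hy⟩
    rw [LinearMap.mem_ker, hp] at hy
    obtain ⟨n, hn⟩ := (hs.exact _).1 hy
    obtain ⟨q, rfl⟩ := hp' n
    obtain ⟨z, hz⟩ := exists_of_red_eq_zero (ω := ω) (x := y - s q) (by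
      rw [map_sub, hs', hn, sub_self])
    refine ⟨(q, -z), Subtype.ext ?_⟩
    rw [hg, smul_neg, neg_neg, ← hz]
    abel
  · rintro ⟨q, x⟩
    rw [← Subtype.coe_inj, hg]
    constructor
    · intro hqx
      replace hqx : s q = ω • x := add_neg_eq_zero.1 hqx
      have hq : p' q = 0 := hs.inj (by rw [← hs', hqx, red_smul, map_zero])
      refine ⟨⟨q, hq⟩, Prod.ext rfl (smul_fin_injective hreg ?_)⟩
      exact (ht ⟨q, hq⟩).symm.trans hqx
    · rintro ⟨y, hy⟩
      obtain ⟨rfl, rfl⟩ := Prod.ext_iff.1 hy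
      exact add_neg_eq_zero.2 (ht y)
  · have hmem : ∀ q : Fin l → S, ω • q ∈ LinearMap.ker p' := fun q => by
      rw [LinearMap.mem_ker, map_smul, omega_smul]
    let ψ : (Fin l → S) →ₗ[S] S :=
      h ∘ₗ LinearMap.codRestrict _ (LinearMap.lsmul S (Fin l → S) ω) hmem
    have hψ : ∀ q : LinearMap.ker p', ψ q.1 = ω * h q := fun q => by
      rw [← smul_eq_mul, ← map_smul]
      rfl
    -- the obstruction `α : N' ⟶ R`, and its extension `β` to `Rᵐ`
    obtain ⟨α, hα⟩ := exists_comp_eq_of_ker_le hp' (Algebra.linearMap S (FactorRing ω) ∘ₗ ψ)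
      fun q hq => (mk_eq_zero_iff _).2 ⟨_, hψ ⟨q, hq⟩⟩
    obtain ⟨β, hβ⟩ := hs.extend (hN.ext_eq_zero 1 le_rfl)
      (α.extendScalarsOfSurjective Ideal.Quotient.mk_surjective)
    replace hβ : ∀ n, β (i n) = α n := LinearMap.congr_fun hβ
    obtain ⟨γ, hγ⟩ := Module.projective_lifting_property (Algebra.linearMap S (FactorRing ω))
      (β.restrictScalars S ∘ₗ red ω m) Ideal.Quotient.mk_surjective
    replace hγ : ∀ x, Ideal.Quotient.mk (Ideal.span {ω}) (γ x) = β (red ω m x) :=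
      LinearMap.congr_fun hγ
    obtain ⟨δ, hδ⟩ := exists_div (mul_left_cancel_of_reg hreg) (ψ - γ ∘ₗ s) fun q => by
      refine (mk_eq_zero_iff _).1 ?_
      have : Ideal.Quotient.mk (Ideal.span {ω}) (ψ q) = α (p' q) := (hα q).symm
      rw [LinearMap.sub_apply, map_sub, this, LinearMap.comp_apply, hγ, hs', hβ, sub_self]
    refine ⟨δ.coprod γ, LinearMap.ext fun q => mul_left_cancel_of_reg hreg ?_⟩
    have h₁ : ψ q.1 - γ (s q.1) = ω * δ q.1 := hδ q.1
    rw [ht, map_smul, smul_eq_mul, hψ] at h₁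
    change ω * (δ q.1 + γ (t q)) = ω * h q
    rw [mul_add, ← h₁]
    ring

lemma exists_factor_red {N : Type u} [AddCommGroup N]
    [Module S N] [Module (FactorRing ω) N] [IsScalarTower S (FactorRing ω) N] {n : ℕ}
    (p : (Fin n → S) →ₗ[S] N) :
    ∃ π : (Fin n → FactorRing ω) →ₗ[FactorRing ω] N, ∀ x, p x = π (red ω n x) := by
  refine ⟨Fintype.linearCombination (FactorRing ω) fun i => p (Pi.single i 1), fun x => ?_⟩
  rw [Fintype.linearCombination_apply]
  conv_lhs => rw [← Finset.univ_sum_single x, map_sum]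
  refine Finset.sum_congr rfl fun i _ => ?_
  have : (red ω n x) i = algebraMap S (FactorRing ω) (x i) := rfl
  rw [this, algebraMap_smul, ← map_smul, ← Pi.single_smul, smul_eq_mul, mul_one]

/-- The `S`-syzygies of a Gorenstein projective `R`-module are Gorenstein projective. -/
theorem gp_syzygy [IsNoetherianRing S] (hreg : ω ∈ nonZeroDivisors S) {N : Type u}
    [AddCommGroup N] [Module S N] [Module (FactorRing ω) N] [IsScalarTower S (FactorRing ω) N]
    (hN : GP (FactorRing ω) N) {n : ℕ} (p : (Fin n → S) →ₗ[S] N) (hp : Function.Surjective p) :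
    GP S (LinearMap.ker p) := by
  refine GP.of_class (fun K => ∃ (N : Type u) (_ : AddCommGroup N) (_ : Module S N)
      (_ : Module (FactorRing ω) N) (_ : IsScalarTower S (FactorRing ω) N) (n : ℕ)
      (p : (Fin n → S) →ₗ[S] N), GP (FactorRing ω) N ∧ Function.Surjective p ∧
        Nonempty (K ≃ₗ[S] LinearMap.ker p)) ?_ ?_ ?_ _
    ⟨N, _, _, _, inferInstance, n, p, hN, hp, ⟨LinearEquiv.refl _ _⟩⟩
  · rintro K ⟨N, _, _, _, _, n, p, hN, hp, ⟨e⟩⟩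
    exact Module.Finite.equiv e.symm
  · rintro K ⟨N, _, _, _, _, m, p, hN, hp, ⟨e⟩⟩
    obtain ⟨π, hπ⟩ := exists_factor_red (ω := ω) p
    have hπs : Function.Surjective π := fun y => by
      obtain ⟨x, rfl⟩ := hp y
      exact ⟨_, (hπ x).symm⟩
    have hs := IsSES.of_ker hπs
    have hK : GP (FactorRing ω) (LinearMap.ker π) := GP.of_kernel hs GP.of_projective hN
    have : Module.Finite (FactorRing ω) (LinearMap.ker π) := hK.finite
    have : Module.Finite S (LinearMap.ker π) := Module.Finite.trans (FactorRing ω) _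
    obtain ⟨l, p', hp'⟩ := Module.Finite.exists_fin' S (LinearMap.ker π)
    obtain ⟨f, g, hfg, hext⟩ := exists_syzygy_sequence hreg hs hN hp' hπ
    refine ⟨ModuleCat.of S (LinearMap.ker p'), (Fin l → S) × (Fin m → S), inferInstance,
      inferInstance, inferInstance, inferInstance, f, e.symm.toLinearMap ∘ₗ g,
      ⟨_, _, _, _, inferInstance, l, p', hK, hp', ⟨LinearEquiv.refl _ _⟩⟩, ⟨hfg.inj,
      e.symm.surjective.comp hfg.surj, fun x => ?_⟩, hext⟩
    exact (LinearEquiv.map_eq_zero_iff e.symm).trans (hfg.exact x)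
  · rintro K ⟨N, _, _, _, _, l, p', hN, hp', ⟨e⟩⟩
    obtain ⟨m, N', _, _, i, π, hs, hN'⟩ := hN.exists_cosyzygy
    let _ : Module S N' := Module.compHom N' (algebraMap S (FactorRing ω))
    have : IsScalarTower S (FactorRing ω) N' := IsScalarTower.of_algebraMap_smul fun _ _ => rfl
    let p : (Fin m → S) →ₗ[S] N' := π.restrictScalars S ∘ₗ red ω m
    obtain ⟨f, g, hfg, hext⟩ := exists_syzygy_sequence hreg hs hN' hp' (p := p) fun _ => rfl
    refine ⟨ModuleCat.of S (LinearMap.ker p), (Fin l → S) × (Fin m → S), inferInstance,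
      inferInstance, inferInstance, inferInstance, f ∘ₗ e.toLinearMap, g,
      ⟨_, _, _, _, inferInstance, m, p, hN', hs.surj.comp (red_surjective m),
        ⟨LinearEquiv.refl _ _⟩⟩, ⟨hfg.inj.comp e.injective, hfg.surj, fun x => ?_⟩, fun k => ?_⟩
    · refine (hfg.exact x).trans ⟨?_, ?_⟩
      · rintro ⟨y, rfl⟩
        exact ⟨e.symm y, by simp⟩
      · rintro ⟨y, rfl⟩
        exact ⟨e y, rfl⟩
    · obtain ⟨k', hk'⟩ := hext (k ∘ₗ e.symm.toLinearMap)
      refine ⟨k', LinearMap.ext fun x => ?_⟩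
      simpa using LinearMap.congr_fun hk' (e x)

/-! ### Precover sequences -/

section Precover

/-- A short exact sequence of `S`-modules `0 ⟶ P ⟶ G ⟶ M ⟶ 0`, with `P ⟶ G` in `Mon(ω, 𝒢)` and `P`
projective, is a precover sequence. -/
noncomputable def PrecoverSequence.ofSES {M : ModuleCat.{u} (FactorRing ω)} (X : Mon ω)
    (hX : Module.Projective S X.obj.left) (π : X.obj.right →ₗ[S] (resS ω).obj M)
    (h : IsSES X.arr π) : PrecoverSequence ω M where
  obj := X
  projective := hX
  π := ModuleCat.ofHom (Y := (resS ω).obj M) π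
  zero := by ext x; exact h.comp_eq_zero x
  exact := h.shortExact
  precover G hG g := by
    have := X.property.left.finite
    obtain ⟨l, hl⟩ := h.lift_of_projective (hG.ext_eq_zero 1 le_rfl) g.hom
    exact ⟨ModuleCat.ofHom l, by ext x; exact LinearMap.congr_fun hl x⟩

/-- The epimorphism `G ⟶ M` of a precover sequence, as a linear map. -/
noncomputable def PrecoverSequence.proj {M : ModuleCat.{u} (FactorRing ω)}
    (c : PrecoverSequence ω M) :
    c.obj.obj.right →ₗ[S] (resS ω).obj M := c.π.hom

lemma PrecoverSequence.isSES {M : ModuleCat.{u} (FactorRing ω)} (c : PrecoverSequence ω M) :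
    IsSES c.obj.arr c.proj :=
  IsSES.of_shortExact c.exact

variable [IsNoetherianRing S]

/-- Embed `M` in `Rⁿ` with Gorenstein projective cokernel `N`. Then the syzygy `G` of `N` over `S`
contains `ω Sⁿ`, and `G/ω Sⁿ ≅ M`. -/
theorem nonempty_precoverSequence (hreg : ω ∈ nonZeroDivisors S) (M : GProj (FactorRing ω)) :
    Nonempty (PrecoverSequence ω M.obj) := by
  obtain ⟨n, N, _, _, i, π, hs, hN⟩ := GP.exists_cosyzygy (X := M.obj) M.property
  let _ : Module S N := Module.compHom N (algebraMap S (FactorRing ω))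
  have : IsScalarTower S (FactorRing ω) N := IsScalarTower.of_algebraMap_smul fun _ _ => rfl
  let _ : Module S M.obj := Module.compHom M.obj (Ideal.Quotient.mk (Ideal.span {ω}))
  have : IsScalarTower S (FactorRing ω) M.obj := IsScalarTower.of_algebraMap_smul fun _ _ => rfl
  let p : (Fin n → S) →ₗ[S] N := π.restrictScalars S ∘ₗ red ω n
  have hG : GP S (LinearMap.ker p) := gp_syzygy hreg hN p (hs.surj.comp (red_surjective n))
  let f : (Fin n → S) →ₗ[S] LinearMap.ker p :=
    LinearMap.codRestrict _ (LinearMap.lsmul S (Fin n → S) ω) fun x => by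
      change π (red ω n (ω • x)) = 0
      rw [red_smul, map_zero]
  let e := LinearEquiv.ofInjective (i.restrictScalars S) hs.inj
  have hmem : ∀ x : LinearMap.ker p, red ω n x.1 ∈ LinearMap.range (i.restrictScalars S) :=
    fun x => (hs.exact _).1 x.2
  let q : LinearMap.ker p →ₗ[S] M.obj := e.symm.toLinearMap ∘ₗ
    LinearMap.codRestrict _ (red ω n ∘ₗ (LinearMap.ker p).subtype) hmem
  have hq : ∀ x, i (q x) = red ω n x.1 := fun x =>
    congr_arg Subtype.val (e.apply_symm_apply ⟨_, hmem x⟩)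
  let X : Mon ω := Mon.of f GP.of_projective hG
    (fun x y hxy => smul_fin_injective hreg (congr_arg Subtype.val hxy))
    (fun y => ⟨y.1, rfl⟩)
  refine ⟨PrecoverSequence.ofSES X (inferInstanceAs (Module.Projective S (Fin n → S))) q
    ⟨X.arr_injective, fun m => ?_, fun x => ?_⟩⟩
  · obtain ⟨x, hx⟩ := red_surjective (ω := ω) n (i m)
    refine ⟨⟨x, ?_⟩, hs.inj ((hq _).trans hx)⟩
    change π (red ω n x) = 0
    exact (congr_arg π hx).trans (hs.comp_eq_zero m)
  · constructor
    · intro hx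
      obtain ⟨y, hy⟩ := exists_of_red_eq_zero (ω := ω) (x := x.1)
        ((hq x).symm.trans ((congr_arg i hx).trans (map_zero i)))
      exact ⟨y, Subtype.ext hy.symm⟩
    · rintro ⟨y, rfl⟩
      refine hs.inj ((hq _).trans ((red_smul n y).trans (map_zero i).symm))

end Precover

end GorensteinMono

namespace GorensteinMono

open FrobeniusExact

variable {S : Type u} [CommRing S] {ω : S}

/-! ### Lifting morphisms to precover sequences -/

section Lift

variable {M M' M'' : ModuleCat.{u} (FactorRing ω)} {c : PrecoverSequence ω M}
  {c' : PrecoverSequence ω M'} {c'' : PrecoverSequence ω M''}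

lemma isLiftOf_iff {f : M ⟶ M'} {φ : c.obj ⟶ c'.obj} :
    IsLiftOf c c' f φ ↔
      ∀ y, c'.proj (Mon.rgt φ y) = ((resS ω).map f).hom (c.proj y) := by
  constructor
  · intro h y
    exact congr_arg (fun k : c.obj.obj.right ⟶ (resS ω).obj M' => k.hom y) h
  · intro h
    ext y
    exact h y

lemma IsLiftOf.comp {f : M ⟶ M'} {g : M' ⟶ M''} {φ : c.obj ⟶ c'.obj} {ψ : c'.obj ⟶ c''.obj}
    (h : IsLiftOf c c' f φ) (h' : IsLiftOf c' c'' g ψ) :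
    IsLiftOf c c'' (f ≫ g) (φ ≫ ψ) := by
  rw [isLiftOf_iff] at h h' ⊢
  intro y
  rw [Mon.rgt_comp, h', h]
  rfl

lemma IsLiftOf.id (c : PrecoverSequence ω M) : IsLiftOf c c (𝟙 M) (𝟙 c.obj) :=
  isLiftOf_iff.2 fun _ => rfl

lemma IsLiftOf.sub {f g : M ⟶ M'} {φ ψ : c.obj ⟶ c'.obj}
    (h : IsLiftOf c c' f φ) (h' : IsLiftOf c c' g ψ) : IsLiftOf c c' (f - g) (φ - ψ) := by
  rw [isLiftOf_iff] at h h' ⊢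
  intro y
  rw [Mon.rgt_sub, map_sub, h, h']
  rfl

/-- A lift determines the morphism which it lifts. -/
lemma IsLiftOf.unique {f g : M ⟶ M'} {φ : c.obj ⟶ c'.obj}
    (h : IsLiftOf c c' f φ) (h' : IsLiftOf c c' g φ) : f = g := by
  rw [isLiftOf_iff] at h h'
  ext x
  obtain ⟨y, rfl⟩ := c.isSES.surj x
  exact (h y).symm.trans (h' y)

lemma IsSES.exists_factor {A W X Y Z : Type*} [CommRing A] [AddCommGroup W] [AddCommGroup X]
    [AddCommGroup Y] [AddCommGroup Z] [Module A W] [Module A X] [Module A Y] [Module A Z]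
    {f : X →ₗ[A] Y} {g : Y →ₗ[A] Z} (h : IsSES f g) (k : W →ₗ[A] Y) (hk : ∀ w, g (k w) = 0) :
    ∃ l : W →ₗ[A] X, ∀ w, f (l w) = k w := by
  let e := LinearEquiv.ofInjective f h.inj
  have hmem : ∀ w, k w ∈ LinearMap.range f := fun w => (h.exact _).1 (hk w)
  exact ⟨e.symm.toLinearMap ∘ₗ LinearMap.codRestrict _ k hmem, fun w =>
    congr_arg Subtype.val (e.apply_symm_apply ⟨_, hmem w⟩)⟩

variable (c c') in
lemma exists_isLiftOf (f : M ⟶ M') : ∃ φ : c.obj ⟶ c'.obj, IsLiftOf c c' f φ := by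
  obtain ⟨r, hr⟩ := c'.precover _ c.obj.property.right (c.π ≫ (resS ω).map f)
  have hr' : ∀ y, c'.proj (r.hom y) = ((resS ω).map f).hom (c.proj y) := fun y =>
    congr_arg (fun k : c.obj.obj.right ⟶ (resS ω).obj M' => k.hom y) hr
  obtain ⟨l, hl⟩ := c'.isSES.exists_factor (r.hom ∘ₗ c.obj.arr) fun x => by
    rw [LinearMap.comp_apply, hr', c.isSES.comp_eq_zero, map_zero]
  exact ⟨Mon.homMk l r.hom hl, isLiftOf_iff.2 hr'⟩

/-- Every morphism between the objects of two precover sequences is a lift, of the morphism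
which it induces on cokernels. -/
lemma exists_isLiftOf_of_hom (φ : c.obj ⟶ c'.obj) : ∃ f : M ⟶ M', IsLiftOf c c' f φ := by
  obtain ⟨l, hl⟩ := exists_comp_eq_of_ker_le c.isSES.surj (c'.proj ∘ₗ Mon.rgt φ) fun y hy => by
    obtain ⟨x, rfl⟩ := (c.isSES.exact y).1 hy
    rw [LinearMap.comp_apply, ← Mon.arr_lft, c'.isSES.comp_eq_zero]
  refine ⟨ModuleCat.ofHom
    { toFun := l
      map_add' := fun x y => l.map_add x y
      map_smul' := fun r x => ?_ }, isLiftOf_iff.2 fun y => (hl y).symm⟩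
  obtain ⟨s, rfl⟩ := Ideal.Quotient.mk_surjective r
  exact l.map_smul s x

end Lift

section StableLift

/-- A lift of the zero morphism maps `G` to `P' ⊆ G'`, and so factors through `1 : P' ⟶ P'`. -/
lemma IsLiftOf.mem_projIdeal_of_zero (hreg : ω ∈ nonZeroDivisors S)
    {M M' : ModuleCat.{u} (FactorRing ω)}
    {c : PrecoverSequence ω M} {c' : PrecoverSequence ω M'} {φ : c.obj ⟶ c'.obj}
    (h : IsLiftOf c c' 0 φ) : φ ∈ projIdeal (monConflations ω) c.obj c'.obj := by
  rw [isLiftOf_iff] at h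
  obtain ⟨u, hu⟩ := c'.isSES.exists_factor (Mon.rgt φ) h
  have := c'.obj.property.left.finite
  have := c'.projective
  obtain ⟨α, -, hα⟩ := Mon.exists_hom_triv (hreg := hreg) (P := c'.obj.obj.left)
    (Q := PUnit.{u + 1}) c.obj u 0
  obtain ⟨β, -, hβ⟩ := Mon.exists_triv_hom (hreg := hreg) (P := c'.obj.obj.left)
    (Q := PUnit.{u + 1}) c'.obj LinearMap.id 0
  refine AddSubgroup.subset_closure ⟨_, α, β, Mon.triv_isProjective, Mon.hom_ext fun y => ?_⟩
  rw [Mon.rgt_comp, ← hu y, ← (hα y).1]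
  exact (hβ _ _).trans (add_zero _)

/-- The object `(1 × ω) : Sᵃ × Sᵇ ⟶ Sᵃ × Sᵇ` as a precover sequence of `Rᵇ`. -/
noncomputable def trivPrecover (hreg : ω ∈ nonZeroDivisors S) (a b : ℕ) :
    PrecoverSequence ω (ModuleCat.of (FactorRing ω) (Fin b → FactorRing ω)) :=
  PrecoverSequence.ofSES (Mon.triv ω hreg (Fin a → S) (Fin b → S))
    (inferInstanceAs (Module.Projective S ((Fin a → S) × (Fin b → S))))
    { toFun := fun x => red ω b x.2
      map_add' := fun x y => map_add (red ω b) x.2 y.2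
      map_smul' := fun s x => map_smul (red ω b) s x.2 }
    { inj := Mon.arr_injective _
      surj := fun y => by
        obtain ⟨x, hx⟩ := red_surjective b y
        exact ⟨(0, x), hx⟩
      exact := fun x => by
        constructor
        · intro hx
          obtain ⟨y, hy⟩ := exists_of_red_eq_zero hx
          exact ⟨(x.1, y), Prod.ext rfl hy.symm⟩
        · rintro ⟨y, rfl⟩
          exact red_smul b y.2 }

variable [IsNoetherianRing S] {M M' : GProj (FactorRing ω)} {c : PrecoverSequence ω M.obj}
  {c' : PrecoverSequence ω M'.obj}

lemma IsLiftOf.mem_projIdeal (hreg : ω ∈ nonZeroDivisors S)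
    {f : M ⟶ M'} {φ : c.obj ⟶ c'.obj} (h : IsLiftOf c c' f.hom φ)
    (hf : f ∈ projIdeal (gprojConflations (FactorRing ω)) M M') :
    φ ∈ projIdeal (monConflations ω) c.obj c'.obj := by
  obtain ⟨X, a, b, hX, rfl⟩ := (isFrobenius_gproj (FactorRing ω)).factors_of_mem hf
  obtain ⟨n, i, r, hir⟩ := exists_retract_of_isProjective hX
  obtain ⟨α, hα⟩ := exists_isLiftOf c (trivPrecover hreg 0 n) (a ≫ i).hom
  obtain ⟨β, hβ⟩ := exists_isLiftOf (trivPrecover hreg 0 n) c' (r ≫ b).hom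
  have hαβ : α ≫ β ∈ projIdeal (monConflations ω) c.obj c'.obj :=
    AddSubgroup.subset_closure ⟨_, α, β, Mon.triv_isProjective (hreg := hreg), rfl⟩
  have hz : IsLiftOf c c' 0 (φ - α ≫ β) := by
    have := h.sub (hα.comp hβ)
    have heq : (a ≫ b).hom - (a ≫ i).hom ≫ (r ≫ b).hom = 0 := by
      have : (a ≫ i) ≫ r ≫ b = a ≫ b := by rw [Category.assoc, reassoc_of% hir]
      rw [sub_eq_zero, ← this]
      rfl
    rwa [heq] at this
  simpa using add_mem (hz.mem_projIdeal_of_zero hreg) hαβ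

lemma IsLiftOf.map_eq (hreg : ω ∈ nonZeroDivisors S)
    {f g : M ⟶ M'} {φ ψ : c.obj ⟶ c'.obj} (h : IsLiftOf c c' f.hom φ)
    (h' : IsLiftOf c c' g.hom ψ) (hfg : (toStable (gprojConflations (FactorRing ω))).map f =
      (toStable (gprojConflations (FactorRing ω))).map g) :
    (toStable (monConflations ω)).map φ = (toStable (monConflations ω)).map ψ := by
  rw [toStable_map_eq_iff] at hfg ⊢
  exact IsLiftOf.mem_projIdeal hreg (f := f - g) (h.sub h') hfg

/-- A morphism with a stably trivial lift is stably trivial: pass to cokernels in a factorization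
of the lift through `(1 × ω) : Sᵃ × Sᵇ ⟶ Sᵃ × Sᵇ`. -/
lemma IsLiftOf.mem_projIdeal_of_lift (hreg : ω ∈ nonZeroDivisors S)
    {f : M ⟶ M'} {φ : c.obj ⟶ c'.obj}
    (h : IsLiftOf c c' f.hom φ) (hφ : φ ∈ projIdeal (monConflations ω) c.obj c'.obj) :
    f ∈ projIdeal (gprojConflations (FactorRing ω)) M M' := by
  obtain ⟨X, α, β, hX, rfl⟩ := (isFrobenius_mon hreg).factors_of_mem hφ
  obtain ⟨a, b, p, K, i, w, hp⟩ := Mon.exists_triv_deflation hreg X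
  obtain ⟨s, hs⟩ := hX p ⟨_, _, _, hp⟩ (𝟙 X)
  obtain ⟨f₁, hf₁⟩ := exists_isLiftOf_of_hom (c := c) (c' := trivPrecover hreg a b) (α ≫ s)
  obtain ⟨f₂, hf₂⟩ := exists_isLiftOf_of_hom (c := trivPrecover hreg a b) (c' := c') (p ≫ β)
  have heq : f.hom = f₁ ≫ f₂ := by
    have hαβ : α ≫ β = (α ≫ s) ≫ p ≫ β := by rw [Category.assoc, reassoc_of% hs]
    rw [hαβ] at h
    exact h.unique (hf₁.comp hf₂)
  let F : GProj (FactorRing ω) := gprojOf (Fin b → FactorRing ω) GP.of_projective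
  have : Module.Projective (FactorRing ω) F.obj :=
    inferInstanceAs (Module.Projective (FactorRing ω) (Fin b → FactorRing ω))
  refine AddSubgroup.subset_closure ⟨F, ObjectProperty.homMk f₁, ObjectProperty.homMk f₂,
    isProjective_of_module_projective F, ?_⟩
  ext1
  exact heq.symm

lemma PrecoverSequence.isProjective_obj (hreg : ω ∈ nonZeroDivisors S)
    (c : PrecoverSequence ω M.obj)
    (hM : FrobeniusExact.IsProjective (gprojConflations (FactorRing ω)) M) :
    FrobeniusExact.IsProjective (monConflations ω) c.obj :=
  (isFrobenius_mon hreg).isProjective_of_id_mem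
    (IsLiftOf.mem_projIdeal (M := M) (M' := M) hreg (f := 𝟙 M) (IsLiftOf.id c)
      (AddSubgroup.subset_closure ⟨M, 𝟙 M, 𝟙 M, hM, Category.comp_id _⟩))

end StableLift

/-! ### Lifting conflations -/

lemma projective_ker {A X Y : Type*} [CommRing A] [AddCommGroup X] [AddCommGroup Y] [Module A X]
    [Module A Y] [Module.Projective A X] [Module.Projective A Y] {f : X →ₗ[A] Y}
    (hf : Function.Surjective f) : Module.Projective A (LinearMap.ker f) := by
  obtain ⟨s, hs⟩ := Module.projective_lifting_property f LinearMap.id hf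
  have hs' : ∀ y, f (s y) = y := LinearMap.congr_fun hs
  refine Module.Projective.of_split (LinearMap.ker f).subtype
    (LinearMap.codRestrict _ (LinearMap.id - s ∘ₗ f) fun x => by simp [hs']) ?_
  ext ⟨x, hx⟩
  replace hx : f x = 0 := hx
  simp [hx]

/-- Every conflation of Gorenstein projective `R`-modules lifts to a conflation of precover
sequences. A lift `X ⟶ X''` of the epimorphism becomes surjective on sources after adding the
trivial object `1 : P'' ⟶ P''` to `X`, hence also on targets, and its kernel is a precover sequence
of the first module by the snake lemma. -/
theorem exists_conflation_lift [IsNoetherianRing S] {T : ShortComplex (GProj (FactorRing ω))}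
    (hT : gprojConflations (FactorRing ω) T) (c : PrecoverSequence ω T.X₂.obj)
    (c'' : PrecoverSequence ω T.X₃.obj) :
    ∃ (b₁ : PrecoverSequence ω T.X₁.obj) (b₂ : PrecoverSequence ω T.X₂.obj)
      (f : b₁.obj ⟶ b₂.obj) (g : b₂.obj ⟶ c''.obj) (w : f ≫ g = 0),
      monConflations ω (ShortComplex.mk f g w) ∧ IsLiftOf b₁ b₂ T.f.hom f ∧
        IsLiftOf b₂ c'' T.g.hom g := by
  obtain ⟨φ, hφ⟩ := exists_isLiftOf c c'' T.g.hom
  rw [isLiftOf_iff] at hφ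
  have hT' : IsSES ((resS ω).map T.f.hom).hom ((resS ω).map T.g.hom).hom :=
    ⟨(isSES_of_gprojConflations hT).inj, (isSES_of_gprojConflations hT).surj,
      (isSES_of_gprojConflations hT).exact⟩
  have := c.obj.property.left.finite
  have := c.projective
  have := c''.obj.property.left.finite
  have := c''.projective
  let X : Mon ω := Mon.of (LinearMap.prodMap c.obj.arr (LinearMap.id (M := c''.obj.obj.left)))
    (GP.prod c.obj.property.left c''.obj.property.left)
    (GP.prod c.obj.property.right c''.obj.property.left)
    (Function.Injective.prodMap c.obj.arr_injective Function.injective_id)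
    (fun y => by
      obtain ⟨x, hx⟩ := c.obj.exists_arr_eq y.1
      exact ⟨(x, ω • y.2), Prod.ext hx rfl⟩)
  let b₂ : PrecoverSequence ω T.X₂.obj := PrecoverSequence.ofSES X
    (inferInstanceAs (Module.Projective S (c.obj.obj.left × c''.obj.obj.left)))
    (c.proj ∘ₗ LinearMap.fst S c.obj.obj.right c''.obj.obj.left)
    { inj := X.arr_injective
      surj := c.isSES.surj.comp LinearMap.fst_surjective
      exact := fun y => by
        constructor
        · intro hy
          obtain ⟨x, hx⟩ := (c.isSES.exact y.1).1 hy
          exact ⟨(x, y.2), Prod.ext hx rfl⟩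
        · rintro ⟨x, rfl⟩
          exact c.isSES.comp_eq_zero x.1 }
  let g : b₂.obj ⟶ c''.obj := Mon.homMk (X := X) ((Mon.lft φ).coprod LinearMap.id)
    ((Mon.rgt φ).coprod c''.obj.arr) fun x => by
      change c''.obj.arr (Mon.lft φ x.1 + x.2) = Mon.rgt φ (c.obj.arr x.1) + c''.obj.arr x.2
      rw [map_add, Mon.arr_lft]
  have hg : ∀ (y : c.obj.obj.right) (z : c''.obj.obj.left),
    Mon.rgt g (y, z) = Mon.rgt φ y + c''.obj.arr z := fun _ _ => rfl
  have hgl : IsLiftOf b₂ c'' T.g.hom g := isLiftOf_iff.2 fun y => by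
    change c''.proj (Mon.rgt φ y.1 + c''.obj.arr y.2) = _
    rw [map_add, c''.isSES.comp_eq_zero, add_zero]
    exact hφ y.1
  have hl : Function.Surjective (Mon.lft g) := fun z => ⟨((0 : c.obj.obj.left), z), by
    change Mon.lft φ 0 + z = z
    rw [map_zero, zero_add]⟩
  have hr : Function.Surjective (Mon.rgt g) := fun w => by
    obtain ⟨m, hm⟩ := hT'.surj (c''.proj w)
    obtain ⟨y, rfl⟩ := c.isSES.surj m
    obtain ⟨z, hz⟩ := (c''.isSES.exact (w - Mon.rgt φ y)).1 (by
      rw [map_sub, hφ, hm, sub_self])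
    refine ⟨(y, z), ?_⟩
    rw [hg, hz]
    abel
  let K : Mon ω := Mon.ker g hl hr
  rw [isLiftOf_iff] at hgl
  obtain ⟨q, hq⟩ := hT'.exists_factor (b₂.proj ∘ₗ (LinearMap.ker (Mon.rgt g)).subtype)
    fun y => by
      have : Mon.rgt g y.1 = 0 := y.2
      exact (hgl y.1).symm.trans (by rw [this, map_zero])
  have hq' : ∀ y : LinearMap.ker (Mon.rgt g), ((resS ω).map T.f.hom).hom (q y) = b₂.proj y.1 := hq
  have hKP : Module.Projective S K.obj.left := by
    have : Module.Projective S b₂.obj.obj.left := b₂.projective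
    exact projective_ker hl
  let b₁ : PrecoverSequence ω T.X₁.obj := PrecoverSequence.ofSES K hKP q
    { inj := K.arr_injective
      surj := fun m => by
        obtain ⟨y, hy⟩ := b₂.isSES.surj (((resS ω).map T.f.hom).hom m)
        have hy' : c''.proj (Mon.rgt g y) = 0 := by rw [hgl, hy, hT'.comp_eq_zero]
        obtain ⟨z, hz⟩ := (c''.isSES.exact _).1 hy'
        obtain ⟨x, rfl⟩ := hl z
        have hmem : Mon.rgt g (y - b₂.obj.arr x) = 0 := by
          rw [map_sub, ← hz, Mon.arr_lft, sub_self]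
        refine ⟨⟨y - b₂.obj.arr x, hmem⟩, hT'.inj ((hq' _).trans ?_)⟩
        change b₂.proj (y - b₂.obj.arr x) = _
        rw [map_sub, b₂.isSES.comp_eq_zero, sub_zero, hy]
      exact := fun y => by
        constructor
        · intro hy
          have h0 : b₂.proj y.1 = 0 := by
            rw [← hq', hy, map_zero]
          obtain ⟨x, hx⟩ := (b₂.isSES.exact _).1 h0
          have hy2 : Mon.rgt g y.1 = 0 := y.2
          have hx0 : Mon.lft g x = 0 := c''.obj.arr_injective (by
            rw [Mon.arr_lft, hx, map_zero, hy2])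
          exact ⟨⟨x, hx0⟩, Subtype.ext hx⟩
        · rintro ⟨x, rfl⟩
          refine hT'.inj ((hq' _).trans ?_)
          rw [map_zero]
          exact b₂.isSES.comp_eq_zero x.1 }
  obtain ⟨w, hw⟩ := Mon.kerι_conflation g hl hr
  exact ⟨b₁, b₂, Mon.kerι g hl hr, g, w, hw, isLiftOf_iff.2 fun y => (hq' y).symm,
    isLiftOf_iff.2 hgl⟩

end GorensteinMono

namespace GorensteinMono

open FrobeniusExact

variable {S : Type u} [CommRing S] [IsNoetherianRing S] {ω : S}

/-! ### The functor to the stable monomorphism category -/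

/-- Two precover sequences of the same module are stably isomorphic, through the lifts of the
identity. -/
lemma IsLiftOf.stable_inverse (hreg : ω ∈ nonZeroDivisors S) {M : GProj (FactorRing ω)}
    {b b' : PrecoverSequence ω M.obj}
    {φ : b.obj ⟶ b'.obj} {ψ : b'.obj ⟶ b.obj} (hφ : IsLiftOf b b' (𝟙 M.obj) φ)
    (hψ : IsLiftOf b' b (𝟙 M.obj) ψ) :
    (toStable (monConflations ω)).map φ ≫ (toStable (monConflations ω)).map ψ = 𝟙 _ := by
  rw [← Functor.map_comp, ← CategoryTheory.Functor.map_id]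
  have h := hφ.comp hψ
  rw [Category.comp_id] at h
  exact IsLiftOf.map_eq hreg (f := 𝟙 M) (g := 𝟙 M) h (IsLiftOf.id b) rfl

/-- The stable isomorphism between two precover sequences of the same module. -/
lemma exists_iso_of_precover (hreg : ω ∈ nonZeroDivisors S) {M : GProj (FactorRing ω)}
    (b b' : PrecoverSequence ω M.obj) :
    ∃ e : (toStable (monConflations ω)).obj b.obj ≅ (toStable (monConflations ω)).obj b'.obj,
      (∀ φ : b.obj ⟶ b'.obj, IsLiftOf b b' (𝟙 M.obj) φ →
        e.hom = (toStable (monConflations ω)).map φ) ∧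
      ∀ φ : b'.obj ⟶ b.obj, IsLiftOf b' b (𝟙 M.obj) φ →
        e.inv = (toStable (monConflations ω)).map φ := by
  obtain ⟨φ, hφ⟩ := exists_isLiftOf b b' (𝟙 M.obj)
  obtain ⟨ψ, hψ⟩ := exists_isLiftOf b' b (𝟙 M.obj)
  exact ⟨⟨_, _, IsLiftOf.stable_inverse hreg hφ hψ, IsLiftOf.stable_inverse hreg hψ hφ⟩,
    fun φ' hφ' =>
    IsLiftOf.map_eq hreg (f := 𝟙 M) (g := 𝟙 M) hφ hφ' rfl, fun φ' hφ' =>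
    IsLiftOf.map_eq hreg (f := 𝟙 M) (g := 𝟙 M) hψ hφ' rfl⟩

section Functor

variable (hreg : ω ∈ nonZeroDivisors S) (c : ∀ M : GProj (FactorRing ω), PrecoverSequence ω M.obj)

/-- The functor which sends `M` to the object `P_M ⟶ G_M` of a chosen precover sequence, and the
class of a morphism to the class of any of its lifts. -/
noncomputable def precoverFunctor :
    Stable (gprojConflations (FactorRing ω)) ⥤ Stable (monConflations ω) :=
  CategoryTheory.Quotient.lift (stableRel (gprojConflations (FactorRing ω)))
    { obj := fun M => (toStable (monConflations ω)).obj (c M).obj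
      map := fun {M M'} f =>
        (toStable (monConflations ω)).map (exists_isLiftOf (c M) (c M') f.hom).choose
      map_id := fun M => by
        rw [← CategoryTheory.Functor.map_id]
        exact IsLiftOf.map_eq hreg (f := 𝟙 M) (g := 𝟙 M)
          (exists_isLiftOf (c M) (c M) (𝟙 M : M ⟶ M).hom).choose_spec (IsLiftOf.id _) rfl
      map_comp := fun {M M' M''} f g => by
        rw [← Functor.map_comp]
        exact IsLiftOf.map_eq hreg (f := f ≫ g) (g := f ≫ g)
          (exists_isLiftOf (c M) (c M'') (f ≫ g).hom).choose_spec
          ((exists_isLiftOf (c M) (c M') f.hom).choose_spec.comp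
            (exists_isLiftOf (c M') (c M'') g.hom).choose_spec) rfl }
    (fun M M' f g hfg => IsLiftOf.map_eq hreg
      (exists_isLiftOf (c M) (c M') f.hom).choose_spec
      (exists_isLiftOf (c M) (c M') g.hom).choose_spec (CategoryTheory.Quotient.sound _ hfg))

lemma precoverFunctor_map {M M' : GProj (FactorRing ω)} {f : M ⟶ M'}
    {φ : (c M).obj ⟶ (c M').obj} (h : IsLiftOf (c M) (c M') f.hom φ) :
    (precoverFunctor hreg c).map ((toStable _).map f) = (toStable _).map φ :=
  IsLiftOf.map_eq hreg (f := f) (g := f)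
    (exists_isLiftOf (c M) (c M') f.hom).choose_spec h rfl

instance precoverFunctor_additive : (precoverFunctor hreg c).Additive where
  map_add {M M' f g} := by
    obtain ⟨f, rfl⟩ := (toStable _).map_surjective f
    obtain ⟨g, rfl⟩ := (toStable _).map_surjective g
    obtain ⟨φ, hφ⟩ := exists_isLiftOf (c M.as) (c M'.as) f.hom
    obtain ⟨ψ, hψ⟩ := exists_isLiftOf (c M.as) (c M'.as) (-g).hom
    have h : IsLiftOf (c M.as) (c M'.as) (f - -g).hom (φ - ψ) := hφ.sub hψ
    have hg : (precoverFunctor hreg c).map ((toStable _).map g) = (toStable _).map (-ψ) := by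
      refine precoverFunctor_map hreg c ?_
      have h0 : IsLiftOf (c M.as) (c M'.as) (0 : M.as ⟶ M'.as).hom 0 :=
        isLiftOf_iff.2 fun _ => map_zero _
      have := h0.sub hψ
      rw [zero_sub] at this
      have heq : (0 : M.as ⟶ M'.as).hom - (-g).hom = g.hom := by
        change (0 : M.as.obj ⟶ M'.as.obj) - -g.hom = g.hom
        simp
      rwa [heq] at this
    have h' := precoverFunctor_map hreg c h
    rw [sub_neg_eq_add, sub_eq_add_neg] at h'
    rw [hg, precoverFunctor_map hreg c hφ]
    exact h'

lemma precoverFunctor_full : (precoverFunctor hreg c).Full where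
  map_surjective {M M'} φ := by
    obtain ⟨φ, rfl⟩ := (toStable (monConflations ω)).map_surjective φ
    obtain ⟨f, hf⟩ := exists_isLiftOf_of_hom (c := c M.as) (c' := c M'.as) φ
    exact ⟨(toStable _).map (ObjectProperty.homMk f : M.as ⟶ M'.as), precoverFunctor_map hreg c hf⟩

lemma precoverFunctor_faithful : (precoverFunctor hreg c).Faithful where
  map_injective {M M' f g} hfg := by
    obtain ⟨f, rfl⟩ := (toStable _).map_surjective f
    obtain ⟨g, rfl⟩ := (toStable _).map_surjective g
    obtain ⟨φ, hφ⟩ := exists_isLiftOf (c M.as) (c M'.as) f.hom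
    obtain ⟨ψ, hψ⟩ := exists_isLiftOf (c M.as) (c M'.as) g.hom
    have h : (toStable (monConflations ω)).map φ = (toStable (monConflations ω)).map ψ :=
      (precoverFunctor_map hreg c hφ).symm.trans (hfg.trans (precoverFunctor_map hreg c hψ))
    rw [toStable_map_eq_iff] at h ⊢
    exact IsLiftOf.mem_projIdeal_of_lift hreg (f := f - g) (hφ.sub hψ) h

/-- The stable isomorphism from the chosen precover sequence of `M` to another one. -/
noncomputable def precoverIso {M : GProj (FactorRing ω)} (b : PrecoverSequence ω M.obj) :
    (precoverFunctor hreg c).obj ((toStable _).obj M) ≅ (toStable (monConflations ω)).obj b.obj :=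
  (exists_iso_of_precover hreg (c M) b).choose

lemma precoverIso_inv {M : GProj (FactorRing ω)} {b : PrecoverSequence ω M.obj}
    {φ : b.obj ⟶ (c M).obj} (hφ : IsLiftOf b (c M) (𝟙 M.obj) φ) :
    (precoverIso hreg c b).inv = (toStable (monConflations ω)).map φ :=
  (exists_iso_of_precover hreg (c M) b).choose_spec.2 φ hφ

lemma precoverIso_naturality {M M' : GProj (FactorRing ω)} {b : PrecoverSequence ω M.obj}
    {b' : PrecoverSequence ω M'.obj} {f : M ⟶ M'} {φ : b.obj ⟶ b'.obj}
    (h : IsLiftOf b b' f.hom φ) :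
    (precoverFunctor hreg c).map ((toStable _).map f) ≫ (precoverIso hreg c b').hom =
      (precoverIso hreg c b).hom ≫ (toStable _).map φ := by
  obtain ⟨v, hv⟩ := exists_isLiftOf b (c M) (𝟙 M.obj)
  obtain ⟨v', hv'⟩ := exists_isLiftOf b' (c M') (𝟙 M'.obj)
  obtain ⟨ψ, hψ⟩ := exists_isLiftOf (c M) (c M') f.hom
  rw [← Iso.inv_comp_eq, ← Category.assoc, ← Iso.eq_comp_inv, precoverIso_inv hreg c hv,
    precoverIso_inv hreg c hv', precoverFunctor_map hreg c hψ]
  refine ((toStable _).map_comp _ _).symm.trans (Eq.trans ?_ ((toStable _).map_comp _ _))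
  have h₁ := hv.comp hψ
  have h₂ := h.comp hv'
  rw [Category.id_comp] at h₁
  rw [Category.comp_id] at h₂
  exact IsLiftOf.map_eq hreg h₁ h₂ rfl

/-- The image of a conflation is isomorphic to the image of a conflation which lifts it. -/
theorem exists_conflation_iso {T : ShortComplex (GProj (FactorRing ω))}
    (hT : gprojConflations (FactorRing ω) T) :
    ∃ B : ShortComplex (Mon ω), monConflations ω B ∧
      ∃ (x₁ : (precoverFunctor hreg c).obj ((toStable _).obj T.X₁) ≅ (toStable _).obj B.X₁)
        (x₂ : (precoverFunctor hreg c).obj ((toStable _).obj T.X₂) ≅ (toStable _).obj B.X₂)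
        (x₃ : (precoverFunctor hreg c).obj ((toStable _).obj T.X₃) ≅ (toStable _).obj B.X₃),
        (precoverFunctor hreg c).map ((toStable _).map T.f) ≫ x₂.hom =
          x₁.hom ≫ (toStable _).map B.f ∧
        (precoverFunctor hreg c).map ((toStable _).map T.g) ≫ x₃.hom =
          x₂.hom ≫ (toStable _).map B.g := by
  obtain ⟨b₁, b₂, f, g, w, hB, hf, hg⟩ := exists_conflation_lift hT (c T.X₂) (c T.X₃)
  exact ⟨_, hB, precoverIso hreg c b₁, precoverIso hreg c b₂, precoverIso hreg c (c T.X₃),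
    precoverIso_naturality hreg c hf, precoverIso_naturality hreg c hg⟩

/-! ### Compatibility with suspensions and triangles -/

variable (D : InjectiveEmbeddings (gprojConflations (FactorRing ω)))
  (D' : InjectiveEmbeddings (monConflations ω))

/-- The comparison `T Σ M ⟶ Σ T M`. It is computed from a conflation of precover sequences lifting
`M ⟶ I M ⟶ ΣM` and its connecting morphism; `suspComparison_unique` shows that any
such lift, and more generally any morphism of conflations into `M ⟶ I M ⟶ ΣM`, computes it. -/
lemma exists_suspComparison (hreg : ω ∈ nonZeroDivisors S) (M : GProj (FactorRing ω)) :
    ∃ ξ : (toStable (monConflations ω)).obj (c (D.susp M)).obj ≅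
        (toStable (monConflations ω)).obj (D'.susp (c M).obj),
      ∀ {T : ShortComplex (GProj (FactorRing ω))} (_ : gprojConflations (FactorRing ω) T)
        {b₁ : PrecoverSequence ω T.X₁.obj} {b₂ : PrecoverSequence ω T.X₂.obj}
        {b₃ : PrecoverSequence ω T.X₃.obj} {f : b₁.obj ⟶ b₂.obj} {g : b₂.obj ⟶ b₃.obj}
        {w : f ≫ g = 0} (_ : monConflations ω (ShortComplex.mk f g w))
        (_ : IsLiftOf b₁ b₂ T.f.hom f) (_ : IsLiftOf b₂ b₃ T.g.hom g)
        (φ : T ⟶ D.complex M) (ψ : ShortComplex.mk f g w ⟶ D'.complex (c M).obj)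
        (_ : IsLiftOf b₁ (c M) φ.τ₁.hom ψ.τ₁) (d : b₃.obj ⟶ (c (D.susp M)).obj)
        (_ : IsLiftOf b₃ (c (D.susp M)) φ.τ₃.hom d),
        (toStable _).map d ≫ ξ.hom = (toStable _).map ψ.τ₃ := by
  have hM := isFrobenius_mon (S := S) hreg
  have hG := isFrobenius_gproj (FactorRing ω)
  obtain ⟨e₁, e₂, p, q, wpq, hpq, hp, hq⟩ :=
    exists_conflation_lift (D.conflation M) (c (D.I M)) (c (D.susp M))
  have he₂ : FrobeniusExact.IsInjective (monConflations ω) e₂.obj :=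
    (hM.projective_iff_injective _).1 (PrecoverSequence.isProjective_obj hreg
      (M := D.I M) e₂ ((hG.projective_iff_injective _).2 (D.injective M)))
  obtain ⟨r, hr⟩ := exists_isLiftOf e₁ (c M) (𝟙 M.obj)
  obtain ⟨r', hr'⟩ := exists_isLiftOf (c M) e₁ (𝟙 M.obj)
  let B : ShortComplex (Mon ω) := ShortComplex.mk p q wpq
  obtain ⟨ρ, hρ⟩ := hM.exact.exists_hom (T := B) (T' := D'.complex (c M).obj) hpq
    (D'.injective _) r
  obtain ⟨ρ', hρ'⟩ := hM.exact.exists_hom (T := D'.complex (c M).obj) (T' := B)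
    (D'.conflation _) he₂ r'
  let ξ : (toStable (monConflations ω)).obj (c (D.susp M)).obj ≅
        (toStable (monConflations ω)).obj (D'.susp (c M).obj) :=
    { hom := (toStable _).map ρ.τ₃
      inv := (toStable _).map ρ'.τ₃
      hom_inv_id := by
        have := hM.third_unique (T := B) (T' := B) hpq he₂ (ρ ≫ ρ') (𝟙 _) (by
          rw [ShortComplex.comp_τ₁, hρ, hρ', Functor.map_comp,
            IsLiftOf.stable_inverse hreg hr hr']
          exact ((toStable _).map_id _).symm)
        rw [ShortComplex.comp_τ₃, Functor.map_comp] at this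
        exact this.trans ((toStable _).map_id _)
      inv_hom_id := by
        have := hM.third_unique (T := D'.complex (c M).obj) (T' := D'.complex (c M).obj)
          (D'.conflation _) (D'.injective _) (ρ' ≫ ρ) (𝟙 _) (by
          rw [ShortComplex.comp_τ₁, hρ, hρ', Functor.map_comp,
            IsLiftOf.stable_inverse hreg hr' hr]
          exact ((toStable _).map_id _).symm)
        rw [ShortComplex.comp_τ₃, Functor.map_comp] at this
        exact this.trans ((toStable _).map_id _) }
  refine ⟨ξ, ?_⟩
  intro T hT b₁ b₂ b₃ f g w hB hf hg φ ψ hψ d hd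
  -- lift the morphism on first terms to a morphism `β` between the two lifted conflations
  obtain ⟨β₁, hβ₁⟩ := exists_isLiftOf b₁ e₁ φ.τ₁.hom
  obtain ⟨β, hβ⟩ := hM.exact.exists_hom (T := ShortComplex.mk f g w) (T' := B) hB he₂ β₁
  obtain ⟨j, hj⟩ := exists_isLiftOf_of_hom (c := b₂) (c' := e₂) β.τ₂
  obtain ⟨s, hs⟩ := exists_isLiftOf_of_hom (c := b₃) (c' := c (D.susp M)) β.τ₃
  have hβ₁₂ : β₁ ≫ p = f ≫ β.τ₂ := hβ ▸ β.comm₁₂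
  have hβ₂₃ : β.τ₂ ≫ q = g ≫ β.τ₃ := β.comm₂₃
  -- the morphism induced by `β` on cokernels agrees stably with `φ` on third terms
  let φ' : T ⟶ D.complex M :=
    { τ₁ := φ.τ₁
      τ₂ := ObjectProperty.homMk j
      τ₃ := ObjectProperty.homMk s
      comm₁₂ := by
        ext1
        exact (hβ₁.comp hp).unique (hβ₁₂ ▸ hf.comp hj)
      comm₂₃ := by
        ext1
        exact (hj.comp hq).unique (hβ₂₃ ▸ hg.comp hs) }
  have h₁ := hG.third_unique hT (D.injective M) φ φ' rfl
  have h₂ : (toStable (monConflations ω)).map d = (toStable (monConflations ω)).map β.τ₃ :=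
    IsLiftOf.map_eq hreg (f := φ.τ₃) (g := φ'.τ₃) hd hs h₁
  have h₃ := hM.third_unique (T := ShortComplex.mk f g w) (T' := D'.complex (c M).obj) hB
    (D'.injective _) (β ≫ ρ) ψ (by
      rw [ShortComplex.comp_τ₁, hβ, hρ]
      have := hβ₁.comp hr
      exact IsLiftOf.map_eq hreg (f := φ.τ₁ ≫ 𝟙 _) (g := φ.τ₁) this hψ
        (by rw [Category.comp_id]))
  rw [h₂, ← h₃, ShortComplex.comp_τ₃, Functor.map_comp]

/-- The comparison isomorphism `T Σ M ≅ Σ T M`. -/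
noncomputable def suspComparison (M : GProj (FactorRing ω)) :
    (toStable (monConflations ω)).obj (c (D.susp M)).obj ≅
      (toStable (monConflations ω)).obj (D'.susp (c M).obj) :=
  (exists_suspComparison c D D' hreg M).choose

lemma suspComparison_unique {M : GProj (FactorRing ω)} {T : ShortComplex (GProj (FactorRing ω))}
    (hT : gprojConflations (FactorRing ω) T)
    {b₁ : PrecoverSequence ω T.X₁.obj} {b₂ : PrecoverSequence ω T.X₂.obj}
    {b₃ : PrecoverSequence ω T.X₃.obj} {f : b₁.obj ⟶ b₂.obj} {g : b₂.obj ⟶ b₃.obj}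
    {w : f ≫ g = 0} (hB : monConflations ω (ShortComplex.mk f g w))
    (hf : IsLiftOf b₁ b₂ T.f.hom f) (hg : IsLiftOf b₂ b₃ T.g.hom g)
    (φ : T ⟶ D.complex M) (ψ : ShortComplex.mk f g w ⟶ D'.complex (c M).obj)
    (hψ : IsLiftOf b₁ (c M) φ.τ₁.hom ψ.τ₁) {d : b₃.obj ⟶ (c (D.susp M)).obj}
    (hd : IsLiftOf b₃ (c (D.susp M)) φ.τ₃.hom d) :
    (toStable _).map d ≫ (suspComparison hreg c D D' M).hom = (toStable _).map ψ.τ₃ :=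
  (exists_suspComparison c D D' hreg M).choose_spec hT hB hf hg φ ψ hψ d hd

variable (hG : IsFrobenius (gprojConflations (FactorRing ω)))
  (hM : IsFrobenius (monConflations ω))

lemma suspComparison_naturality {M N : GProj (FactorRing ω)} (f : M ⟶ N) :
    (precoverFunctor hreg c).map ((D.suspension hG).map ((toStable _).map f)) ≫
        (suspComparison hreg c D D' N).hom =
      (suspComparison hreg c D D' M).hom ≫
        (D'.suspension hM).map ((precoverFunctor hreg c).map ((toStable _).map f)) := by
  obtain ⟨e₁, e₂, p, q, wpq, hpq, hp, hq⟩ :=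
    exists_conflation_lift (D.conflation M) (c (D.I M)) (c (D.susp M))
  obtain ⟨φ, hφ⟩ := hG.exact.exists_hom (T := D.complex M) (T' := D.complex N)
    (D.conflation M) (D.injective N) f
  obtain ⟨r, hr⟩ := exists_isLiftOf e₁ (c M) (𝟙 M.obj)
  obtain ⟨k, hk⟩ := exists_isLiftOf (c M) (c N) f.hom
  obtain ⟨d, hd⟩ := exists_isLiftOf (c (D.susp M)) (c (D.susp N)) φ.τ₃.hom
  obtain ⟨ρ, hρ⟩ := hM.exact.exists_hom (T := ShortComplex.mk p q wpq)
    (T' := D'.complex (c M).obj) hpq (D'.injective _) r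
  obtain ⟨θ, hθ⟩ := hM.exact.exists_hom (T := D'.complex (c M).obj)
    (T' := D'.complex (c N).obj) (D'.conflation _) (D'.injective _) k
  have h₁ := suspComparison_unique hreg c D D' (D.conflation M) hpq hp hq (𝟙 _) ρ
    (by rw [hρ]; exact hr) (d := 𝟙 _) (IsLiftOf.id _)
  have h₂ := suspComparison_unique hreg c D D' (D.conflation M) hpq hp hq φ (ρ ≫ θ)
    (by
      rw [ShortComplex.comp_τ₁, hρ, hθ, hφ]
      have := hr.comp hk
      rwa [Category.id_comp] at this) hd
  have h₃ : (D.suspension hG).map ((toStable _).map f) = (toStable _).map φ.τ₃ := by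
    rw [← D.suspension_map_of_hom hG φ, hφ]
  have h₄ : (D'.suspension hM).map ((toStable _).map k) = (toStable _).map θ.τ₃ := by
    rw [← D'.suspension_map_of_hom hM θ, hθ]
  rw [CategoryTheory.Functor.map_id, Category.id_comp] at h₁
  rw [ShortComplex.comp_τ₃, Functor.map_comp] at h₂
  rw [precoverFunctor_map hreg c hk, h₁]
  refine Eq.trans ?_ (h₂.trans (congr_arg _ h₄.symm))
  refine congr_arg (· ≫ (suspComparison hreg c D D' N).hom) ?_
  exact (congr_arg _ h₃).trans (precoverFunctor_map hreg c hd)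

/-- The comparison `T Σ ≅ Σ T` as a natural isomorphism. -/
noncomputable def suspNatIso :
    D.suspension hG ⋙ precoverFunctor hreg c ≅ precoverFunctor hreg c ⋙ D'.suspension hM :=
  NatIso.ofComponents (fun X => suspComparison hreg c D D' X.as) (fun {X Y} f => by
    obtain ⟨f, rfl⟩ := (toStable _).map_surjective f
    exact suspComparison_naturality hreg c D D' hG hM f)

/-- The functor preserves distinguished triangles: the triangle of a conflation of precover
sequences lifting a conflation `T` is, through the comparison `TΣ ≅ ΣT`, the image of the triangle
of `T`. -/
theorem precoverFunctor_isTriangleFunctor :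
    IsTriangleFunctor hG D hM D' (precoverFunctor hreg c) := by
  refine ⟨precoverFunctor_additive hreg c, suspNatIso hreg c D D' hG hM, ?_⟩
  intro X Y Z a b t ht
  obtain ⟨T, hT, φ, hφ, x, y, z, ha, hb, hc⟩ := ht.exists_conflation
  obtain ⟨b₁, b₂, f, g, w, hB, hf, hg⟩ := exists_conflation_lift hT (c T.X₂) (c T.X₃)
  obtain ⟨ψ, hψ⟩ := hM.exact.exists_hom (T := ShortComplex.mk f g w)
    (T' := D'.complex b₁.obj) hB (D'.injective _) (𝟙 _)
  obtain ⟨v, hv⟩ := exists_isLiftOf b₁ (c T.X₁) (𝟙 T.X₁.obj)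
  obtain ⟨θ, hθ⟩ := hM.exact.exists_hom (T := D'.complex b₁.obj)
    (T' := D'.complex (c T.X₁).obj) (D'.conflation _) (D'.injective _) v
  obtain ⟨d, hd⟩ := exists_isLiftOf (c T.X₃) (c (D.susp T.X₁)) φ.τ₃.hom
  have h₁ := suspComparison_unique hreg c D D' hT hB hf hg φ (ψ ≫ θ) (by
    rw [ShortComplex.comp_τ₁, hψ, hθ, hφ]
    exact (Category.id_comp v).symm ▸ hv) hd
  rw [ShortComplex.comp_τ₃, Functor.map_comp, ← D'.suspension_map_of_hom hM θ, hθ,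
    ← precoverIso_inv hreg c hv, ← precoverFunctor_map hreg c hd] at h₁
  have h₃ : (precoverIso hreg c (c T.X₃)).hom = 𝟙 _ :=
    hom_eq_id_of_inv (X := (precoverFunctor hreg c).obj ((toStable _).obj T.X₃)) _
      ((precoverIso_inv hreg c (IsLiftOf.id _)).trans ((toStable _).map_id _))
  have h₄ := precoverIso_naturality hreg c hf
  have h₅ := precoverIso_naturality hreg c hg
  rw [h₃] at h₅
  refine D'.isDistinguished_of_conflation hM hB ψ hψ _ _ _
    ((precoverFunctor hreg c).mapIso x ≪≫ precoverIso hreg c b₁)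
    ((precoverFunctor hreg c).mapIso y ≪≫ precoverIso hreg c b₂)
    ((precoverFunctor hreg c).mapIso z) ?_ ?_ ?_
  · have := congr_arg (precoverFunctor hreg c).map ha
    rw [Functor.map_comp, Functor.map_comp] at this
    rw [Iso.trans_hom, Iso.trans_hom, Functor.mapIso_hom, Functor.mapIso_hom, Category.assoc]
    refine ((Category.assoc _ _ _).symm.trans (congr_arg (· ≫ _) this)).trans ?_
    exact (Category.assoc _ _ _).trans (congr_arg (_ ≫ ·) h₄)
  · have := congr_arg (precoverFunctor hreg c).map hb
    rw [Functor.map_comp, Functor.map_comp] at this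
    rw [Iso.trans_hom, Functor.mapIso_hom, Functor.mapIso_hom, Category.assoc]
    refine this.trans (congr_arg (_ ≫ ·) ?_)
    exact (Category.comp_id _).symm.trans h₅
  · -- `h₁` says that the connecting morphisms of `T` and of its lift correspond
    exact map_third_of_comparison (suspNatIso hreg c D D' hG hM) hc h₁

end Functor

end GorensteinMono

theorem theorem3p13 {S : Type u} [CommRing S] [IsNoetherianRing S] [IsLocalRing S] (ω : S)
    (hω : ω ∈ IsLocalRing.maximalIdeal S) (hreg : ω ∈ nonZeroDivisors S) :
    ∃ (hG : IsFrobenius (gprojConflations (FactorRing ω)))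
      (hM : IsFrobenius (monConflations ω)),
      (∀ M : GProj (FactorRing ω), Nonempty (PrecoverSequence ω M.obj)) ∧
      ∀ c : ∀ M : GProj (FactorRing ω), PrecoverSequence ω M.obj,
        ∃ T : Stable (gprojConflations (FactorRing ω)) ⥤ Stable (monConflations ω),
          -- the values of the functor on objects and on morphisms
          (∃ hT : ∀ M : GProj (FactorRing ω),
              T.obj ((toStable _).obj M) = (toStable _).obj (c M).obj,
            ∀ (M M' : GProj (FactorRing ω)) (f : M ⟶ M') (φ : (c M).obj ⟶ (c M').obj),
              IsLiftOf (c M) (c M') f.hom φ →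
              T.map ((toStable _).map f) =
                eqToHom (hT M) ≫ (toStable _).map φ ≫ eqToHom (hT M').symm) ∧
          T.Full ∧ T.Faithful ∧
          -- short exact sequences come from conflations
          (∀ A : ShortComplex (GProj (FactorRing ω)), gprojConflations (FactorRing ω) A →
            ∃ B : ShortComplex (Mon ω), monConflations ω B ∧
              ∃ (x₁ : T.obj ((toStable _).obj A.X₁) ≅ (toStable _).obj B.X₁)
                (x₂ : T.obj ((toStable _).obj A.X₂) ≅ (toStable _).obj B.X₂)
                (x₃ : T.obj ((toStable _).obj A.X₃) ≅ (toStable _).obj B.X₃),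
                T.map ((toStable _).map A.f) ≫ x₂.hom = x₁.hom ≫ (toStable _).map B.f ∧
                T.map ((toStable _).map A.g) ≫ x₃.hom = x₂.hom ≫ (toStable _).map B.g) ∧
          -- the functor is a triangle functor, for any choice of the suspensions
          ∀ (D : InjectiveEmbeddings (gprojConflations (FactorRing ω)))
            (D' : InjectiveEmbeddings (monConflations ω)), IsTriangleFunctor hG D hM D' T := by
  refine ⟨isFrobenius_gproj _, isFrobenius_mon hreg, nonempty_precoverSequence hreg, fun c =>
    ⟨precoverFunctor hreg c, ⟨fun _ => rfl, fun M M' f φ h => ?_⟩, precoverFunctor_full hreg c,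
      precoverFunctor_faithful hreg c, fun A hA => exists_conflation_iso hreg c hA,
      fun D D' => precoverFunctor_isTriangleFunctor hreg c D D' _ _⟩⟩
  exact (precoverFunctor_map hreg c h).trans
    ((Category.comp_id _).symm.trans (Category.id_comp _).symm)
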